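/- Let $V$ be the rank one free fermion vertex operator superalgebra: the Fock space with basis $\psi(-k_1)\cdots\psi(-k_m)\mathbf 1$ ($1\le k_1<\dots<k_m$), generated by an odd vector $\psi=\psi(-1)\mathbf 1$ of weight $\tfrac12$ with $Y(\psi,x)=\sum_{n\in\mathbb Z}\psi(n)x^{-n-1}$, $\psi(m)\psi(n)+\psi(n)\psi(m)=\delta_{m+n+1,0}$, $\psi(n)\mathbf 1=0$ for $n\ge 0$, central charge $c=\tfrac12$, and $L(0)$-weight $\sum_i(k_i-\tfrac12)$ of the above basis vector. Let $\sigma$ be the parity automorphism, $\tau\in\mathbb H$, $q=e^{2\pi i\tau}$, $q_z=e^z$, $z_{ij}=z_i-z_j$. For $v_1,\dots,v_n\in V$ put $q_i=e^{z_i}$ and $$F_V(g;(v_1,z_1),\dots,(v_n,z_n);\tau)=\mathrm{Tr}_V\big(\sigma\, g\,Y(q_1^{L(0)}v_1,q_1)\cdots Y(q_n^{L(0)}v_n,q_n)\,q^{L(0)-c/24}\big),$$ expanded as a series over the diagonal entries in the Fock basis and over the modes of the $n$ vertex operators. Put $Z_V(g,\tau)=\mathrm{Tr}_V(\sigma g\,q^{L(0)-c/24})$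 and $G_n(g;z_1,\dots,z_n;\tau)=F_V(g;(\psi,z_1),\dots,(\psi,z_n);\tau)$. Let $g=1$ and $\theta=1$, or $g=\sigma$ and $\theta=-1$. For $k\ge1$ let $P_k(z)=P_k\left[{\theta\atop -1}\right](z,\tau)$ be the analytic continuation to $\{|q|<|q_z|<|q|^{-1},\ q_z\ne 1\}$ of $$\frac{(-1)^k}{(k-1)!}\sum_{n\in\mathbb Z+\frac12}\frac{n^{k-1}q_z^n}{1-\theta^{-1}q^n}\qquad(|q|<|q_z|<1).$$ For $n\ge 1$ let $$E_n=E_n\left[{\theta\atop -1}\right](\tau)=-\frac{B_n(\frac12)}{n!}+\frac1{(n-1)!}\sum_{r\ge0}\frac{(r+\frac12)^{n-1}\theta^{-1}q^{r+\frac12}}{1-\theta^{-1}q^{r+\frac12}}+\frac{(-1)^n}{(n-1)!}\sum_{r\ge1}\frac{(r-\frac12)^{n-1}\theta q^{r-\frac12}}{1-\theta q^{r-\frac12}},$$ where $B_n(x)$ is the Bernoulli polynomial. For $k,l\ge1$ let $C(k,l)=(-1)^l\binom{k+l-2}{k-1}E_{k+l-1}$ and $D(k,l,z)=(-1)^{k+1}\binom{k+l-2}{k-1}P_{k+l-1}(z)$.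 Let $v[n]$ be the square bracket modes, $\sum_n v[n]z^{-n-1}=Y(q_z^{L(0)}v,q_z-1)$. Let $\mathcal D_n$ be the domain of all $(z_1,\dots,z_n)\in\mathbb C^n$ with $|q|<|q_{z_{ji}}|<1$ for all $i<j$. (1) Let $n$ be even. On $\mathcal D_n$, the matrix $\mathbf P$ with entries $P_1(z_{ij})$ for $i\ne j$ and zero diagonal is antisymmetric, and $$G_n(g;z_1,\dots,z_n;\tau)=\mathrm{Pf}(\mathbf P)\,Z_V(g,\tau).$$ (2) For $a=1,\dots,n$ let $\Psi[-\mathbf k^{(a)}]=\psi[-k^{(a)}_1]\cdots\psi[-k^{(a)}_{m_a}]\mathbf 1$ with integers $1\le k^{(a)}_1<\dots<k^{(a)}_{m_a}$. On $\mathcal D_n$, the function $F_V(g;(\Psi[-\mathbf k^{(1)}],z_1),\dots,(\Psi[-\mathbf k^{(n)}],z_n);\tau)$ vanishes if $\sum_a m_a$ is odd. If $\sum_a m_a$ is even it equals $\mathrm{Pf}(\mathbf M)\,Z_V(g,\tau)$, where $\mathbf M$ is the antisymmetric block matrix with diagonal blocks $\big(C(k^{(a)}_i,k^{(a)}_j)\big)_{i,j}$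 and off-diagonal blocks $\big(D(k^{(a)}_i,k^{(b)}_j,z_a-z_b)\big)_{i,j}$ for $a\ne b$. (3) The series for every function in (1) and (2) converges absolutely, and uniformly on compact subsets, on $\mathcal D_n$, and its sum is analytic there. In the even case of (2), $\mathrm{Pf}(\mathbf M)\,Z_V(g,\tau)$ is moreover analytic on the larger domain where $|q|<|q_{z_{ij}}|<|q|^{-1}$ and $q_{z_{ij}}\neq1$ for all $i\ne j$. -/

import Mathlib

/-! ### The rank one free fermion vertex operator superalgebra -/

namespace FreeFermion

/-- The Fock space `V`. The basis vector of a finite set `S = {i₁ < i₂ < … < iₘ}` of natural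
numbers is `ψ(-i₁-1) ψ(-i₂-1) ⋯ ψ(-iₘ-1) 𝟏`. -/
abbrev Fock : Type := Finset ℕ →₀ ℂ

/-- The Fock basis vector of `S`. -/
noncomputable def fockBasis (S : Finset ℕ) : Fock := Finsupp.single S 1

/-- The vacuum vector `𝟏`. -/
noncomputable def vacuum : Fock := fockBasis ∅

/-- The generating fermion `ψ = ψ(-1) 𝟏`. -/
noncomputable def fermion : Fock := fockBasis {0}

/-- `(-1)` to the number of elements of `S` below `i`. -/
noncomputable def orderSign (i : ℕ) (S : Finset ℕ) : ℂ := (-1) ^ (S.filter (· < i)).card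

/-- The mode `ψ(-i-1)`. -/
noncomputable def creation (i : ℕ) : Module.End ℂ Fock :=
  Finsupp.linearCombination ℂ fun S =>
    if i ∈ S then 0 else orderSign i S • fockBasis (insert i S)

/-- The mode `ψ(i)`. -/
noncomputable def annihilation (i : ℕ) : Module.End ℂ Fock :=
  Finsupp.linearCombination ℂ fun S =>
    if i ∈ S then orderSign i S • fockBasis (S.erase i) else 0

/-- The modes `ψ(n)`, `n ∈ ℤ`; they satisfy `ψ(m)ψ(n) + ψ(n)ψ(m) = δ_{m+n+1,0}`. -/
noncomputable def psi (n : ℤ) : Module.End ℂ Fock :=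
  if n < 0 then creation (-n - 1).toNat else annihilation n.toNat

/-- The parity automorphism `σ`. -/
noncomputable def parity : Module.End ℂ Fock :=
  Finsupp.linearCombination ℂ fun S => ((-1 : ℂ) ^ S.card) • fockBasis S

/-- The `L(0)`-weight `∑ (k - 1/2)` of a Fock basis vector (with `k = i + 1`). -/
noncomputable def weight (S : Finset ℕ) : ℂ := ∑ i ∈ S, ((i : ℂ) + 1 / 2)

/-- The sum of a family of operators of which only finitely many are non-zero on any given
basis vector. -/
noncomputable def pointwiseSum {ι : Type} (A : ι → Module.End ℂ Fock) : Module.End ℂ Fock :=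
  Finsupp.linearCombination ℂ fun T => ∑ᶠ j, A j (fockBasis T)

/-- The coefficient of `x^{-m-1}` in the right-nested normally ordered product
`:∂^{(i₁)}ψ(x) ∂^{(i₂)}ψ(x) ⋯ ∂^{(iᵣ)}ψ(x):` with `∂^{(i)} = (1/i!) (d/dx)^i`.

Here `∂^{(i)}ψ(x) = ∑_{j ≥ 0} binom(j,i) ψ(-j-1) x^{j-i}
  + (-1)^i ∑_{j ≥ 0} binom(j+i,i) ψ(j) x^{-j-i-1}`,
and `:A(x)B(x):` puts the creation part of `A` to the left of `B` and its annihilation part,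
with the sign of the exchange, to the right of `B`. -/
noncomputable def fieldMode : List ℕ → ℤ → Module.End ℂ Fock
  | [], m => if m = -1 then 1 else 0
  | i :: is, m =>
      pointwiseSum (fun j : ℕ =>
        ((j.choose i : ℕ) : ℂ) • (psi (-(j : ℤ) - 1) * fieldMode is (m + j - i)))
      + pointwiseSum (fun j : ℕ =>
        ((-1 : ℂ) ^ (i + is.length) * (((j + i).choose i : ℕ) : ℂ)) •
          (fieldMode is (m - j - i - 1) * psi (j : ℤ)))

/-- The modes `v(n)` of the vertex operator `Y(v,x) = ∑ v(n) x^{-n-1}`: for a basis vector it is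
the normally ordered product of divided derivatives of `ψ(x)`, extended linearly. -/
noncomputable def mode (v : Fock) (n : ℤ) : Module.End ℂ Fock :=
  Finsupp.linearCombination ℂ (fun S : Finset ℕ => fieldMode (S.sort (· ≤ ·)) n) v

/-! ### Square bracket vertex operators -/

/-- The coefficient of `z^{-n-1}` in the Laurent series of `e^{wz} (e^z - 1)^{-m-1}`. -/
noncomputable def squareCoeff (w : ℂ) (n m : ℤ) : ℂ :=
  ((HahnSeries.ofPowerSeries ℤ ℂ (PowerSeries.rescale w (PowerSeries.exp ℂ))) *
    (HahnSeries.ofPowerSeries ℤ ℂ (PowerSeries.exp ℂ - 1) : LaurentSeries ℂ) ^ (-m - 1)).coeff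
      (-n - 1)

/-- The modes `v[n]` of `Y[v,z] = ∑ v[n] z^{-n-1} = Y(e^{z L(0)} v, e^z - 1)`. -/
noncomputable def squareMode (v : Fock) (n : ℤ) : Module.End ℂ Fock :=
  Finsupp.linearCombination ℂ (fun S : Finset ℕ =>
    pointwiseSum fun m : ℤ => squareCoeff (weight S) n m • mode (fockBasis S) m) v

/-- The square bracket Fock vector `ψ[-k₁] ψ[-k₂] ⋯ ψ[-kₘ] 𝟏`. -/
noncomputable def squareFock {m : ℕ} (k : Fin m → ℕ) : Fock :=
  (List.ofFn fun i => squareMode fermion (-(k i : ℤ))).prod vacuum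

/-! ### Supertraces and torus `n`-point functions -/

/-- `q^{L(0) - c/24}` with `q = e^{2πiτ}` and `c = 1/2`. -/
noncomputable def qL0 (τ : UpperHalfPlane) : Module.End ℂ Fock :=
  Finsupp.linearCombination ℂ fun T =>
    Complex.exp (2 * Real.pi * Complex.I * τ * (weight T - 1 / 48)) • fockBasis T

/-- The diagonal entry at the basis vector of `T` of `σ A`, so that `STr A = ∑_T`. -/
noncomputable def supertraceTerm (A : Module.End ℂ Fock) (T : Finset ℕ) : ℂ :=
  (parity * A) (fockBasis T) T

/-- `Z_V(g,τ) = STr (g q^{L(0) - c/24})`. -/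
noncomputable def partitionFunction (g : Module.End ℂ Fock) (τ : UpperHalfPlane) : ℂ :=
  ∑' T : Finset ℕ, supertraceTerm (g * qL0 τ) T

/-- The `n`-th summand `∑_S v_S e^{(wt S - n - 1) z} S(n)` of
`Y(e^{z L(0)} v, e^z) = ∑_n (e^{z L(0)} v)(n) e^{-(n+1) z}`. -/
noncomputable def vertexTerm (v : Fock) (z : ℂ) (n : ℤ) : Module.End ℂ Fock :=
  Finsupp.linearCombination ℂ (fun S : Finset ℕ =>
    Complex.exp ((weight S - n - 1) * z) • mode (fockBasis S) n) v

/-- The summands of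
`STr (g Y(q₁^{L(0)} v₁, q₁) ⋯ Y(qₙ^{L(0)} vₙ, qₙ) q^{L(0) - c/24})`, `qᵢ = e^{zᵢ}`, indexed by the
basis vector at which the diagonal entry is taken and by the modes of the `n` vertex operators. -/
noncomputable def nPointTerm {n : ℕ} (g : Module.End ℂ Fock) (v : Fin n → Fock)
    (τ : UpperHalfPlane) (p : Finset ℕ × (Fin n → ℤ)) (z : Fin n → ℂ) : ℂ :=
  supertraceTerm
    (g * (List.ofFn fun i => vertexTerm (v i) (z i) (p.2 i)).prod * qL0 τ) p.1

/-- The `n`-point function `F_V(g; (v₁,z₁), …, (vₙ,zₙ); τ)`. -/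
noncomputable def nPoint {n : ℕ} (g : Module.End ℂ Fock) (v : Fin n → Fock)
    (τ : UpperHalfPlane) (z : Fin n → ℂ) : ℂ :=
  ∑' p : Finset ℕ × (Fin n → ℤ), nPointTerm g v τ p z

/-- The generating function `G_n(g; z₁, …, zₙ; τ)`. -/
noncomputable def generatingFunction (n : ℕ) (g : Module.End ℂ Fock)
    (τ : UpperHalfPlane) (z : Fin n → ℂ) : ℂ :=
  nPoint g (fun _ : Fin n => fermion) τ z

/-! ### Twisted Weierstrass functions and Eisenstein series -/

/-- `q^x = e^{2πiτx}`. -/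
noncomputable def qPow (τ : UpperHalfPlane) (x : ℂ) : ℂ :=
  Complex.exp (2 * Real.pi * Complex.I * τ * x)

/-- The series
`(-1)^k/(k-1)! ∑'_{n ∈ ℤ + lam} n^{k-1} e^{nz} / (1 - θ⁻¹ q^n)`, which converges for
`|q| < |e^z| < 1`; the prime means that `n = 0` is omitted if `(θ, e^{2πi lam}) = (1,1)`
(where `0 ≤ lam < 1`). -/
noncomputable def twistedSeries (θ : ℂ) (lam : ℝ) (k : ℕ) (τ : UpperHalfPlane) (z : ℂ) : ℂ :=
  (-1) ^ k / ((k - 1).factorial : ℂ) * ∑' n : ℤ,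
    if θ = 1 ∧ lam = 0 ∧ n = 0 then 0
    else ((n : ℂ) + lam) ^ (k - 1) * Complex.exp (((n : ℂ) + lam) * z) /
      (1 - θ⁻¹ * qPow τ ((n : ℂ) + lam))

/-- The strip `|q| < |e^z| < |q|⁻¹` without the points `2πiℤ`; it is connected. -/
def puncturedStrip (τ : UpperHalfPlane) : Set ℂ :=
  {z | ‖qPow τ 1‖ < ‖Complex.exp z‖ ∧ ‖Complex.exp z‖ < ‖qPow τ 1‖⁻¹ ∧ Complex.exp z ≠ 1}

/-- `f` is the analytic continuation of `twistedSeries` from `|q| < |e^z| < 1` to the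
punctured strip. -/
def IsContinuation (θ : ℂ) (lam : ℝ) (k : ℕ) (τ : UpperHalfPlane) (f : ℂ → ℂ) : Prop :=
  AnalyticOnNhd ℂ f (puncturedStrip τ) ∧
    ∀ z : ℂ, ‖qPow τ 1‖ < ‖Complex.exp z‖ → ‖Complex.exp z‖ < 1 →
      f z = twistedSeries θ lam k τ z

open Classical in
/-- The twisted Weierstrass function `P_k[θ;φ](z,τ)`, `φ = e^{2πi lam}`, on the punctured strip:
the (unique) analytic continuation of its defining series. -/
noncomputable def twistedWeierstrass (θ : ℂ) (lam : ℝ) (k : ℕ) (τ : UpperHalfPlane) (z : ℂ) : ℂ :=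
  if h : ∃ f : ℂ → ℂ, IsContinuation θ lam k τ f then h.choose z else 0

/-- The twisted Eisenstein series `E_n[θ;φ](τ)`, `φ = e^{2πi lam}`, `0 ≤ lam < 1`, `n ≥ 1`. -/
noncomputable def twistedEisenstein (θ : ℂ) (lam : ℝ) (n : ℕ) (τ : UpperHalfPlane) : ℂ :=
  -(Polynomial.aeval (lam : ℂ) (Polynomial.bernoulli n)) / (n.factorial : ℂ)
  + 1 / ((n - 1).factorial : ℂ) * ∑' r : ℕ,
      (if θ = 1 ∧ lam = 0 ∧ r = 0 then 0
       else ((r : ℂ) + lam) ^ (n - 1) * (θ⁻¹ * qPow τ ((r : ℂ) + lam)) /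
        (1 - θ⁻¹ * qPow τ ((r : ℂ) + lam)))
  + (-1) ^ n / ((n - 1).factorial : ℂ) * ∑' r : ℕ,
      ((r : ℂ) + 1 - lam) ^ (n - 1) * (θ * qPow τ ((r : ℂ) + 1 - lam)) /
        (1 - θ * qPow τ ((r : ℂ) + 1 - lam))

/-- `C[θ;φ](k,l,τ)`, `k, l ≥ 1`. -/
noncomputable def coeffC (θ : ℂ) (lam : ℝ) (k l : ℕ) (τ : UpperHalfPlane) : ℂ :=
  (-1) ^ l * (((k + l - 2).choose (k - 1) : ℕ) : ℂ) * twistedEisenstein θ lam (k + l - 1) τ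

/-- `D[θ;φ](k,l,τ,z)`, `k, l ≥ 1`. -/
noncomputable def coeffD (θ : ℂ) (lam : ℝ) (k l : ℕ) (τ : UpperHalfPlane) (z : ℂ) : ℂ :=
  (-1) ^ (k + 1) * (((k + l - 2).choose (k - 1) : ℕ) : ℂ) *
    twistedWeierstrass θ lam (k + l - 1) τ z

/-! ### Pfaffians -/

/-- The permutation `(i₁, j₁, i₂, j₂, …)` of `0, …, N-1` satisfies `iₐ < jₐ` and
`i₁ < i₂ < ⋯`; for even `N` these are the partitions into pairs. -/
def IsPairing {N : ℕ} (s : Equiv.Perm (Fin N)) : Prop :=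
  (∀ a : Fin (N / 2), s ⟨2 * a, by omega⟩ < s ⟨2 * a + 1, by omega⟩) ∧
  (∀ a b : Fin (N / 2), a < b → s ⟨2 * a, by omega⟩ < s ⟨2 * b, by omega⟩)

open Classical in
/-- The Pfaffian of an antisymmetric matrix of even size. -/
noncomputable def pfaffian {N : ℕ} (M : Matrix (Fin N) (Fin N) ℂ) : ℂ :=
  ∑ s : Equiv.Perm (Fin N), if IsPairing s then
    ((Equiv.Perm.sign s : ℤ) : ℂ) *
      ∏ a : Fin (N / 2), M (s ⟨2 * a, by omega⟩) (s ⟨2 * a + 1, by omega⟩)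
  else 0

/-- The matrix `𝐏` with entries `P₁[θ;-1](zᵢ - zⱼ, τ)` for `i ≠ j`. -/
noncomputable def matrixP {n : ℕ} (θ : ℂ) (τ : UpperHalfPlane) (z : Fin n → ℂ) :
    Matrix (Fin n) (Fin n) ℂ :=
  Matrix.of fun i j => if i = j then 0 else twistedWeierstrass θ (1 / 2) 1 τ (z i - z j)

/-- The block matrix `𝐌` with diagonal blocks `C[θ;-1](kᵢ⁽ᵃ⁾, kⱼ⁽ᵃ⁾, τ)` and off-diagonal blocks
`D[θ;-1](kᵢ⁽ᵃ⁾, kⱼ⁽ᵇ⁾, τ, z_a - z_b)`; rows and columns are ordered by block, then by position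
in the block. -/
noncomputable def matrixM {n : ℕ} {m : Fin n → ℕ} (θ : ℂ) (k : (a : Fin n) → Fin (m a) → ℕ)
    (τ : UpperHalfPlane) (z : Fin n → ℂ) : Matrix (Fin (∑ a, m a)) (Fin (∑ a, m a)) ℂ :=
  Matrix.reindex finSigmaFinEquiv finSigmaFinEquiv <| Matrix.of
    fun (x y : (a : Fin n) × Fin (m a)) =>
      if x.1 = y.1 then coeffC θ (1 / 2) (k x.1 x.2) (k y.1 y.2) τ
      else coeffD θ (1 / 2) (k x.1 x.2) (k y.1 y.2) τ (z x.1 - z y.1)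

/-! ### Domains and convergence -/

/-- The domain `|q| < |e^{z_j - z_i}| < 1` for all `i < j`. -/
def orderedDomain (n : ℕ) (τ : UpperHalfPlane) : Set (Fin n → ℂ) :=
  {z | ∀ i j : Fin n, i < j →
    ‖qPow τ 1‖ < ‖Complex.exp (z j - z i)‖ ∧ ‖Complex.exp (z j - z i)‖ < 1}

/-- The domain on which all differences `z_i - z_j` (`i ≠ j`) lie in the punctured strip. -/
def fullDomain (n : ℕ) (τ : UpperHalfPlane) : Set (Fin n → ℂ) :=
  {z | ∀ i j : Fin n, i ≠ j → z i - z j ∈ puncturedStrip τ}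

/-- The series defining the `n`-point function converges absolutely, and uniformly on compact
subsets, on the ordered domain, and its sum is analytic there. -/
def ConvergesAnalytically {n : ℕ} (g : Module.End ℂ Fock) (v : Fin n → Fock)
    (τ : UpperHalfPlane) : Prop :=
  (∀ z ∈ orderedDomain n τ, Summable fun p => ‖nPointTerm g v τ p z‖) ∧
  (∀ K : Set (Fin n → ℂ), K ⊆ orderedDomain n τ → IsCompact K →
    HasSumUniformlyOn (nPointTerm g v τ) (nPoint g v τ) K) ∧
  AnalyticOnNhd ℂ (nPoint g v τ) (orderedDomain n τ)

end FreeFermion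

namespace FreeFermion

/-! ### Fermionic operators on functions of finite sets -/

/-! The proof is Zhu's recursion for a free field, carried out with infinite matrices in the Fock
basis. Three algebraic facts drive it.

Cyclicity: moving `ψ(m)` once around the trace against `σ g q^{L(0)-c/24}` multiplies it by `θ
q^{m+1/2}`. Hence the trace of `ψ(m) K` is `1/(1 - θ q^{m+1/2})` times the trace of the graded
commutator `[ψ(m), K]` (`torusTrace_leftMul`).

Commutators: `[ψ(m), ·]` is a superderivation of matrix products (`gradedComm_kernelMul`). On the
vertex operator of a square bracket vector at `z` it removes one fermion `ψ[-p-1]` at a time, with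
coefficient `(m+1/2)^p/p! · e^{(m+1/2)z}` (`gradedComm_vertexKernel_squareVector`,
`gradedComm_twist`). The source is `e^{x/2} (1 + (e^x - 1))^m = e^{(m+1/2)x}`: square bracket modes
diagonalise the binomial coefficients of the commutator formula.

Splitting: the vertex operator of `ψ[-p-1] v` is a normally ordered product of a field with that of
`v`, plus contractions of `ψ[-p-1]` with the fermions of `v`, whose values are Bernoulli numbers
`B_n(1/2)/n!` up to sign and binomial factor (`vertexKernel_squareVector_cons`, `contraction_eq`).

Summed over the modes of the normally ordered field, pairings with fermions at other points give the
series of `P_k`, that is `D`, while pairings inside the same block give `C` minus the contraction.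
The contractions cancel, and the recursion `blockTrace_cons` is exactly the expansion of a Pfaffian
along its first row (`pfaffian_succ`, `pfaffian_eq_pfList`). With an odd number of fermions it ends
in an empty sum.

Convergence: matrix entries of vertex operators grow subexponentially in the weights, and inserting
at `z` multiplies them by `e^{(wt S - wt T) z}`. Products converge because the real parts of the
`z_i` decrease, and the trace converges because their total spread is less than `2π Im τ`; together
these conditions are the ordered domain (`exists_majorant`, `tsum_traceWeight_ne_top`). Analyticity
of the sum is then read off from the Pfaffian, whose entries are analytic on the larger domain. -/

/-- Add `j` to `S` or remove it. -/
def toggle (j : ℕ) (S : Finset ℕ) : Finset ℕ := if j ∈ S then S.erase j else insert j S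

lemma mem_toggle_self (j : ℕ) (S : Finset ℕ) : j ∈ toggle j S ↔ j ∉ S := by
  unfold toggle; split_ifs with h <;> simp [h]

lemma mem_toggle_of_ne {i j : ℕ} (h : i ≠ j) (S : Finset ℕ) : i ∈ toggle j S ↔ i ∈ S := by
  unfold toggle; split_ifs with hj <;> simp [h]

lemma toggle_of_mem {j : ℕ} {S : Finset ℕ} (h : j ∈ S) : toggle j S = S.erase j := by
  simp [toggle, h]

lemma toggle_of_notMem {j : ℕ} {S : Finset ℕ} (h : j ∉ S) : toggle j S = insert j S := by
  simp [toggle, h]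

lemma toggle_toggle (j : ℕ) (S : Finset ℕ) : toggle j (toggle j S) = S := by
  ext i
  by_cases h : i = j
  · subst h; simp [mem_toggle_self]
  · simp [mem_toggle_of_ne h]

lemma toggle_comm (i j : ℕ) (S : Finset ℕ) : toggle i (toggle j S) = toggle j (toggle i S) := by
  by_cases hij : i = j
  · rw [hij]
  ext k
  by_cases hi : k = i
  · subst hi; simp [mem_toggle_self, mem_toggle_of_ne hij]
  · by_cases hj : k = j
    · subst hj; simp [mem_toggle_self, mem_toggle_of_ne hi]
    · simp [mem_toggle_of_ne hi, mem_toggle_of_ne hj]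

/-- `toggle j` as an involution. -/
def toggleEquiv (j : ℕ) : Finset ℕ ≃ Finset ℕ where
  toFun := toggle j
  invFun := toggle j
  left_inv := toggle_toggle j
  right_inv := toggle_toggle j

lemma card_toggle_sign (j : ℕ) (S : Finset ℕ) :
    (-1 : ℂ) ^ (toggle j S).card = -(-1) ^ S.card := by
  by_cases h : j ∈ S
  · rw [toggle_of_mem h, ← Finset.card_erase_add_one h, pow_succ]; ring
  · rw [toggle_of_notMem h, Finset.card_insert_of_notMem h, pow_succ]; ring

lemma filter_toggle (i j : ℕ) (S : Finset ℕ) :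
    (toggle j S).filter (· < i) = if j < i then toggle j (S.filter (· < i))
      else S.filter (· < i) := by
  ext k
  split_ifs with h
  · by_cases hk : k = j
    · subst hk; simp [mem_toggle_self, h]
    · simp [mem_toggle_of_ne hk]
  · by_cases hk : k = j
    · subst hk; simp [h]
    · simp [mem_toggle_of_ne hk]

lemma orderSign_toggle (i j : ℕ) (S : Finset ℕ) :
    orderSign i (toggle j S) = if j < i then -orderSign i S else orderSign i S := by
  unfold orderSign
  rw [filter_toggle]
  split_ifs
  · rw [card_toggle_sign]
  · rfl

lemma orderSign_toggle_self (j : ℕ) (S : Finset ℕ) : orderSign j (toggle j S) = orderSign j S := by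
  simp [orderSign_toggle]

lemma orderSign_mul_self (j : ℕ) (S : Finset ℕ) : orderSign j S * orderSign j S = 1 := by
  unfold orderSign; rw [← mul_pow]; simp

/-- Toggling the smaller level flips the sign seen by the larger one but not conversely; this
asymmetry is the source of anticommutation. -/
lemma orderSign_exchange {i j : ℕ} (h : i ≠ j) (S : Finset ℕ) :
    orderSign i S * orderSign j (toggle i S) = -(orderSign j S * orderSign i (toggle j S)) := by
  rw [orderSign_toggle, orderSign_toggle]
  rcases lt_or_gt_of_ne h with h | h
  · simp [h, h.le, not_lt.mpr]; ring
  · simp [h, h.le, not_lt.mpr]; ring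

/-- The creation (`b = true`) or annihilation (`b = false`) operator of level `j` on functions of
finite sets. -/
noncomputable def op (b : Bool) (j : ℕ) (f : Finset ℕ → ℂ) (S : Finset ℕ) : ℂ :=
  if decide (j ∈ S) = b then orderSign j S * f (toggle j S) else 0

lemma decide_mem_toggle (j : ℕ) (S : Finset ℕ) : decide (j ∈ toggle j S) = !decide (j ∈ S) := by
  simp [mem_toggle_self]

lemma op_op_of_ne {i j : ℕ} (h : i ≠ j) (b b' : Bool) (f : Finset ℕ → ℂ) (S : Finset ℕ) :
    op b i (op b' j f) S = -op b' j (op b i f) S := by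
  simp only [op, mem_toggle_of_ne h, mem_toggle_of_ne h.symm]
  split_ifs with h1 h2
  · rw [← mul_assoc, ← mul_assoc, orderSign_exchange h, toggle_comm]; ring
  all_goals simp

lemma op_op_same (b : Bool) (j : ℕ) (f : Finset ℕ → ℂ) (S : Finset ℕ) :
    op b j (op b j f) S = 0 := by
  simp only [op, decide_mem_toggle]
  split_ifs with h1 h2
  · rw [h1] at h2; simp at h2
  all_goals simp

lemma op_op_not (b : Bool) (j : ℕ) (f : Finset ℕ → ℂ) (S : Finset ℕ) :
    op b j (op (!b) j f) S = if decide (j ∈ S) = b then f S else 0 := by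
  simp only [op, decide_mem_toggle]
  split_ifs with h1 h2
  · rw [← mul_assoc, orderSign_toggle_self, orderSign_mul_self, one_mul, toggle_toggle]
  · rw [h1] at h2; simp at h2
  · rfl

lemma op_op_not_add (b : Bool) (j : ℕ) (f : Finset ℕ → ℂ) (S : Finset ℕ) :
    op b j (op (!b) j f) S + op (!b) j (op b j f) S = f S := by
  rw [op_op_not]
  have := op_op_not (!b) j f S
  rw [Bool.not_not] at this
  rw [this]
  cases b <;> by_cases h : j ∈ S <;> simp [h]

/-- The level of a fermionic mode. -/
def level (m : ℤ) : ℕ := if m < 0 then (-m - 1).toNat else m.toNat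

/-- The action of `ψ(m)` on functions of finite sets. -/
noncomputable def psiFun (m : ℤ) (f : Finset ℕ → ℂ) : Finset ℕ → ℂ := op (decide (m < 0)) (level m) f

lemma psiFun_natCast (j : ℕ) : psiFun (j : ℤ) = op false j := by
  have h : ¬((j : ℤ) < 0) := by omega
  funext f; simp [psiFun, level, h]

lemma psiFun_neg (j : ℕ) : psiFun (-(j : ℤ) - 1) = op true j := by
  have h : -(j : ℤ) - 1 < 0 := by omega
  funext f; simp [psiFun, level, h]

lemma exists_mode (m : ℤ) : ∃ j : ℕ, m = j ∨ m = -(j : ℤ) - 1 := by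
  rcases lt_or_ge m 0 with h | h
  · exact ⟨(-m - 1).toNat, Or.inr (by omega)⟩
  · exact ⟨m.toNat, Or.inl (by omega)⟩

/-- The modes `m` and `-m-1` are the two operators of one level, so `m + n + 1 = 0` means same level
and opposite type. -/
lemma psiFun_anticomm (m n : ℤ) (f : Finset ℕ → ℂ) (S : Finset ℕ) :
    psiFun m (psiFun n f) S + psiFun n (psiFun m f) S = if m + n + 1 = 0 then f S else 0 := by
  obtain ⟨i, rfl | rfl⟩ := exists_mode m <;> obtain ⟨j, rfl | rfl⟩ := exists_mode n <;>
    simp only [psiFun_natCast, psiFun_neg]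
  · rw [if_neg (by omega)]
    by_cases h : i = j
    · subst h; simp [op_op_same]
    · rw [op_op_of_ne h]; ring
  · by_cases h : i = j
    · subst h; rw [if_pos (by omega)]; exact op_op_not_add false i f S
    · rw [if_neg (by omega), op_op_of_ne h]; ring
  · by_cases h : i = j
    · subst h; rw [if_pos (by omega)]; exact op_op_not_add true i f S
    · rw [if_neg (by omega), op_op_of_ne h]; ring
  · rw [if_neg (by omega)]
    by_cases h : i = j
    · subst h; simp [op_op_same]
    · rw [op_op_of_ne h]; ring

lemma op_add (b : Bool) (j : ℕ) (f g : Finset ℕ → ℂ) : op b j (f + g) = op b j f + op b j g := by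
  funext S; simp only [op, Pi.add_apply]; split_ifs <;> ring

lemma op_smul (b : Bool) (j : ℕ) (c : ℂ) (f : Finset ℕ → ℂ) : op b j (c • f) = c • op b j f := by
  funext S; simp only [op, Pi.smul_apply, smul_eq_mul]; split_ifs <;> ring

/-- Creation and annihilation at one level are transposes of each other. The identity is a
reindexing by `toggle j`, so no summability is involved. -/
lemma tsum_op_mul (b : Bool) (j : ℕ) (f g : Finset ℕ → ℂ) :
    ∑' T, op b j f T * g T = ∑' T, f T * op (!b) j g T := by
  rw [← (toggleEquiv j).tsum_eq (fun T => op b j f T * g T)]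
  refine tsum_congr fun T => ?_
  change op b j f (toggle j T) * g (toggle j T) = _
  simp only [op, decide_mem_toggle, orderSign_toggle_self, toggle_toggle]
  have : ((!decide (j ∈ T)) = b) ↔ (decide (j ∈ T) = !b) := by
    cases b <;> by_cases h : j ∈ T <;> simp [h]
  simp only [this]
  split_ifs <;> ring

/-! ### Kernels -/

/-- Matrices indexed by the Fock basis. -/
abbrev Kernel : Type := Finset ℕ → Finset ℕ → ℂ

/-- Conjugation of a matrix by the parity operator. -/
noncomputable def parityConj (K : Kernel) : Kernel := fun S T => (-1) ^ (S.card + T.card) * K S T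

/-- Left multiplication by `ψ(m)`. -/
noncomputable def leftMul (m : ℤ) : Module.End ℂ Kernel where
  toFun K S T := psiFun m (fun S' => K S' T) S
  map_add' K K' := by
    funext S T
    exact congrFun (op_add _ _ (fun S' => K S' T) (fun S' => K' S' T)) S
  map_smul' c K := by
    funext S T
    exact congrFun (op_smul _ _ c (fun S' => K S' T)) S

/-- Right multiplication by `ψ(m)` after conjugation by the parity operator. -/
noncomputable def rightMul (m : ℤ) : Module.End ℂ Kernel where
  toFun K S T := psiFun (-m - 1) (fun T' => parityConj K S T') T
  map_add' K K' := by
    funext S T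
    rw [show (fun T' => parityConj (K + K') S T')
      = (fun T' => parityConj K S T') + fun T' => parityConj K' S T' from by
        funext T'; simp [parityConj, mul_add]]
    exact congrFun (op_add _ _ _ _) T
  map_smul' c K := by
    funext S T
    rw [show (fun T' => parityConj (c • K) S T') = c • (fun T' => parityConj K S T') from by
        funext T'; simp [parityConj]; ring]
    exact congrFun (op_smul _ _ _ _) T

lemma leftMul_apply (m : ℤ) (K : Kernel) (S T : Finset ℕ) :
    leftMul m K S T = psiFun m (fun S' => K S' T) S := rfl

lemma rightMul_apply (m : ℤ) (K : Kernel) (S T : Finset ℕ) :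
    rightMul m K S T = psiFun (-m - 1) (fun T' => parityConj K S T') T := rfl

lemma leftMul_anticomm (m n : ℤ) (K : Kernel) :
    leftMul m (leftMul n K) + leftMul n (leftMul m K) = if m + n + 1 = 0 then K else 0 := by
  funext S T
  have := psiFun_anticomm m n (fun S' => K S' T) S
  simp only [Pi.add_apply, leftMul_apply]
  rw [this]
  split_ifs <;> rfl

lemma op_parityConj (b : Bool) (j : ℕ) (K : Kernel) (S T : Finset ℕ) :
    op b j (fun T' => parityConj K S T') T =
      -((-1) ^ (S.card + T.card) * op b j (fun T' => K S T') T) := by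
  simp only [op, parityConj, pow_add, card_toggle_sign]
  split_ifs <;> ring

/-- The parity sign can be pulled out at the price of a minus, because the mode changes the
cardinality of `T` by one. -/
lemma rightMul_apply' (m : ℤ) (K : Kernel) (S T : Finset ℕ) :
    rightMul m K S T = -((-1) ^ (S.card + T.card) * psiFun (-m - 1) (fun T' => K S T') T) :=
  op_parityConj _ _ _ _ _

lemma rightMul_rightMul (m n : ℤ) (K : Kernel) (S T : Finset ℕ) :
    rightMul m (rightMul n K) S T =
      -psiFun (-m - 1) (psiFun (-n - 1) (fun T' => K S T')) T := by
  rw [rightMul_apply']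
  have : (fun T' => rightMul n K S T') =
      fun T' => -parityConj (fun S T => psiFun (-n - 1) (fun T' => K S T') T) S T' := by
    funext T'; rw [rightMul_apply']; rfl
  rw [this]
  have h2 : ∀ f : Finset ℕ → ℂ, (fun T' => -f T') = (-1 : ℂ) • f := by intro f; funext; simp
  rw [h2 (fun T' => parityConj _ S T')]
  unfold psiFun
  rw [op_smul, Pi.smul_apply, op_parityConj]
  have : ((-1 : ℂ) ^ (S.card + T.card)) * (-1) ^ (S.card + T.card) = 1 := by
    rw [← mul_pow]; simp
  rw [smul_eq_mul]
  linear_combination (-(op (decide (-m - 1 < 0)) (level (-m - 1))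
    (fun T' => op (decide (-n - 1 < 0)) (level (-n - 1)) (fun T' => K S T') T') T)) * this

/-- The sign is opposite to that of `leftMul_anticomm`, owing to the parity conjugation. This is
what makes the difference `gradedComm` have the same anticommutator with left and with right
multiplications. -/
lemma rightMul_anticomm (m n : ℤ) (K : Kernel) :
    rightMul m (rightMul n K) + rightMul n (rightMul m K) = if m + n + 1 = 0 then -K else 0 := by
  funext S T
  have := psiFun_anticomm (-m - 1) (-n - 1) (fun T' => K S T') T
  rw [Pi.add_apply, Pi.add_apply, rightMul_rightMul, rightMul_rightMul, ← neg_add, this]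
  by_cases h : m + n + 1 = 0
  · rw [if_pos h, if_pos (by omega)]; rfl
  · rw [if_neg h, if_neg (by omega)]; simp

lemma leftMul_rightMul_anticomm (m n : ℤ) (K : Kernel) :
    leftMul m (rightMul n K) + rightMul n (leftMul m K) = 0 := by
  funext S T
  rw [Pi.add_apply, Pi.add_apply, rightMul_apply']
  simp only [leftMul_apply, rightMul_apply', psiFun, op, pow_add, card_toggle_sign]
  split_ifs <;> (simp; try ring)

/-- The graded commutator with `ψ(m)`. -/
noncomputable def gradedComm (m : ℤ) : Module.End ℂ Kernel := leftMul m - rightMul m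

/-- The truncation of `normalOp w` to levels below `N`. -/
noncomputable def normalOpTrunc (w : ℤ → ℂ) (N : ℕ) : Module.End ℂ Kernel :=
  ∑ j ∈ Finset.range N,
    (w j • leftMul (-(j : ℤ) - 1) + w (-(j : ℤ) - 1) • rightMul j)

/-- The normally ordered multiplication by the field `∑ w(m) ψ(-m-1)`: creation operators act from
the left, annihilation operators from the right. -/
noncomputable def normalOp (w : ℤ → ℂ) (K : Kernel) : Kernel := fun S T =>
  ∑ j ∈ S, w j * leftMul (-(j : ℤ) - 1) K S T + ∑ j ∈ T, w (-(j : ℤ) - 1) * rightMul j K S T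

lemma leftMul_neg_apply (j : ℕ) (K : Kernel) (S T : Finset ℕ) :
    leftMul (-(j : ℤ) - 1) K S T = if j ∈ S then orderSign j S * K (S.erase j) T else 0 := by
  rw [leftMul_apply, psiFun_neg]
  by_cases h : j ∈ S <;> simp [op, h, toggle_of_mem]

lemma leftMul_natCast_apply (j : ℕ) (K : Kernel) (S T : Finset ℕ) :
    leftMul (j : ℤ) K S T = if j ∈ S then 0 else orderSign j S * K (insert j S) T := by
  rw [leftMul_apply, psiFun_natCast]
  by_cases h : j ∈ S <;> simp [op, h, toggle_of_notMem]

lemma rightMul_natCast_apply (j : ℕ) (K : Kernel) (S T : Finset ℕ) :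
    rightMul (j : ℤ) K S T =
      if j ∈ T then orderSign j T * parityConj K S (T.erase j) else 0 := by
  rw [rightMul_apply, psiFun_neg]
  by_cases h : j ∈ T <;> simp [op, h, toggle_of_mem]

/-- A creation operator on the left only sees levels of `S`, and an annihilation operator on the
right only levels of `T`. Every entry of the infinite normally ordered sum therefore agrees with one
of a finite sum of linear maps, where the Clifford relations apply directly. -/
lemma normalOp_eq_trunc (w : ℤ → ℂ) (K : Kernel) {N : ℕ} {S T : Finset ℕ}
    (hS : S ⊆ Finset.range N) (hT : T ⊆ Finset.range N) :
    normalOp w K S T = normalOpTrunc w N K S T := by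
  simp only [normalOp, normalOpTrunc, LinearMap.sum_apply, LinearMap.add_apply,
    LinearMap.smul_apply, Finset.sum_apply, Pi.add_apply, Pi.smul_apply, smul_eq_mul,
    Finset.sum_add_distrib]
  congr 1
  · refine Finset.sum_subset hS fun j _ hj => ?_
    simp [leftMul_neg_apply, hj]
  · refine Finset.sum_subset hT fun j _ hj => ?_
    simp [rightMul_natCast_apply, hj]

lemma gradedComm_leftMul (m n : ℤ) (K : Kernel) :
    gradedComm m (leftMul n K) + leftMul n (gradedComm m K) = if m + n + 1 = 0 then K else 0 := by
  simp only [gradedComm, LinearMap.sub_apply, map_sub]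
  rw [← leftMul_anticomm m n K]
  have := leftMul_rightMul_anticomm n m K
  linear_combination (norm := module) (-1 : ℂ) • this

lemma gradedComm_rightMul (m n : ℤ) (K : Kernel) :
    gradedComm m (rightMul n K) + rightMul n (gradedComm m K) = if m + n + 1 = 0 then K else 0 := by
  simp only [gradedComm, LinearMap.sub_apply, map_sub]
  have h1 := rightMul_anticomm m n K
  have h2 := leftMul_rightMul_anticomm m n K
  have h3 : (if m + n + 1 = 0 then K else 0) = -(if m + n + 1 = 0 then -K else 0) := by
    split_ifs <;> simp
  rw [h3, ← h1]
  linear_combination (norm := module) (1 : ℂ) • h2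

lemma gradedComm_normalOpTrunc (m : ℤ) (w : ℤ → ℂ) {N : ℕ} (hN : level m < N) (K : Kernel) :
    gradedComm m (normalOpTrunc w N K) + normalOpTrunc w N (gradedComm m K) = w m • K := by
  simp only [normalOpTrunc, LinearMap.sum_apply, LinearMap.add_apply, LinearMap.smul_apply,
    map_sum, map_add, map_smul, ← Finset.sum_add_distrib]
  have : ∀ j : ℕ, (w j • gradedComm m (leftMul (-(j : ℤ) - 1) K)
      + w (-(j : ℤ) - 1) • gradedComm m (rightMul j K))
      + (w j • leftMul (-(j : ℤ) - 1) (gradedComm m K)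
      + w (-(j : ℤ) - 1) • rightMul j (gradedComm m K)) =
      if j = level m then w m • K else 0 := by
    intro j
    have e1 := gradedComm_leftMul m (-(j : ℤ) - 1) K
    have e2 := gradedComm_rightMul m j K
    have e3 : (w j • gradedComm m (leftMul (-(j : ℤ) - 1) K)
      + w (-(j : ℤ) - 1) • gradedComm m (rightMul j K))
      + (w j • leftMul (-(j : ℤ) - 1) (gradedComm m K)
      + w (-(j : ℤ) - 1) • rightMul j (gradedComm m K)) =
      w j • (if m + (-(j : ℤ) - 1) + 1 = 0 then K else 0)
        + w (-(j : ℤ) - 1) • (if m + (j : ℤ) + 1 = 0 then K else 0) := by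
      rw [← e1, ← e2, smul_add, smul_add]; abel
    rw [e3]
    obtain ⟨i, rfl | rfl⟩ := exists_mode m
    · have hl : level (i : ℤ) = i := by simp [level]
      rw [hl, if_neg (by omega : ¬((i : ℤ) + j + 1 = 0)), smul_zero, add_zero]
      by_cases h : j = i
      · rw [if_pos (by omega), if_pos h, h]
      · rw [if_neg (by omega), if_neg h, smul_zero]
    · have hl : level (-(i : ℤ) - 1) = i := by
        have h : -(i : ℤ) - 1 < 0 := by omega
        simp [level, h]
      rw [hl, if_neg (by omega : ¬(-(i : ℤ) - 1 + (-(j : ℤ) - 1) + 1 = 0)), smul_zero, zero_add]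
      by_cases h : j = i
      · rw [if_pos (by omega), if_pos h, h]
      · rw [if_neg (by omega), if_neg h, smul_zero]
  rw [Finset.sum_congr rfl fun j _ => this j]
  simp [hN]

lemma exists_range_bound (S T : Finset ℕ) (i : ℕ) : ∃ N, S ⊆ Finset.range N ∧ T ⊆ Finset.range N ∧
    i < N := by
  refine ⟨S.sup id + T.sup id + i + 1, fun x hx => ?_, fun x hx => ?_, by omega⟩
  · have := Finset.le_sup (f := id) hx; simp only [id] at this; simp; omega
  · have := Finset.le_sup (f := id) hx; simp only [id] at this; simp; omega

lemma toggle_subset_range {N j : ℕ} {S : Finset ℕ} (hS : S ⊆ Finset.range N) (hj : j < N) :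
    toggle j S ⊆ Finset.range N := by
  unfold toggle
  split_ifs
  · exact (Finset.erase_subset _ _).trans hS
  · exact Finset.insert_subset (by simpa using hj) hS

lemma leftMul_congr {m : ℤ} {K K' : Kernel} {S T : Finset ℕ}
    (h : K (toggle (level m) S) T = K' (toggle (level m) S) T) :
    leftMul m K S T = leftMul m K' S T := by
  simp only [leftMul_apply, psiFun, op, h]

lemma level_neg (m : ℤ) : level (-m - 1) = level m := by
  unfold level; split_ifs <;> omega

lemma rightMul_congr {m : ℤ} {K K' : Kernel} {S T : Finset ℕ}
    (h : K S (toggle (level m) T) = K' S (toggle (level m) T)) :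
    rightMul m K S T = rightMul m K' S T := by
  simp only [rightMul_apply, psiFun, op, parityConj, level_neg, h]

/-- `[ψ(m), :φ(x) K:] = w(m) K - :φ(x) [ψ(m), K]:` for graded commutators. -/
lemma gradedComm_normalOp (m : ℤ) (w : ℤ → ℂ) (K : Kernel) :
    gradedComm m (normalOp w K) = w m • K - normalOp w (gradedComm m K) := by
  rw [eq_sub_iff_add_eq]
  funext S T
  -- The bound also covers `level m`, so that toggling this level in `S` or `T` stays within the
  -- truncation.
  obtain ⟨N, hS, hT, hN⟩ := exists_range_bound S T (level m)
  have := congrFun (congrFun (gradedComm_normalOpTrunc m w hN K) S) T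
  rw [← this, Pi.add_apply, Pi.add_apply, Pi.add_apply, Pi.add_apply, normalOp_eq_trunc w _ hS hT]
  congr 1
  simp only [gradedComm, LinearMap.sub_apply, Pi.sub_apply]
  rw [leftMul_congr (normalOp_eq_trunc w K (toggle_subset_range hS hN) hT),
    rightMul_congr (normalOp_eq_trunc w K hS (toggle_subset_range hT hN))]

lemma normalOpTrunc_anticomm (w w' : ℤ → ℂ) (N : ℕ) (K : Kernel) :
    normalOpTrunc w N (normalOpTrunc w' N K) + normalOpTrunc w' N (normalOpTrunc w N K) = 0 := by
  have key : ∀ i j : ℕ,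
      (w i • leftMul (-(i : ℤ) - 1) + w (-(i : ℤ) - 1) • rightMul i)
        ((w' j • leftMul (-(j : ℤ) - 1) + w' (-(j : ℤ) - 1) • rightMul j) K) +
      (w' j • leftMul (-(j : ℤ) - 1) + w' (-(j : ℤ) - 1) • rightMul j)
        ((w i • leftMul (-(i : ℤ) - 1) + w (-(i : ℤ) - 1) • rightMul i) K) = 0 := by
    intro i j
    have e1 := leftMul_anticomm (-(i : ℤ) - 1) (-(j : ℤ) - 1) K
    have e2 := rightMul_anticomm i j K
    have e3 := leftMul_rightMul_anticomm (-(i : ℤ) - 1) j K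
    have e4 := leftMul_rightMul_anticomm (-(j : ℤ) - 1) i K
    rw [if_neg (by omega)] at e1 e2
    simp only [LinearMap.add_apply, LinearMap.smul_apply, map_add, map_smul]
    linear_combination (norm := module) (w i * w' j) • e1 + (w (-(i : ℤ) - 1) * w' (-(j : ℤ) - 1)) • e2
      + (w i * w' (-(j : ℤ) - 1)) • e3 + (w (-(i : ℤ) - 1) * w' j) • e4
  unfold normalOpTrunc
  rw [LinearMap.sum_apply, LinearMap.sum_apply]
  simp only [LinearMap.sum_apply, map_sum]
  rw [← Finset.sum_add_distrib]
  refine Finset.sum_eq_zero fun i _ => ?_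
  rw [← Finset.sum_add_distrib]
  exact Finset.sum_eq_zero fun j _ => key _ _

lemma normalOpTrunc_congr (w : ℤ → ℂ) {N : ℕ} {K K' : Kernel}
    (h : ∀ S T, S ⊆ Finset.range N → T ⊆ Finset.range N → K S T = K' S T) {S T : Finset ℕ}
    (hS : S ⊆ Finset.range N) (hT : T ⊆ Finset.range N) :
    normalOpTrunc w N K S T = normalOpTrunc w N K' S T := by
  rw [← normalOp_eq_trunc w K hS hT, ← normalOp_eq_trunc w K' hS hT]
  have key : ∀ j < N, ∀ S ⊆ Finset.range N, toggle j S ⊆ Finset.range N := fun j hj S hS =>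
    toggle_subset_range hS hj
  unfold normalOp
  congr 1 <;> refine Finset.sum_congr rfl fun j hj => ?_
  · rw [leftMul_neg_apply, leftMul_neg_apply,
      h _ _ ((Finset.erase_subset _ _).trans hS) hT]
  · simp only [rightMul_natCast_apply, parityConj]
    rw [h _ _ hS ((Finset.erase_subset _ _).trans hT)]

lemma normalOp_anticomm (w w' : ℤ → ℂ) (K : Kernel) :
    normalOp w (normalOp w' K) = -normalOp w' (normalOp w K) := by
  rw [eq_neg_iff_add_eq_zero]
  funext S T
  obtain ⟨N, hS, hT, -⟩ := exists_range_bound S T 0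
  have := congrFun (congrFun (normalOpTrunc_anticomm w w' N K) S) T
  rw [← this, Pi.add_apply, Pi.add_apply, Pi.add_apply, Pi.add_apply, normalOp_eq_trunc w _ hS hT,
    normalOp_eq_trunc w' _ hS hT]
  congr 1 <;> exact normalOpTrunc_congr _ (fun S T hS hT => normalOp_eq_trunc _ _ hS hT) hS hT

lemma normalOp_normalOp_self (w : ℤ → ℂ) (K : Kernel) : normalOp w (normalOp w K) = 0 :=
  self_eq_neg.mp (normalOp_anticomm w w K)

lemma normalOp_add (w : ℤ → ℂ) (K K' : Kernel) :
    normalOp w (K + K') = normalOp w K + normalOp w K' := by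
  funext S T
  simp only [normalOp, map_add, Pi.add_apply, mul_add, Finset.sum_add_distrib]; ring

lemma normalOp_smul (w : ℤ → ℂ) (c : ℂ) (K : Kernel) : normalOp w (c • K) = c • normalOp w K := by
  funext S T
  simp only [normalOp, map_smul, Pi.smul_apply, smul_eq_mul, mul_add, Finset.mul_sum]
  congr 1 <;> exact Finset.sum_congr rfl fun j _ => by ring

lemma normalOp_zero (w : ℤ → ℂ) : normalOp w 0 = 0 := by
  simpa using normalOp_smul w 0 0

end FreeFermion

namespace FreeFermion

/-! ### Matrix entries of the vertex operators -/

/-- Twice the `L(0)`-weight. -/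
def deg (S : Finset ℕ) : ℕ := ∑ i ∈ S, (2 * i + 1)

lemma weight_eq_deg (S : Finset ℕ) : weight S = (deg S : ℂ) / 2 := by
  unfold weight deg
  push_cast
  rw [Finset.sum_div]
  exact Finset.sum_congr rfl fun i _ => by ring

lemma deg_erase {j : ℕ} {S : Finset ℕ} (h : j ∈ S) : deg (S.erase j) + (2 * j + 1) = deg S :=
  Finset.sum_erase_add _ _ h

lemma deg_insert {j : ℕ} {S : Finset ℕ} (h : j ∉ S) : deg (insert j S) = deg S + (2 * j + 1) := by
  unfold deg; rw [Finset.sum_insert h, add_comm]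

/-- The binomial coefficient of an integer and a natural number. -/
noncomputable def binomZ (m : ℤ) (i : ℕ) : ℂ :=
  if m < 0 then (-1) ^ i * ((level m + i).choose i : ℕ) else ((level m).choose i : ℕ)

lemma binomZ_natCast (j i : ℕ) : binomZ j i = (j.choose i : ℕ) := by
  have h : ¬((j : ℤ) < 0) := by omega
  simp [binomZ, level, h]

lemma binomZ_neg (j i : ℕ) : binomZ (-(j : ℤ) - 1) i = (-1) ^ i * ((j + i).choose i : ℕ) := by
  have h : -(j : ℤ) - 1 < 0 := by omega
  simp [binomZ, level, h]

lemma binomZ_zero (m : ℤ) : binomZ m 0 = 1 := by simp [binomZ]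

/-- One recursion valid for both signs of `m`; it replaces the binomial series in
`sum_binomZ_mul_creationCoeff`. -/
lemma binomZ_succ (m : ℤ) (i : ℕ) : (i + 1) * binomZ m (i + 1) = (m - i) * binomZ m i := by
  obtain ⟨j, rfl | rfl⟩ := exists_mode m
  · rw [binomZ_natCast, binomZ_natCast]
    have := Nat.choose_succ_right_eq j i
    rcases le_or_gt i j with h | h
    · have h2 := congrArg (Nat.cast (R := ℂ)) this
      push_cast [Nat.cast_sub h] at h2 ⊢
      linear_combination h2
    · rw [Nat.choose_eq_zero_of_lt h, Nat.choose_eq_zero_of_lt (by omega)]; simp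
  · rw [binomZ_neg, binomZ_neg]
    have h2 := congrArg (Nat.cast (R := ℂ)) (Nat.add_one_mul_choose_eq (j + i) i)
    push_cast at h2 ⊢
    rw [← add_assoc, pow_succ]
    linear_combination (-1 : ℂ) ^ i * h2

/-- The identity matrix. -/
noncomputable def idKernel : Kernel := fun S T => if S = T then 1 else 0

/-- The matrix of `:∂^{(i₁)}ψ(1) ⋯ ∂^{(iᵣ)}ψ(1):`. -/
noncomputable def fieldKernel : List ℕ → Kernel
  | [] => idKernel
  | i :: is => normalOp (fun m => binomZ m i) (fieldKernel is)

lemma parityConj_leftMul (m : ℤ) (K : Kernel) :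
    parityConj (leftMul m K) = -leftMul m (parityConj K) := by
  funext S T
  simp only [Pi.neg_apply, leftMul_apply, parityConj, psiFun, op, pow_add, card_toggle_sign]
  split_ifs <;> ring

lemma parityConj_rightMul (m : ℤ) (K : Kernel) :
    parityConj (rightMul m K) = -rightMul m (parityConj K) := by
  funext S T
  simp only [Pi.neg_apply, rightMul_apply, parityConj, psiFun, op, pow_add, card_toggle_sign]
  split_ifs <;> ring

lemma parityConj_normalOp (w : ℤ → ℂ) (K : Kernel) :
    parityConj (normalOp w K) = -normalOp w (parityConj K) := by
  funext S T
  have h1 : ∀ j : ℕ, parityConj (leftMul (-(j : ℤ) - 1) K) S T =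
      -leftMul (-(j : ℤ) - 1) (parityConj K) S T := fun j => by rw [parityConj_leftMul]; rfl
  have h2 : ∀ j : ℕ, parityConj (rightMul j K) S T = -rightMul j (parityConj K) S T :=
    fun j => by rw [parityConj_rightMul]; rfl
  simp only [Pi.neg_apply, normalOp, neg_add, ← Finset.sum_neg_distrib, ← mul_neg, ← h1, ← h2]
  simp only [parityConj, normalOp, mul_add, Finset.mul_sum]
  congr 1 <;> exact Finset.sum_congr rfl fun j _ => by ring

lemma parityConj_smul (c : ℂ) (K : Kernel) : parityConj (c • K) = c • parityConj K := by
  funext S T; simp only [parityConj, Pi.smul_apply, smul_eq_mul]; ring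

lemma parityConj_add (K K' : Kernel) : parityConj (K + K') = parityConj K + parityConj K' := by
  funext S T; simp only [parityConj, Pi.add_apply]; ring

lemma parityConj_idKernel : parityConj idKernel = idKernel := by
  funext S T
  unfold parityConj idKernel
  split_ifs with h
  · subst h; rw [pow_add, ← mul_pow]; simp
  · simp

lemma parityConj_fieldKernel (l : List ℕ) :
    parityConj (fieldKernel l) = (-1 : ℂ) ^ l.length • fieldKernel l := by
  induction l with
  | nil => simp [fieldKernel, parityConj_idKernel]
  | cons i is ih =>
    rw [fieldKernel, parityConj_normalOp, ih, normalOp_smul, List.length_cons, pow_succ]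
    simp

lemma linearMap_apply_eq_sum (A : Module.End ℂ Fock) (v : Fock) :
    A v = v.sum fun R c => c • A (fockBasis R) := by
  conv_lhs => rw [← Finsupp.sum_single v]
  rw [Finsupp.sum, Finsupp.sum, map_sum]
  refine Finset.sum_congr rfl fun R _ => ?_
  rw [← map_smul]; simp [fockBasis]

lemma fock_induction {p : Fock → Prop} (h0 : p 0) (hadd : ∀ v w, p v → p w → p (v + w))
    (hb : ∀ R, p (fockBasis R)) (hs : ∀ (c : ℂ) v, p v → p (c • v)) (v : Fock) : p v := by
  induction v using Finsupp.induction_linear with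
  | zero => exact h0
  | add v w hv hw => exact hadd v w hv hw
  | single R c =>
    have := hs c _ (hb R)
    rwa [fockBasis, Finsupp.smul_single, smul_eq_mul, mul_one] at this

lemma linearCombination_fockBasis {M : Type*} [AddCommMonoid M] [Module ℂ M]
    (f : Finset ℕ → M) (T : Finset ℕ) : Finsupp.linearCombination ℂ f (fockBasis T) = f T := by
  simp [fockBasis]

lemma fockBasis_apply (R S : Finset ℕ) : fockBasis R S = if R = S then 1 else 0 := by
  simp [fockBasis, Finsupp.single_apply]

lemma erase_eq_iff_eq_insert {i : ℕ} {R S : Finset ℕ} (hR : i ∉ R) (hS : i ∈ S) :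
    insert i R = S ↔ R = S.erase i := by
  constructor
  · rintro rfl; simp [hR]
  · rintro rfl; simp [hS]

lemma creation_apply (i : ℕ) (v : Fock) (S : Finset ℕ) : creation i v S = op true i v S := by
  induction v using fock_induction with
  | h0 => simp [op]
  | hadd v w hv hw => rw [map_add, Finsupp.add_apply, hv, hw, Finsupp.coe_add, op_add]; rfl
  | hs c v hv => rw [map_smul, Finsupp.smul_apply, hv, Finsupp.coe_smul, op_smul]; rfl
  | hb R =>
    rw [creation, linearCombination_fockBasis]
    by_cases hR : i ∈ R <;> by_cases hS : i ∈ S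
    · simp [op, hR, hS, toggle_of_mem, fockBasis_apply]
      intro h; subst h; simp at hR
    · simp [op, hR, hS]
    · have hs : orderSign i S = orderSign i (S.erase i) := by
        rw [← toggle_of_mem hS, orderSign_toggle_self]
      simp only [hR, hS, op, toggle_of_mem, fockBasis_apply, if_false, decide_true, if_true,
        Finsupp.smul_apply, smul_eq_mul]
      by_cases h : insert i R = S
      · rw [if_pos h, if_pos ((erase_eq_iff_eq_insert hR hS).mp h), hs,
          ← (erase_eq_iff_eq_insert hR hS).mp h]
      · rw [if_neg h, if_neg (fun h' => h ((erase_eq_iff_eq_insert hR hS).mpr h'))]; simp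
    · simp [op, hR, hS, fockBasis_apply]
      intro h; subst h; simp at hS

lemma annihilation_apply (i : ℕ) (v : Fock) (S : Finset ℕ) :
    annihilation i v S = op false i v S := by
  induction v using fock_induction with
  | h0 => simp [op]
  | hadd v w hv hw => rw [map_add, Finsupp.add_apply, hv, hw, Finsupp.coe_add, op_add]; rfl
  | hs c v hv => rw [map_smul, Finsupp.smul_apply, hv, Finsupp.coe_smul, op_smul]; rfl
  | hb R =>
    rw [annihilation, linearCombination_fockBasis]
    by_cases hR : i ∈ R <;> by_cases hS : i ∈ S
    · simp [op, hR, hS, fockBasis_apply]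
      intro h; subst h; simp at hS
    · have hs : orderSign i S = orderSign i (insert i S) := by
        rw [← toggle_of_notMem hS, orderSign_toggle_self]
      have hiff := erase_eq_iff_eq_insert hS hR
      simp only [hR, hS, op, toggle_of_notMem hS, fockBasis_apply, decide_false, if_true,
        Finsupp.smul_apply, smul_eq_mul]
      by_cases h : insert i S = R
      · rw [if_pos (hiff.mp h).symm, if_pos h.symm, hs, h]
      · rw [if_neg (fun h' => h (hiff.mpr h'.symm)), if_neg (fun h' => h h'.symm)]; simp
    · simp [op, hR, hS]
    · simp [op, hR, hS, toggle_of_notMem, fockBasis_apply]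
      intro h; subst h; simp at hR

lemma psi_natCast (j : ℕ) : psi (j : ℤ) = annihilation j := by
  have h : ¬((j : ℤ) < 0) := by omega
  simp [psi, h]

lemma psi_neg (j : ℕ) : psi (-(j : ℤ) - 1) = creation j := by
  have h : -(j : ℤ) - 1 < 0 := by omega
  simp [psi, h]

lemma pointwiseSum_fockBasis_apply {ι : Type} (A : ι → Module.End ℂ Fock) (S T : Finset ℕ)
    (h : (Function.support fun j => A j (fockBasis T)).Finite) :
    pointwiseSum A (fockBasis T) S = ∑ᶠ j, A j (fockBasis T) S := by
  rw [pointwiseSum, linearCombination_fockBasis]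
  exact AddMonoidHom.map_finsum (Finsupp.applyAddHom S) h

/-- The total degree of a list of levels. -/
def listDeg (l : List ℕ) : ℕ := (l.map fun i => 2 * i + 1).sum

/-- Each mode shifts the degree by a fixed amount, so an entry belongs to at most one mode.
Forgetting the mode loses nothing: the field at `x = 1` determines all modes, and the same
`fieldKernel` serves every `n`. -/
lemma fieldMode_apply (l : List ℕ) : ∀ (n : ℤ) (S T : Finset ℕ), fieldMode l n (fockBasis T) S =
    if (deg S : ℤ) = deg T + listDeg l - 2 * (n + 1) then fieldKernel l S T else 0 := by
  induction l with
  | nil =>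
    intro n S T
    by_cases hn : n = -1
    · subst hn
      by_cases h : S = T
      · subst h; simp [fieldMode, fieldKernel, idKernel, listDeg, fockBasis_apply]
      · simp [fieldMode, fieldKernel, idKernel, listDeg, fockBasis_apply, h, Ne.symm h]
    · by_cases h : S = T
      · subst h
        rw [if_neg (by simp [listDeg]; omega)]
        simp [fieldMode, hn]
      · simp [fieldMode, fieldKernel, idKernel, hn, h]
  | cons i is ih =>
    intro n S T
    have hl : listDeg (i :: is) = listDeg is + (2 * i + 1) := by simp [listDeg, add_comm]
    -- Modes that would push the degree below zero vanish. This yields the finite support without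
    -- which the `finsum` in `pointwiseSum` would take its default value `0`.
    have hvan : ∀ m : ℤ, (deg T : ℤ) + listDeg is < 2 * (m + 1) →
        fieldMode is m (fockBasis T) = 0 := by
      intro m hm
      ext S
      rw [ih, if_neg (by have := Int.natCast_nonneg (deg S); omega)]; rfl
    rw [fieldMode, LinearMap.add_apply, Finsupp.add_apply, pointwiseSum_fockBasis_apply,
      pointwiseSum_fockBasis_apply]
    · have e1 : ∀ j : ℕ, (((j.choose i : ℕ) : ℂ) • (psi (-(j : ℤ) - 1) *
          fieldMode is (n + j - i))) (fockBasis T) S = if j ∈ S then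
            (if (deg S : ℤ) = deg T + listDeg (i :: is) - 2 * (n + 1) then
              binomZ j i * leftMul (-(j : ℤ) - 1) (fieldKernel is) S T else 0) else 0 := by
        intro j
        rw [LinearMap.smul_apply, Finsupp.smul_apply, Module.End.mul_apply, psi_neg,
          creation_apply, binomZ_natCast, leftMul_neg_apply]
        by_cases hj : j ∈ S
        · have hd := deg_erase hj
          have : (deg (S.erase j) : ℤ) = deg T + listDeg is - 2 * (n + j - i + 1) ↔
            (deg S : ℤ) = deg T + listDeg (i :: is) - 2 * (n + 1) := by
            rw [hl]; push_cast; omega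
          simp only [op, hj, decide_true, if_true, toggle_of_mem hj, ih, this]
          split_ifs <;> simp
        · simp [op, hj]
      have e2 : ∀ j : ℕ, ((((-1 : ℂ) ^ (i + is.length) * (((j + i).choose i : ℕ) : ℂ)) •
          (fieldMode is (n - j - i - 1) * psi (j : ℤ))) (fockBasis T)) S = if j ∈ T then
            (if (deg S : ℤ) = deg T + listDeg (i :: is) - 2 * (n + 1) then
              binomZ (-(j : ℤ) - 1) i * rightMul j (fieldKernel is) S T else 0) else 0 := by
        intro j
        rw [LinearMap.smul_apply, Finsupp.smul_apply, Module.End.mul_apply, psi_natCast,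
          annihilation, linearCombination_fockBasis, binomZ_neg, rightMul_natCast_apply,
          parityConj_fieldKernel]
        by_cases hj : j ∈ T
        · have hd := deg_erase hj
          have : (deg S : ℤ) = deg (T.erase j) + listDeg is - 2 * (n - j - i - 1 + 1) ↔
            (deg S : ℤ) = deg T + listDeg (i :: is) - 2 * (n + 1) := by
            rw [hl]; push_cast; omega
          simp only [hj, if_true, map_smul, Finsupp.smul_apply, ih, this, Pi.smul_apply, smul_eq_mul]
          split_ifs
          · rw [pow_add]; ring
          · simp
        · simp [hj]
      simp only [e1, e2]
      have fs : ∀ (U : Finset ℕ) (g : ℕ → ℂ), (∑ᶠ j, if j ∈ U then g j else 0) = ∑ j ∈ U, g j := by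
        intro U g
        rw [finsum_eq_sum_of_support_subset (s := U)]
        · exact Finset.sum_congr rfl fun j hj => by simp [hj]
        · intro j hj; by_contra h; simp at hj h; exact h hj.1
      rw [fs, fs]
      split_ifs
      · rfl
      · simp
    · refine Set.Finite.subset (Finset.finite_toSet T) fun j hj => ?_
      by_contra h
      apply hj
      have h' : j ∉ T := by simpa using h
      simp only [LinearMap.smul_apply, Module.End.mul_apply, psi_natCast]
      rw [annihilation, linearCombination_fockBasis, if_neg h', map_zero, smul_zero]
    · refine Set.Finite.subset (Finset.finite_toSet
        (Finset.range (deg T + listDeg is + i + n.natAbs + 1))) fun j hj => ?_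
      by_contra h
      apply hj
      have h' : deg T + listDeg is + i + n.natAbs + 1 ≤ j := by simpa using h
      simp only [LinearMap.smul_apply, Module.End.mul_apply]
      rw [hvan _ (by omega), map_zero, smul_zero]

/-! ### Vertex operators at the point 1 and the commutator formula -/

/-- The matrix of `Y(v, 1)`. -/
noncomputable def vertexKernel : Fock →ₗ[ℂ] Kernel :=
  Finsupp.linearCombination ℂ fun R => fieldKernel (R.sort (· ≤ ·))

lemma vertexKernel_fockBasis (R : Finset ℕ) :
    vertexKernel (fockBasis R) = fieldKernel (R.sort (· ≤ ·)) :=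
  linearCombination_fockBasis _ _

lemma vertexKernel_vacuum : vertexKernel vacuum = idKernel := by
  rw [vacuum, vertexKernel_fockBasis]; simp [fieldKernel]

lemma creation_fockBasis (i : ℕ) (R : Finset ℕ) : creation i (fockBasis R) =
    if i ∈ R then 0 else orderSign i R • fockBasis (insert i R) :=
  linearCombination_fockBasis _ _

lemma orderSign_of_lt {i : ℕ} {R : Finset ℕ} (h : ∀ x ∈ R, i < x) : orderSign i R = 1 := by
  have : R.filter (· < i) = ∅ := by
    rw [Finset.filter_eq_empty_iff]
    intro x hx; have := h x hx; omega
  simp [orderSign, this]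

lemma creation_of_lt {i : ℕ} {R : Finset ℕ} (h : ∀ x ∈ R, i < x) :
    creation i (fockBasis R) = fockBasis (insert i R) := by
  have : i ∉ R := fun hi => lt_irrefl _ (h i hi)
  rw [creation_fockBasis, if_neg this, orderSign_of_lt h, one_smul]

lemma vertexKernel_insert {i : ℕ} {R : Finset ℕ} (h : ∀ x ∈ R, i < x) :
    vertexKernel (fockBasis (insert i R)) =
      normalOp (fun m => binomZ m i) (vertexKernel (fockBasis R)) := by
  have hi : i ∉ R := fun hi => lt_irrefl _ (h i hi)
  rw [vertexKernel_fockBasis, vertexKernel_fockBasis,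
    Finset.sort_insert _ (fun b hb => (h b hb).le) hi, fieldKernel]

lemma creation_anticomm (i j : ℕ) (v : Fock) :
    creation i (creation j v) = -creation j (creation i v) := by
  ext S
  rw [Finsupp.neg_apply, creation_apply, creation_apply]
  have h : ∀ k, ⇑(creation k v) = op true k v := fun k => funext fun S => creation_apply k v S
  rw [h, h]
  by_cases hij : i = j
  · subst hij; rw [op_op_same]; simp
  · rw [op_op_of_ne hij]

/-- For `i` below all levels of the basis vector this is the definition of the sorted normally
ordered product. Otherwise `i` is moved past the minimal level: both the creation operators and the
normally ordered fields anticommute and square to zero, so the two sides change in the same way. -/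
lemma vertexKernel_creation (i : ℕ) (v : Fock) : vertexKernel (creation i v) =
    normalOp (fun m => binomZ m i) (vertexKernel v) := by
  induction v using fock_induction with
  | h0 => simp [normalOp_zero]
  | hadd v w hv hw => rw [map_add, map_add, map_add, hv, hw, normalOp_add]
  | hs c v hv => rw [map_smul, map_smul, map_smul, hv, normalOp_smul]
  | hb R =>
    induction R using Finset.induction_on_min with
    | empty => rw [creation_of_lt (by simp), vertexKernel_insert (by simp)]
    | insert a s has ih =>
      rcases lt_trichotomy i a with h | h | h
      · have : ∀ x ∈ insert a s, i < x := by
          intro x hx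
          rcases Finset.mem_insert.mp hx with rfl | hx
          · exact h
          · exact h.trans (has x hx)
        rw [creation_of_lt this, vertexKernel_insert this]
      · subst h
        rw [creation_fockBasis, if_pos (Finset.mem_insert_self _ _), map_zero,
          vertexKernel_insert has, normalOp_normalOp_self]
      · rw [vertexKernel_insert has, normalOp_anticomm, ← ih, ← creation_of_lt has,
          creation_anticomm, map_neg]
        congr 1
        rw [creation_fockBasis]
        split_ifs with hi
        · simp [normalOp_zero]
        · have : ∀ x ∈ insert i s, a < x := by
            intro x hx
            rcases Finset.mem_insert.mp hx with rfl | hx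
            · exact h
            · exact has x hx
          rw [map_smul, creation_of_lt this, map_smul, vertexKernel_insert this, map_smul,
            normalOp_smul]

/-- The operator `∑ w(l) ψ(l)`, `l ≥ 0`. -/
noncomputable def annihilationSum (w : ℕ → ℂ) : Module.End ℂ Fock :=
  Finsupp.linearCombination ℂ fun T => ∑ j ∈ T, w j • annihilation j (fockBasis T)

lemma annihilation_of_notMem {j : ℕ} {T : Finset ℕ} (h : j ∉ T) :
    annihilation j (fockBasis T) = 0 := by
  rw [annihilation, linearCombination_fockBasis, if_neg h]

lemma annihilationSum_eq_sum (w : ℕ → ℂ) {N : ℕ} {T : Finset ℕ} (h : T ⊆ Finset.range N) :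
    annihilationSum w (fockBasis T) = ∑ j ∈ Finset.range N, w j • annihilation j (fockBasis T) := by
  rw [annihilationSum, linearCombination_fockBasis]
  exact Finset.sum_subset h fun j _ hj => by rw [annihilation_of_notMem hj, smul_zero]

lemma annihilation_creation (i j : ℕ) (v : Fock) : annihilation j (creation i v) =
    (if j = i then v else 0) - creation i (annihilation j v) := by
  rw [eq_sub_iff_add_eq]
  ext S
  rw [Finsupp.add_apply, creation_apply, annihilation_apply]
  have h1 : ⇑(creation i v) = op true i v := funext fun S => creation_apply i v S
  have h2 : ⇑(annihilation j v) = op false j v := funext fun S => annihilation_apply j v S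
  rw [h1, h2]
  split_ifs with h
  · subst h; exact op_op_not_add false j v S
  · rw [op_op_of_ne h]; simp

lemma annihilationSum_creation (w : ℕ → ℂ) (i : ℕ) (v : Fock) :
    annihilationSum w (creation i v) = w i • v - creation i (annihilationSum w v) := by
  induction v using fock_induction with
  | h0 => simp
  | hadd v w hv hw => simp only [map_add, hv, hw, smul_add]; abel
  | hs c v hv => simp only [map_smul, hv, smul_sub]; rw [smul_comm]
  | hb R =>
    obtain ⟨N, hR, -, hN⟩ := exists_range_bound R R i
    have h1 : annihilationSum w (creation i (fockBasis R)) =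
        ∑ j ∈ Finset.range N, w j • annihilation j (creation i (fockBasis R)) := by
      rw [creation_fockBasis]
      split_ifs
      · simp
      · simp only [map_smul]
        rw [annihilationSum_eq_sum w (Finset.insert_subset (by simpa using hN) hR),
          Finset.smul_sum]
        exact Finset.sum_congr rfl fun j _ => smul_comm _ _ _
    rw [h1, annihilationSum_eq_sum w hR, map_sum]
    simp only [annihilation_creation, smul_sub, map_smul, Finset.sum_sub_distrib]
    congr 1
    simp [hN]

lemma annihilationSum_vacuum (w : ℕ → ℂ) : annihilationSum w vacuum = 0 := by
  rw [vacuum, annihilationSum, linearCombination_fockBasis, Finset.sum_empty]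

lemma op_idKernel (b : Bool) (j : ℕ) (S T : Finset ℕ) :
    op b j (fun S' => idKernel S' T) S = op (!b) j (fun T' => idKernel S T') T := by
  by_cases h : toggle j S = T
  · subst h
    simp only [op, decide_mem_toggle, idKernel, orderSign_toggle_self, toggle_toggle]
    cases b <;> by_cases h : j ∈ S <;> simp [h]
  · have h' : S ≠ toggle j T := fun h' => h (by rw [h', toggle_toggle])
    simp [op, idKernel, h, h']

lemma gradedComm_idKernel (m : ℤ) : gradedComm m idKernel = 0 := by
  funext S T
  have h : (fun T' => parityConj idKernel S T') = fun T' => idKernel S T' := by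
    rw [parityConj_idKernel]
  rw [gradedComm, LinearMap.sub_apply, Pi.sub_apply, Pi.sub_apply, leftMul_apply, rightMul_apply, h]
  obtain ⟨j, rfl | rfl⟩ := exists_mode m
  · rw [psiFun_natCast, psiFun_neg, op_idKernel]; simp
  · rw [show -(-(j : ℤ) - 1) - 1 = j by ring, psiFun_natCast, psiFun_neg, op_idKernel]; simp

/-- The commutator formula `[ψ(m), Y(v, 1)] = ∑ binom(m, l) Y(ψ(l) v, 1)`. -/
lemma gradedComm_vertexKernel (m : ℤ) (v : Fock) : gradedComm m (vertexKernel v) =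
    vertexKernel (annihilationSum (fun l => binomZ m l) v) := by
  induction v using fock_induction with
  | h0 => simp
  | hadd v w hv hw => simp only [map_add, hv, hw]
  | hs c v hv => simp only [map_smul, hv]
  | hb R =>
    induction R using Finset.induction_on_min with
    | empty =>
      have := annihilationSum_vacuum fun l => binomZ m l
      have h2 := vertexKernel_vacuum
      rw [vacuum] at this h2
      rw [this, h2, gradedComm_idKernel, map_zero]
    -- Adding a minimal level turns both sides by the same rule: `gradedComm_normalOp` for the
    -- matrix and `annihilationSum_creation` for the vector.
    | insert a s has ih =>
      rw [vertexKernel_insert has, gradedComm_normalOp, ih, ← creation_of_lt has,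
        annihilationSum_creation, map_sub, map_smul, vertexKernel_creation]

end FreeFermion

namespace FreeFermion

/-! ### Generating functions of the square bracket modes of the fermion -/

open PowerSeries in
/-- The power series `(e^z - 1) / z`. -/
noncomputable def expQuot : PowerSeries ℂ := PowerSeries.mk fun n => ((n + 1).factorial : ℂ)⁻¹

open PowerSeries

lemma exp_sub_one_eq : (exp ℂ - 1 : PowerSeries ℂ) = X * expQuot := by
  ext n
  cases n with
  | zero => simp
  | succ n => simp [coeff_succ_X_mul, expQuot, coeff_exp, coeff_one]

lemma constantCoeff_expQuot : constantCoeff expQuot = 1 := by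
  rw [← coeff_zero_eq_constantCoeff_apply]; simp [expQuot]

lemma expQuot_mul_inv : expQuot * expQuot⁻¹ = 1 :=
  PowerSeries.mul_inv_cancel _ (by rw [constantCoeff_expQuot]; exact one_ne_zero)

/-- The power series `e^{z/2}`. -/
noncomputable def expHalf : PowerSeries ℂ := rescale (1 / 2 : ℂ) (exp ℂ)

lemma derivative_expHalf : d⁄dX ℂ expHalf = C (1 / 2 : ℂ) * expHalf := by
  ext n
  rw [coeff_derivative, coeff_C_mul, expHalf, coeff_rescale, coeff_rescale, coeff_exp, coeff_exp]
  simp only [Nat.factorial_succ]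
  have : ((n : ℂ) + 1) ≠ 0 := Nat.cast_add_one_ne_zero n
  have h2 : (n.factorial : ℂ) ≠ 0 := by exact_mod_cast n.factorial_ne_zero
  simp
  field_simp
  ring

lemma derivative_exp_sub_one : d⁄dX ℂ (exp ℂ - 1) = (exp ℂ - 1) + 1 := by
  ext n
  rw [coeff_derivative, sub_add_cancel]
  have : ((n : ℂ) + 1) ≠ 0 := Nat.cast_add_one_ne_zero n
  have h2 : (n.factorial : ℂ) ≠ 0 := by exact_mod_cast n.factorial_ne_zero
  simp [coeff_exp, coeff_one, Nat.factorial_succ]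
  field_simp

lemma X_mul_derivative_expQuot : X * d⁄dX ℂ expQuot = 1 + X * expQuot - expQuot := by
  have h := derivative_exp_sub_one
  rw [exp_sub_one_eq, Derivation.leibniz, derivative_X] at h
  simp only [smul_eq_mul] at h
  linear_combination h

/-- The coefficient of `z^k` in `e^{z/2} (e^z - 1)^i`. -/
noncomputable def creationCoeff (k i : ℕ) : ℂ := coeff k (expHalf * (exp ℂ - 1) ^ i)

/-- The power series `z^{l+1} e^{z/2} (e^z - 1)^{-l-1}`. -/
noncomputable def annihilationSeries (l : ℕ) : PowerSeries ℂ := expHalf * expQuot⁻¹ ^ (l + 1)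

/-- The coefficient of `z^{k-1}` in `e^{z/2} (e^z - 1)^{-l-1}`. -/
noncomputable def annihilationCoeff (k l : ℕ) : ℂ := coeff (l + k) (annihilationSeries l)

lemma creationCoeff_zero (i : ℕ) : creationCoeff 0 i = if i = 0 then 1 else 0 := by
  rw [creationCoeff, coeff_zero_eq_constantCoeff_apply, map_mul, map_pow]
  simp [expHalf]
  rw [← coeff_zero_eq_constantCoeff_apply, coeff_rescale]
  simp [zero_pow_eq]

/-- `(e^z - 1)^i` is divisible by `z^i`; hence only finitely many creation modes occur in `ψ[-k-1]`.
-/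
lemma creationCoeff_of_lt {k i : ℕ} (h : k < i) : creationCoeff k i = 0 := by
  rw [creationCoeff, exp_sub_one_eq, mul_pow, mul_left_comm, coeff_X_pow_mul', if_neg (by omega)]

lemma creationCoeff_succ_zero (k : ℕ) :
    (k + 1) * creationCoeff (k + 1) 0 = 1 / 2 * creationCoeff k 0 := by
  have h := congrArg (coeff k) derivative_expHalf
  rw [coeff_derivative, coeff_C_mul] at h
  simp only [creationCoeff, pow_zero, mul_one]
  linear_combination h

/-- Differentiate `e^{z/2} (e^z - 1)^{i+1}` and write `e^z = (e^z - 1) + 1`. -/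
lemma creationCoeff_succ_succ (k i : ℕ) : (k + 1) * creationCoeff (k + 1) (i + 1) =
    (i + 1 + 1 / 2) * creationCoeff k (i + 1) + (i + 1) * creationCoeff k i := by
  have h : d⁄dX ℂ (expHalf * (exp ℂ - 1) ^ (i + 1)) =
      C ((i : ℂ) + 1 + 1 / 2) * (expHalf * (exp ℂ - 1) ^ (i + 1)) +
        C ((i : ℂ) + 1) * (expHalf * (exp ℂ - 1) ^ i) := by
    rw [Derivation.leibniz, Derivation.leibniz_pow, derivative_expHalf, derivative_exp_sub_one]
    simp only [smul_eq_mul, nsmul_eq_mul, Nat.add_sub_cancel, map_add, map_natCast, map_one]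
    push_cast
    ring
  have h2 := congrArg (coeff k) h
  rw [coeff_derivative, map_add, coeff_C_mul, coeff_C_mul] at h2
  simp only [creationCoeff]
  linear_combination h2

lemma derivative_expQuot_inv_pow (l : ℕ) : d⁄dX ℂ (expQuot⁻¹ ^ (l + 1)) =
    -(C ((l : ℂ) + 1) * (expQuot⁻¹ ^ (l + 2) * d⁄dX ℂ expQuot)) := by
  have h := congrArg (d⁄dX ℂ) expQuot_mul_inv
  rw [Derivation.leibniz, Derivation.map_one_eq_zero] at h
  simp only [smul_eq_mul] at h
  have h1 : d⁄dX ℂ expQuot⁻¹ = -(expQuot⁻¹ ^ 2 * d⁄dX ℂ expQuot) := by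
    linear_combination expQuot⁻¹ * h - (d⁄dX ℂ expQuot⁻¹) * expQuot_mul_inv
  rw [Derivation.leibniz_pow, h1]
  simp only [smul_eq_mul, nsmul_eq_mul, Nat.add_sub_cancel, map_add, map_natCast, map_one]
  push_cast
  ring

/-- Differentiate `e^{w/2} (e^w - 1)^{-l-1}` in the same manner. The pole is cleared by the factor
`w^{l+1}`, so the computation stays among power series. -/
lemma annihilationCoeff_succ (k l : ℕ) : -(k : ℂ) * annihilationCoeff (k + 1) l =
    (l + 1 / 2) * annihilationCoeff k l + (l + 1) * annihilationCoeff k (l + 1) := by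
  have h : X * d⁄dX ℂ (annihilationSeries l) =
      C ((l : ℂ) + 1) * (annihilationSeries l - annihilationSeries (l + 1)) -
        X * (C ((l : ℂ) + 1 / 2) * annihilationSeries l) := by
    unfold annihilationSeries
    rw [Derivation.leibniz, derivative_expHalf, derivative_expQuot_inv_pow]
    have e : C ((l : ℂ) + 1) = C ((l : ℂ) + 1 / 2) + C (1 / 2 : ℂ) := by
      rw [← map_add]; congr 1; ring
    simp only [smul_eq_mul]
    have e2 := X_mul_derivative_expQuot
    have e3 := expQuot_mul_inv
    linear_combination (-(expHalf * C ((l : ℂ) + 1) * expQuot⁻¹ ^ (l + 2))) * e2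
      + (C ((l : ℂ) + 1) * expHalf * expQuot⁻¹ ^ (l + 1) * (1 - X)) * e3
      - X * expHalf * expQuot⁻¹ ^ (l + 1) * e
  have h2 := congrArg (coeff (l + k + 1)) h
  rw [coeff_succ_X_mul, coeff_derivative, map_sub, coeff_succ_X_mul, coeff_C_mul, coeff_C_mul,
    map_sub] at h2
  simp only [annihilationCoeff]
  rw [show l + 1 + k = l + k + 1 by ring, show l + (k + 1) = l + k + 1 by ring]
  push_cast at h2
  linear_combination -h2

lemma annihilationCoeff_zero (k : ℕ) : annihilationCoeff k 0 =
    Polynomial.aeval (((1 / 2 : ℝ) : ℝ) : ℂ) (Polynomial.bernoulli k) / (k.factorial : ℂ) := by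
  have h := Polynomial.bernoulli_generating_function (A := ℂ) (((1 / 2 : ℝ) : ℝ) : ℂ)
  have h1 : (((1 / 2 : ℝ) : ℝ) : ℂ) = 1 / 2 := by push_cast; ring
  rw [exp_sub_one_eq, mul_left_comm] at h
  have h2 := mul_left_cancel₀ X_ne_zero h
  rw [annihilationCoeff, annihilationSeries, expHalf, ← h1, ← h2, zero_add, zero_add, pow_one,
    mul_assoc, expQuot_mul_inv, mul_one, coeff_mk, map_smul]
  rw [Algebra.smul_def]
  simp
  rw [div_eq_inv_mul]

/-- This is the coefficient of `z^p` in `e^{z/2} (1 + (e^z - 1))^a = e^{(a+1/2)z}`. Since `a` may be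
negative it is proved by induction on `p`: the two recursions combine to multiply the sum by `a +
1/2` at each step. -/
lemma sum_binomZ_mul_creationCoeff (a : ℤ) (p : ℕ) :
    ∑ i ∈ Finset.range (p + 1), binomZ a i * creationCoeff p i =
      ((a : ℂ) + 1 / 2) ^ p / (p.factorial : ℂ) := by
  induction p with
  | zero => simp [creationCoeff_zero, binomZ_zero]
  | succ p ih =>
    have hp : ((p : ℂ) + 1) ≠ 0 := Nat.cast_add_one_ne_zero p
    apply mul_left_cancel₀ hp
    have e1 : ((p : ℂ) + 1) * ∑ i ∈ Finset.range (p + 1 + 1), binomZ a i * creationCoeff (p + 1) i =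
        ∑ i ∈ Finset.range (p + 1 + 1), binomZ a i * (i + 1 / 2) * creationCoeff p i +
        ∑ i ∈ Finset.range (p + 1), binomZ a (i + 1) * (i + 1) * creationCoeff p i := by
      rw [Finset.sum_range_succ', Finset.sum_range_succ' (fun i => binomZ a i * (i + 1 / 2) *
        creationCoeff p i), mul_add, Finset.mul_sum, add_right_comm, ← Finset.sum_add_distrib]
      congr 1
      · refine Finset.sum_congr rfl fun i _ => ?_
        push_cast
        linear_combination binomZ a (i + 1) * creationCoeff_succ_succ p i
      · simp only [Nat.cast_zero]
        linear_combination binomZ a 0 * creationCoeff_succ_zero p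
    rw [e1, Finset.sum_range_succ, creationCoeff_of_lt (Nat.lt_succ_self p), mul_zero, add_zero,
      ← Finset.sum_add_distrib]
    have e2 : ∀ i ∈ Finset.range (p + 1), binomZ a i * ((i : ℂ) + 1 / 2) * creationCoeff p i +
        binomZ a (i + 1) * (i + 1) * creationCoeff p i =
        ((a : ℂ) + 1 / 2) * (binomZ a i * creationCoeff p i) := fun i _ => by
      linear_combination creationCoeff p i * binomZ_succ a i
    rw [Finset.sum_congr rfl e2, ← Finset.mul_sum, ih, Nat.factorial_succ]
    have h2 : (p.factorial : ℂ) ≠ 0 := by exact_mod_cast p.factorial_ne_zero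
    push_cast
    rw [pow_succ]
    field_simp

/-- The contraction of `ψ[-k]` with `ψ[-p-1]`. -/
noncomputable def contraction (k p : ℕ) : ℂ :=
  ∑ i ∈ Finset.range (p + 1), annihilationCoeff k i * creationCoeff p i

/-- The contractions are the coefficients of `∑ e^{w/2} e^{z/2} (e^z - 1)^i / (e^w - 1)^{i+1} =
e^{(w-z)/2} / (e^{w-z} - 1)`, expanded for small `z`. The relation says that this depends on `w - z`
only, i.e. that it is killed by `∂_z + ∂_w`. -/
lemma contraction_succ (k p : ℕ) :
    (p + 1) * contraction k (p + 1) = -(k : ℂ) * contraction (k + 1) p := by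
  have e1 : ((p : ℂ) + 1) * contraction k (p + 1) =
      ∑ i ∈ Finset.range (p + 1 + 1), annihilationCoeff k i * (i + 1 / 2) * creationCoeff p i +
      ∑ i ∈ Finset.range (p + 1), annihilationCoeff k (i + 1) * (i + 1) * creationCoeff p i := by
    rw [contraction, Finset.sum_range_succ', Finset.sum_range_succ' (fun i =>
      annihilationCoeff k i * (i + 1 / 2) * creationCoeff p i), mul_add, Finset.mul_sum,
      add_right_comm, ← Finset.sum_add_distrib]
    congr 1
    · refine Finset.sum_congr rfl fun i _ => ?_
      push_cast
      linear_combination annihilationCoeff k (i + 1) * creationCoeff_succ_succ p i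
    · simp only [Nat.cast_zero]
      linear_combination annihilationCoeff k 0 * creationCoeff_succ_zero p
  rw [e1, Finset.sum_range_succ, creationCoeff_of_lt (Nat.lt_succ_self p), mul_zero, add_zero,
    ← Finset.sum_add_distrib, contraction, Finset.mul_sum]
  refine Finset.sum_congr rfl fun i _ => ?_
  linear_combination (-creationCoeff p i) * annihilationCoeff_succ k i

/-- The value at `z = 0` is the generating function of `B_n(1/2)/n!`, and `contraction_succ`
propagates it to all powers of `z`. -/
lemma contraction_eq (k p : ℕ) : contraction (k + 1) p =
    (-1) ^ p * ((k + p).choose p : ℕ) *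
      (Polynomial.aeval (((1 / 2 : ℝ) : ℝ) : ℂ) (Polynomial.bernoulli (k + p + 1)) /
        ((k + p + 1).factorial : ℂ)) := by
  induction p generalizing k with
  | zero => simp [contraction, annihilationCoeff_zero, creationCoeff_zero]
  | succ p ih =>
    have hp : ((p : ℂ) + 1) ≠ 0 := Nat.cast_add_one_ne_zero p
    apply mul_left_cancel₀ hp
    rw [contraction_succ, ih, show k + 1 + p = k + (p + 1) by ring]
    have := congrArg (Nat.cast (R := ℂ)) (Nat.choose_succ_right_eq (k + (p + 1)) p)
    rw [show k + (p + 1) - p = k + 1 by omega] at this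
    push_cast at this ⊢
    rw [pow_succ]
    linear_combination ((-1) ^ p * (Polynomial.aeval ((1 / 2 : ℂ))
      (Polynomial.bernoulli (k + (p + 1) + 1)) / ((k + (p + 1) + 1).factorial : ℂ))) * this

lemma ofPowerSeries_X_mul (a : PowerSeries ℂ) : (HahnSeries.ofPowerSeries ℤ ℂ (X * a)) =
    HahnSeries.single (1 : ℤ) (1 : ℂ) * HahnSeries.ofPowerSeries ℤ ℂ a := by
  rw [map_mul, HahnSeries.ofPowerSeries_X]

lemma squareCoeff_neg (k i : ℕ) :
    squareCoeff (1 / 2) (-((k + 1 : ℕ) : ℤ)) (-(i : ℤ) - 1) = creationCoeff k i := by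
  unfold squareCoeff
  rw [show -(-(i : ℤ) - 1) - 1 = (i : ℤ) by ring, zpow_natCast, ← map_pow, ← map_mul]
  rw [show -(-((k + 1 : ℕ) : ℤ)) - 1 = (k : ℤ) by push_cast; ring,
    HahnSeries.ofPowerSeries_apply_coeff]
  rfl

lemma squareCoeff_natCast (k l : ℕ) :
    squareCoeff (1 / 2) (-((k + 1 : ℕ) : ℤ)) (l : ℤ) = annihilationCoeff (k + 1) l := by
  unfold squareCoeff
  have e0 : (HahnSeries.ofPowerSeries ℤ ℂ expQuot)⁻¹ = HahnSeries.ofPowerSeries ℤ ℂ expQuot⁻¹ := by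
    rw [inv_eq_iff_eq_inv, eq_comm, inv_eq_of_mul_eq_one_left]
    rw [← map_mul, expQuot_mul_inv, map_one]
  rw [exp_sub_one_eq, ofPowerSeries_X_mul,
    show -(l : ℤ) - 1 = -((l + 1 : ℕ) : ℤ) by push_cast; ring, zpow_neg, zpow_natCast, mul_pow,
    mul_inv, ← inv_pow, ← inv_pow, e0, HahnSeries.inv_single, HahnSeries.single_pow, ← map_pow,
    mul_left_comm, ← map_mul]
  rw [show -(-((k + 1 : ℕ) : ℤ)) - 1 = ((l + (k + 1) : ℕ) : ℤ) + (l + 1) • (-1 : ℤ) by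
    push_cast; simp; ring, add_comm]
  simp only [inv_one, one_pow]
  rw [add_comm, HahnSeries.coeff_single_mul_add, one_mul, HahnSeries.ofPowerSeries_apply_coeff]
  rfl

/-! ### Square bracket Fock vectors -/

lemma mode_fermion (m : ℤ) : mode (fockBasis {0}) m = psi m := by
  rw [mode, linearCombination_fockBasis, Finset.sort_singleton]
  apply Finsupp.lhom_ext'
  intro T
  ext1
  change fieldMode [0] m (fockBasis T) = psi m (fockBasis T)
  simp only [fieldMode, LinearMap.add_apply, pointwiseSum, linearCombination_fockBasis]
  obtain ⟨j, rfl | rfl⟩ := exists_mode m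
  · rw [finsum_eq_zero_of_forall_eq_zero, finsum_eq_single _ j]
    · simp
    · intro i hi
      rw [if_neg (by push_cast; omega)]; simp
    · intro i
      rw [if_neg (by push_cast; omega)]; simp
  · rw [finsum_eq_single _ j, finsum_eq_zero_of_forall_eq_zero]
    · rw [if_pos (by push_cast; omega)]; simp
    · intro i
      rw [if_neg (by push_cast; omega)]; simp
    · intro i hi
      rw [if_neg (by push_cast; omega)]; simp

/-- The operator `ψ[-p-1]`. -/
noncomputable def squareCreation (p : ℕ) : Module.End ℂ Fock :=
  ∑ i ∈ Finset.range (p + 1), creationCoeff p i • creation i +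
    annihilationSum (annihilationCoeff (p + 1))

/-- The fermion has weight `1/2`, so its square bracket mode is a combination of the `ψ(m)` with
coefficients taken from `e^{z/2} (e^z - 1)^{-m-1}`: finitely many creation modes, and an
annihilation sum that is finite on each vector. -/
lemma squareMode_fermion (p : ℕ) :
    squareMode fermion (-((p + 1 : ℕ) : ℤ)) = squareCreation p := by
  rw [squareMode, fermion, linearCombination_fockBasis]
  have hw : weight {0} = 1 / 2 := by simp [weight]
  simp only [hw, mode_fermion]
  apply Finsupp.lhom_ext'
  intro T
  ext1
  change pointwiseSum _ (fockBasis T) = squareCreation p (fockBasis T)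
  rw [pointwiseSum, linearCombination_fockBasis, squareCreation, LinearMap.add_apply,
    annihilationSum, linearCombination_fockBasis, LinearMap.sum_apply]
  rw [finsum_eq_sum_of_support_subset (s := (Finset.range (p + 1)).image (fun i : ℕ => -(i : ℤ) - 1)
    ∪ T.image (fun i : ℕ => (i : ℤ))), Finset.sum_union, Finset.sum_image, Finset.sum_image]
  · congr 1
    · refine Finset.sum_congr rfl fun i _ => ?_
      rw [squareCoeff_neg, psi_neg]
    · refine Finset.sum_congr rfl fun i _ => ?_
      rw [squareCoeff_natCast, psi_natCast]; rfl
  · intro a _ b _ h; simpa using h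
  · intro a _ b _ h; simp at h; omega
  · rw [Finset.disjoint_left]
    intro a ha hb
    simp only [Finset.mem_image] at ha hb
    obtain ⟨i, -, rfl⟩ := ha
    obtain ⟨j, -, hj⟩ := hb
    omega
  · intro m hm
    obtain ⟨j, rfl | rfl⟩ := exists_mode m
    · simp only [Finset.coe_union, Finset.coe_image, Set.mem_union, Set.mem_image]
      right
      refine ⟨j, ?_, rfl⟩
      by_contra h
      apply hm
      simp only [LinearMap.smul_apply, psi_natCast]
      rw [annihilation_of_notMem (by simpa using h), smul_zero]
    · simp only [Finset.coe_union, Finset.coe_image, Set.mem_union, Set.mem_image]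
      left
      refine ⟨j, ?_, rfl⟩
      by_contra h
      apply hm
      simp only [LinearMap.smul_apply, squareCoeff_neg]
      rw [creationCoeff_of_lt (by simpa using h), zero_smul]

lemma annihilation_anticomm (i j : ℕ) (v : Fock) :
    annihilation i (annihilation j v) = -annihilation j (annihilation i v) := by
  ext S
  rw [Finsupp.neg_apply, annihilation_apply, annihilation_apply]
  have h : ∀ k, ⇑(annihilation k v) = op false k v := fun k => funext fun S =>
    annihilation_apply k v S
  rw [h, h]
  by_cases hij : i = j
  · subst hij; rw [op_op_same]; simp
  · rw [op_op_of_ne hij]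

lemma annihilationSum_annihilation (w : ℕ → ℂ) (i : ℕ) (v : Fock) :
    annihilationSum w (annihilation i v) = -annihilation i (annihilationSum w v) := by
  induction v using fock_induction with
  | h0 => simp
  | hadd v w hv hw => simp only [map_add, hv, hw]; abel
  | hs c v hv => simp only [map_smul, hv, smul_neg]
  | hb R =>
    obtain ⟨N, hR, -, -⟩ := exists_range_bound R R i
    have h1 : annihilationSum w (annihilation i (fockBasis R)) =
        ∑ j ∈ Finset.range N, w j • annihilation j (annihilation i (fockBasis R)) := by
      rw [annihilation, linearCombination_fockBasis]
      split_ifs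
      · simp only [map_smul]
        rw [annihilationSum_eq_sum w ((Finset.erase_subset _ _).trans hR), Finset.smul_sum]
        exact Finset.sum_congr rfl fun j _ => smul_comm _ _ _
      · simp
    rw [h1, annihilationSum_eq_sum w hR, map_sum, ← Finset.sum_neg_distrib]
    refine Finset.sum_congr rfl fun j _ => ?_
    rw [annihilation_anticomm, map_smul, smul_neg]

lemma annihilationSum_anticomm (w w' : ℕ → ℂ) (v : Fock) :
    annihilationSum w (annihilationSum w' v) = -annihilationSum w' (annihilationSum w v) := by
  induction v using fock_induction with
  | h0 => simp
  | hadd v w hv hw => simp only [map_add, hv, hw]; abel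
  | hs c v hv => simp only [map_smul, hv, smul_neg]
  | hb R =>
    obtain ⟨N, hR, -, -⟩ := exists_range_bound R R 0
    have h1 : annihilationSum w' (annihilationSum w (fockBasis R)) =
        ∑ j ∈ Finset.range N, w' j • annihilation j (annihilationSum w (fockBasis R)) := by
      rw [annihilationSum_eq_sum w hR, map_sum]
      have : ∀ i, annihilationSum w' (w i • annihilation i (fockBasis R)) =
          ∑ j ∈ Finset.range N, w' j • annihilation j (w i • annihilation i (fockBasis R)) := by
        intro i
        rw [map_smul, annihilationSum_annihilation, annihilationSum_eq_sum w' hR, map_sum,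
          ← Finset.sum_neg_distrib, Finset.smul_sum]
        refine Finset.sum_congr rfl fun j _ => ?_
        rw [map_smul, map_smul, annihilation_anticomm, smul_neg, smul_neg, smul_neg, neg_neg, smul_comm]
      rw [Finset.sum_congr rfl fun i _ => this i, Finset.sum_comm]
      refine Finset.sum_congr rfl fun j _ => ?_
      rw [map_sum, Finset.smul_sum]
    rw [h1, annihilationSum_eq_sum w' hR, map_sum, ← Finset.sum_neg_distrib]
    refine Finset.sum_congr rfl fun j _ => ?_
    rw [map_smul, annihilationSum_annihilation, smul_neg]

/-- The anticommutator of `∑ w(l) ψ(l)` with `ψ[-p-1]`. -/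
noncomputable def pairing (w : ℕ → ℂ) (p : ℕ) : ℂ :=
  ∑ i ∈ Finset.range (p + 1), w i * creationCoeff p i

lemma annihilationSum_squareCreation (w : ℕ → ℂ) (p : ℕ) (v : Fock) :
    annihilationSum w (squareCreation p v) =
      pairing w p • v - squareCreation p (annihilationSum w v) := by
  simp only [squareCreation, LinearMap.add_apply, LinearMap.sum_apply, LinearMap.smul_apply,
    map_add, map_sum, map_smul, annihilationSum_creation, smul_sub, Finset.sum_sub_distrib]
  rw [annihilationSum_anticomm, pairing, Finset.sum_smul]
  have : ∑ i ∈ Finset.range (p + 1), creationCoeff p i • w i • v =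
      ∑ i ∈ Finset.range (p + 1), (w i * creationCoeff p i) • v :=
    Finset.sum_congr rfl fun i _ => by rw [smul_smul, mul_comm]
  rw [this]; abel

/-- The vector `ψ[-p₁-1] ⋯ ψ[-pₘ-1] 𝟏`. -/
noncomputable def squareVector : List ℕ → Fock
  | [] => vacuum
  | p :: ps => squareCreation p (squareVector ps)

/-- All ways to remove one element of a list, with the sign of its position. -/
def removals {α : Type} : List α → List (ℂ × α × List α)
  | [] => []
  | x :: xs => (1, x, xs) :: (removals xs).map fun r => (-r.1, r.2.1, x :: r.2.2)

/-- Wick's rule: an annihilation sum anticommutes with each `ψ[-p-1]` up to a scalar and kills the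
vacuum. -/
lemma annihilationSum_squareVector (w : ℕ → ℂ) (ps : List ℕ) :
    annihilationSum w (squareVector ps) =
      ((removals ps).map fun r => (r.1 * pairing w r.2.1) • squareVector r.2.2).sum := by
  induction ps with
  | nil => simp [squareVector, removals, annihilationSum_vacuum]
  | cons p ps ih =>
    rw [squareVector, annihilationSum_squareCreation, ih, removals, List.map_cons, List.sum_cons,
      List.map_map, sub_eq_add_neg, map_list_sum, List.map_map, one_mul]
    congr 1
    rw [← neg_one_smul ℂ, List.smul_sum, List.map_map]
    congr 1
    refine List.map_congr_left fun r _ => ?_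
    simp [squareVector]

/-! ### Wick rules for the vertex operators of square bracket vectors -/

/-- The function `x^p / p!` at `x = m + 1/2`. -/
noncomputable def modeWeight (p : ℕ) (m : ℤ) : ℂ := ((m : ℂ) + 1 / 2) ^ p / (p.factorial : ℂ)

lemma normalOp_sum (s : Finset ℕ) (c : ℕ → ℂ) (w : ℕ → ℤ → ℂ) (K : Kernel) :
    normalOp (fun m => ∑ i ∈ s, c i * w i m) K = ∑ i ∈ s, c i • normalOp (w i) K := by
  funext S T
  simp only [normalOp, Finset.sum_apply, Pi.smul_apply, smul_eq_mul, mul_add,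
    Finset.sum_add_distrib, Finset.mul_sum, Finset.sum_mul]
  congr 1
  · rw [Finset.sum_comm]; exact Finset.sum_congr rfl fun i _ => Finset.sum_congr rfl fun j _ => by ring
  · rw [Finset.sum_comm]; exact Finset.sum_congr rfl fun i _ => Finset.sum_congr rfl fun j _ => by ring

/-- The creation part of `ψ[-p-1]` makes a normally ordered product whose mode weights add up to
`(m+1/2)^p/p!`; its annihilation part contracts with the remaining fermions. -/
lemma vertexKernel_squareVector_cons (p : ℕ) (ps : List ℕ) :
    vertexKernel (squareVector (p :: ps)) =
      normalOp (modeWeight p) (vertexKernel (squareVector ps)) +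
        ((removals ps).map fun r => (r.1 * contraction (p + 1) r.2.1) •
          vertexKernel (squareVector r.2.2)).sum := by
  have hw : modeWeight p = fun m => ∑ i ∈ Finset.range (p + 1), creationCoeff p i * binomZ m i := by
    funext m
    rw [modeWeight, ← sum_binomZ_mul_creationCoeff]
    exact Finset.sum_congr rfl fun i _ => mul_comm _ _
  rw [squareVector, squareCreation, LinearMap.add_apply, map_add, LinearMap.sum_apply, map_sum, hw,
    normalOp_sum, annihilationSum_squareVector, map_list_sum, List.map_map]
  congr 1
  · refine Finset.sum_congr rfl fun i _ => ?_
    rw [LinearMap.smul_apply, map_smul, vertexKernel_creation]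
  · congr 1
    refine List.map_congr_left fun r _ => ?_
    simp [pairing, contraction]

lemma gradedComm_vertexKernel_squareVector (m : ℤ) (ps : List ℕ) :
    gradedComm m (vertexKernel (squareVector ps)) =
      ((removals ps).map fun r => (r.1 * modeWeight r.2.1 m) •
        vertexKernel (squareVector r.2.2)).sum := by
  rw [gradedComm_vertexKernel, annihilationSum_squareVector, map_list_sum, List.map_map]
  congr 1
  refine List.map_congr_left fun r _ => ?_
  simp only [Function.comp, map_smul, pairing, modeWeight, sum_binomZ_mul_creationCoeff]

lemma length_of_mem_removals {α : Type} {xs : List α} {r : ℂ × α × List α}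
    (h : r ∈ removals xs) : r.2.2.length + 1 = xs.length := by
  induction xs generalizing r with
  | nil => simp [removals] at h
  | cons x xs ih =>
    simp only [removals, List.mem_cons, List.mem_map] at h
    rcases h with rfl | ⟨r', h', rfl⟩
    · rfl
    · simp [ih h']

lemma parityConj_vertexKernel_squareVector (ps : List ℕ) :
    parityConj (vertexKernel (squareVector ps)) =
      (-1 : ℂ) ^ ps.length • vertexKernel (squareVector ps) := by
  have key : ∀ n : ℕ, ∀ ps : List ℕ, ps.length = n → parityConj (vertexKernel (squareVector ps)) =
      (-1 : ℂ) ^ ps.length • vertexKernel (squareVector ps) := by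
    intro n
    -- Strong induction, because the contraction terms have two fermions fewer.
    induction n using Nat.strong_induction_on with
    | _ n ih =>
      intro ps hps
      cases ps with
      | nil => simp [squareVector, vertexKernel_vacuum, parityConj_idKernel]
      | cons p ps =>
        simp only [List.length_cons] at hps
        rw [vertexKernel_squareVector_cons, parityConj_add, parityConj_normalOp,
          ih ps.length (by omega) ps rfl, normalOp_smul, smul_add, List.length_cons, pow_succ]
        congr 1
        · simp
        · have hsum : ∀ l : List Kernel, parityConj l.sum = (l.map parityConj).sum := by
            intro l
            induction l with
            | nil => funext S T; simp [parityConj]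
            | cons K l ih => simp [parityConj_add, ih]
          rw [hsum, List.smul_sum, List.map_map, List.map_map]
          congr 1
          refine List.map_congr_left fun r hr => ?_
          have hl := length_of_mem_removals hr
          simp only [Function.comp]
          rw [parityConj_smul, ih _ (by omega) _ rfl, smul_comm, ← hl, pow_succ]
          simp
  exact key _ ps rfl

end FreeFermion

namespace FreeFermion

open scoped ENNReal

/-! ### Growth of matrix entries -/

/-- The comparison kernel `exp(α deg S - β deg T)`. -/
noncomputable def growth (α β : ℝ) (S T : Finset ℕ) : ℝ≥0∞ :=
  ENNReal.ofReal (Real.exp (α * deg S - β * deg T))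

/-- Entries bounded by a multiple of `exp(α deg S - β deg T)`. -/
def IsBddKernel (α β : ℝ) (b : Finset ℕ → Finset ℕ → ℝ≥0∞) : Prop :=
  ∃ C : ℝ≥0∞, C ≠ ∞ ∧ ∀ S T, b S T ≤ C * growth α β S T

/-- Entries of subexponential growth. -/
def IsSubexp (b : Finset ℕ → Finset ℕ → ℝ≥0∞) : Prop := ∀ ε > 0, IsBddKernel ε (-ε) b

lemma growth_ne_top (α β : ℝ) (S T : Finset ℕ) : growth α β S T ≠ ∞ := ENNReal.ofReal_ne_top

lemma growth_mul (α β α' β' : ℝ) (S T : Finset ℕ) :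
    growth α β S T * growth α' β' S T = growth (α + α') (β + β') S T := by
  unfold growth
  rw [← ENNReal.ofReal_mul (Real.exp_nonneg _), ← Real.exp_add]
  congr 2; ring

lemma growth_mono {α β α' β' : ℝ} (hα : α ≤ α') (hβ : β' ≤ β) (S T : Finset ℕ) :
    growth α β S T ≤ growth α' β' S T := by
  unfold growth
  apply ENNReal.ofReal_le_ofReal
  apply Real.exp_le_exp.mpr
  gcongr

namespace IsBddKernel

variable {α β α' β' : ℝ} {b b' : Finset ℕ → Finset ℕ → ℝ≥0∞}

lemma ne_top (h : IsBddKernel α β b) (S T : Finset ℕ) : b S T ≠ ∞ := by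
  obtain ⟨C, hC, h⟩ := h
  exact ne_top_of_le_ne_top (ENNReal.mul_ne_top hC (growth_ne_top _ _ _ _)) (h S T)

lemma mono (h : IsBddKernel α β b) (hb : ∀ S T, b' S T ≤ b S T) : IsBddKernel α β b' := by
  obtain ⟨C, hC, h⟩ := h
  exact ⟨C, hC, fun S T => (hb S T).trans (h S T)⟩

lemma weaken (h : IsBddKernel α β b) (hα : α ≤ α') (hβ : β' ≤ β) : IsBddKernel α' β' b := by
  obtain ⟨C, hC, h⟩ := h
  exact ⟨C, hC, fun S T => (h S T).trans (mul_le_mul_right (growth_mono hα hβ S T) C)⟩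

lemma add (h : IsBddKernel α β b) (h' : IsBddKernel α β b') :
    IsBddKernel α β fun S T => b S T + b' S T := by
  obtain ⟨C, hC, h⟩ := h
  obtain ⟨C', hC', h'⟩ := h'
  refine ⟨C + C', ENNReal.add_ne_top.mpr ⟨hC, hC'⟩, fun S T => ?_⟩
  rw [add_mul]
  exact add_le_add (h S T) (h' S T)

lemma const_mul (h : IsBddKernel α β b) {c : ℝ≥0∞} (hc : c ≠ ∞) :
    IsBddKernel α β fun S T => c * b S T := by
  obtain ⟨C, hC, h⟩ := h
  refine ⟨c * C, ENNReal.mul_ne_top hc hC, fun S T => ?_⟩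
  rw [mul_assoc]
  exact mul_le_mul_right (h S T) c

lemma growth_mul (h : IsBddKernel α β b) (γ δ : ℝ) :
    IsBddKernel (γ + α) (δ + β) fun S T => growth γ δ S T * b S T := by
  obtain ⟨C, hC, h⟩ := h
  refine ⟨C, hC, fun S T => ?_⟩
  rw [← FreeFermion.growth_mul, mul_left_comm]
  exact mul_le_mul_right (h S T) _

end IsBddKernel

/-- The sum over finite sets is the expanded product `∏ (1 + e^{-δ(2i+1)})`, which converges with
the geometric series. It controls both matrix products and traces. -/
lemma tsum_exp_deg_ne_top {δ : ℝ} (hδ : 0 < δ) :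
    ∑' T : Finset ℕ, ENNReal.ofReal (Real.exp (-δ * deg T)) ≠ ∞ := by
  have h1 : Summable fun i : ℕ => Real.exp (-δ * (2 * i + 1)) := by
    have : ∀ i : ℕ, Real.exp (-δ * (2 * i + 1)) = Real.exp (-δ) * (Real.exp (-(2 * δ))) ^ i := by
      intro i; rw [← Real.exp_nat_mul, ← Real.exp_add]; congr 1; ring
    simp only [this]
    exact (summable_geometric_of_lt_one (Real.exp_nonneg _)
      (by rw [← Real.exp_zero]; exact Real.exp_lt_exp.mpr (by linarith))).mul_left _
  have h2 := summable_finsetProd_of_summable_nonneg (fun i => Real.exp_nonneg _) h1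
  have h3 : ∀ T : Finset ℕ, ∏ i ∈ T, Real.exp (-δ * (2 * i + 1)) = Real.exp (-δ * deg T) := by
    intro T
    rw [← Real.exp_sum, ← Finset.mul_sum]
    simp [deg]
  simp only [h3] at h2
  exact h2.tsum_ofReal_ne_top

/-- The intermediate index contributes `e^{-(β - α') deg T}`, so the strict gap between the column
exponent of the first factor and the row exponent of the second is what makes the product converge.
-/
lemma IsBddKernel.comp {α β α' β' : ℝ} {b b' : Finset ℕ → Finset ℕ → ℝ≥0∞}
    (h : IsBddKernel α β b) (h' : IsBddKernel α' β' b') (hlt : α' < β) :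
    IsBddKernel α β' fun S U => ∑' T, b S T * b' T U := by
  obtain ⟨C, hC, h⟩ := h
  obtain ⟨C', hC', h'⟩ := h'
  refine ⟨C * C' * ∑' T : Finset ℕ, ENNReal.ofReal (Real.exp (-(β - α') * deg T)),
    ENNReal.mul_ne_top (ENNReal.mul_ne_top hC hC') (tsum_exp_deg_ne_top (by linarith)),
    fun S U => ?_⟩
  rw [← ENNReal.tsum_mul_left, ← ENNReal.tsum_mul_right]
  refine ENNReal.tsum_le_tsum fun T => ?_
  calc b S T * b' T U ≤ (C * growth α β S T) * (C' * growth α' β' T U) := mul_le_mul' (h S T) (h' T U)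
    _ = C * C' * (growth α β S T * growth α' β' T U) := by ring
    _ = _ := by
      rw [mul_assoc (C * C')]
      congr 1
      unfold growth
      rw [← ENNReal.ofReal_mul (Real.exp_nonneg _), ← ENNReal.ofReal_mul (Real.exp_nonneg _),
        ← Real.exp_add, ← Real.exp_add]
      congr 2; ring

lemma IsBddKernel.trace {α β δ : ℝ} {b : Finset ℕ → Finset ℕ → ℝ≥0∞} (h : IsBddKernel α β b)
    (hlt : α < β + δ) :
    ∑' T : Finset ℕ, ENNReal.ofReal (Real.exp (-δ * deg T)) * b T T ≠ ∞ := by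
  obtain ⟨C, hC, h⟩ := h
  refine ne_top_of_le_ne_top (ENNReal.mul_ne_top hC
    (tsum_exp_deg_ne_top (sub_pos.mpr hlt))) ?_
  rw [← ENNReal.tsum_mul_left]
  refine ENNReal.tsum_le_tsum fun T => ?_
  calc _ ≤ ENNReal.ofReal (Real.exp (-δ * deg T)) * (C * growth α β T T) :=
        mul_le_mul_right (h T T) _
    _ = _ := by
      rw [mul_left_comm]
      congr 1
      unfold growth
      rw [← ENNReal.ofReal_mul (Real.exp_nonneg _), ← Real.exp_add]
      congr 2; ring

lemma IsSubexp.add {b b' : Finset ℕ → Finset ℕ → ℝ≥0∞} (h : IsSubexp b) (h' : IsSubexp b') :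
    IsSubexp fun S T => b S T + b' S T := fun ε hε => (h ε hε).add (h' ε hε)

lemma IsSubexp.mono {b b' : Finset ℕ → Finset ℕ → ℝ≥0∞} (h : IsSubexp b)
    (hb : ∀ S T, b' S T ≤ b S T) : IsSubexp b' := fun ε hε => (h ε hε).mono hb

lemma IsSubexp.const_mul {b : Finset ℕ → Finset ℕ → ℝ≥0∞} (h : IsSubexp b) {c : ℝ≥0∞}
    (hc : c ≠ ∞) : IsSubexp fun S T => c * b S T := fun ε hε => (h ε hε).const_mul hc

lemma isSubexp_zero : IsSubexp fun _ _ => 0 := fun _ _ => ⟨0, by simp, fun _ _ => by simp⟩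

lemma IsSubexp.finset_sum {ι : Type*} {b : ι → Finset ℕ → Finset ℕ → ℝ≥0∞} (s : Finset ι)
    (h : ∀ i, IsSubexp (b i)) : IsSubexp fun S T => ∑ i ∈ s, b i S T := by
  classical
  induction s using Finset.induction_on with
  | empty => simpa using isSubexp_zero
  | insert i s hi ih =>
    simp only [Finset.sum_insert hi]
    exact (h i).add ih

lemma isBddKernel_idKernel {α β : ℝ} (h : β ≤ α) :
    IsBddKernel α β fun S T => ‖idKernel S T‖ₑ := by
  refine ⟨1, by simp, fun S T => ?_⟩
  by_cases hST : S = T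
  · subst hST
    simp only [idKernel, if_true, enorm_one, one_mul, growth]
    rw [← ENNReal.ofReal_one]
    apply ENNReal.ofReal_le_ofReal
    rw [← sub_mul]
    exact Real.one_le_exp (mul_nonneg (by linarith) (Nat.cast_nonneg _))
  · simp [idKernel, hST]

lemma isSubexp_idKernel : IsSubexp fun S T => ‖idKernel S T‖ₑ := fun _ hε =>
  isBddKernel_idKernel (by linarith)

/-- Weights of subexponential growth. -/
def IsSubexpWeight (w : ℕ → ℂ) : Prop :=
  ∀ ε > 0, ∃ C : ℝ≥0∞, C ≠ ∞ ∧ ∀ j : ℕ, ‖w j‖ₑ ≤ C * ENNReal.ofReal (Real.exp (ε * (2 * j + 1)))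

lemma isSubexpWeight_of_le {w : ℕ → ℂ} (A : ℝ) (p r : ℕ)
    (h : ∀ j : ℕ, ‖w j‖ ≤ A * ((j : ℝ) + r) ^ p / p.factorial) : IsSubexpWeight w := by
  intro ε hε
  refine ⟨ENNReal.ofReal (|A| * (ε⁻¹ ^ p * Real.exp (ε * r))), ENNReal.ofReal_ne_top, fun j => ?_⟩
  rw [← ENNReal.ofReal_mul (by positivity), ← ofReal_norm]
  apply ENNReal.ofReal_le_ofReal
  -- Scaling the argument by `ε` trades the polynomial for an arbitrarily slow exponential at the
  -- cost `ε⁻¹ ^ p`.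
  have h1 := Real.pow_div_factorial_le_exp (x := ε * ((j : ℝ) + r)) (by positivity) p
  have hε' : ε⁻¹ ^ p * ε ^ p = 1 := by rw [← mul_pow, inv_mul_cancel₀ hε.ne', one_pow]
  calc ‖w j‖ ≤ A * ((j : ℝ) + r) ^ p / p.factorial := h j
    _ ≤ |A| * (((j : ℝ) + r) ^ p / p.factorial) := by
      rw [mul_div_assoc]; gcongr; exact le_abs_self A
    _ = |A| * (ε⁻¹ ^ p * ((ε * ((j : ℝ) + r)) ^ p / p.factorial)) := by
      rw [mul_pow, mul_div_assoc (ε ^ p), ← mul_assoc (ε⁻¹ ^ p), hε', one_mul]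
    _ ≤ |A| * (ε⁻¹ ^ p * Real.exp (ε * ((j : ℝ) + r))) := by gcongr
    _ ≤ |A| * (ε⁻¹ ^ p * (Real.exp (ε * r) * Real.exp (ε * (2 * j + 1)))) := by
      rw [← Real.exp_add]
      gcongr
      have : (0 : ℝ) ≤ j := Nat.cast_nonneg j
      nlinarith
    _ = _ := by ring

lemma isSubexpWeight_modeWeight (p : ℕ) : IsSubexpWeight fun j => modeWeight p j := by
  refine isSubexpWeight_of_le 1 p 1 fun j => ?_
  rw [modeWeight, norm_div, norm_pow, one_mul]
  simp only [Int.cast_natCast, Complex.norm_natCast]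
  gcongr
  rw [show (j : ℂ) + 1 / 2 = (((j : ℝ) + 1 / 2 : ℝ) : ℂ) by push_cast; ring, Complex.norm_real,
    Real.norm_of_nonneg (by positivity)]
  push_cast; linarith

lemma modeWeight_neg (p : ℕ) (m : ℤ) : modeWeight p (-m - 1) = (-1) ^ p * modeWeight p m := by
  unfold modeWeight
  rw [show ((-m - 1 : ℤ) : ℂ) + 1 / 2 = (-1) * ((m : ℂ) + 1 / 2) by push_cast; ring, mul_pow]
  ring

lemma isSubexpWeight_modeWeight_neg (p : ℕ) :
    IsSubexpWeight fun j => modeWeight p (-(j : ℤ) - 1) := by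
  intro ε hε
  obtain ⟨C, hC, h⟩ := isSubexpWeight_modeWeight p ε hε
  refine ⟨C, hC, fun j => ?_⟩
  change ‖modeWeight p (-(j : ℤ) - 1)‖ₑ ≤ _
  rw [modeWeight_neg, enorm_mul, enorm_pow, enorm_neg, enorm_one, one_pow, one_mul]
  exact h j

lemma isSubexpWeight_binomZ (i : ℕ) : IsSubexpWeight fun j => binomZ j i := by
  refine isSubexpWeight_of_le 1 i 0 fun j => ?_
  rw [binomZ_natCast, Complex.norm_natCast, one_mul]
  simpa using Nat.choose_le_pow_div (α := ℝ) i j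

lemma isSubexpWeight_binomZ_neg (i : ℕ) : IsSubexpWeight fun j => binomZ (-(j : ℤ) - 1) i := by
  refine isSubexpWeight_of_le 1 i i fun j => ?_
  rw [binomZ_neg, norm_mul, norm_pow, norm_neg, norm_one, one_pow, Complex.norm_natCast, one_mul,
    one_mul]
  have := Nat.choose_le_pow_div (α := ℝ) i (j + i)
  push_cast at this
  exact this

lemma card_le_exp {ε : ℝ} (hε : 0 < ε) (S : Finset ℕ) :
    (S.card : ℝ≥0∞) ≤ ENNReal.ofReal ε⁻¹ * ENNReal.ofReal (Real.exp (ε * deg S)) := by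
  rw [← ENNReal.ofReal_mul (by positivity), ← ENNReal.ofReal_natCast]
  apply ENNReal.ofReal_le_ofReal
  have h1 : S.card ≤ deg S := by
    unfold deg
    rw [Finset.card_eq_sum_ones]
    exact Finset.sum_le_sum fun i _ => by omega
  have h2 : (S.card : ℝ) ≤ deg S := by exact_mod_cast h1
  have h3 := Real.add_one_le_exp (ε * deg S)
  calc (S.card : ℝ) ≤ ε⁻¹ * (ε * deg S) := by
        rw [← mul_assoc, inv_mul_cancel₀ hε.ne', one_mul]; exact h2
    _ ≤ _ := by gcongr; linarith

/-- Half of `ε` bounds each term, the exponential of the weight of `j` restoring exactly the degree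
lost by erasing `j`. The other half absorbs the number of terms. -/
lemma isSubexp_sum_left {c : ℕ → ℂ} (hc : IsSubexpWeight c) {b : Finset ℕ → Finset ℕ → ℝ≥0∞}
    (hb : IsSubexp b) : IsSubexp fun S T => ∑ j ∈ S, ‖c j‖ₑ * b (S.erase j) T := by
  intro ε hε
  obtain ⟨C, hC, h⟩ := hc (ε / 2) (by linarith)
  obtain ⟨D, hD, h'⟩ := hb (ε / 2) (by linarith)
  refine ⟨C * D * ENNReal.ofReal (ε / 2)⁻¹, ENNReal.mul_ne_top (ENNReal.mul_ne_top hC hD)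
    ENNReal.ofReal_ne_top, fun S T => ?_⟩
  have key : ∀ j ∈ S, ‖c j‖ₑ * b (S.erase j) T ≤ C * D * growth (ε / 2) (-(ε / 2)) S T := by
    intro j hj
    calc _ ≤ (C * ENNReal.ofReal (Real.exp (ε / 2 * (2 * j + 1)))) *
          (D * growth (ε / 2) (-(ε / 2)) (S.erase j) T) := mul_le_mul' (h j) (h' _ _)
      _ = C * D * (ENNReal.ofReal (Real.exp (ε / 2 * (2 * j + 1))) *
          growth (ε / 2) (-(ε / 2)) (S.erase j) T) := by ring
      _ = _ := by
        congr 1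
        unfold growth
        rw [← ENNReal.ofReal_mul (Real.exp_nonneg _), ← Real.exp_add, ← deg_erase hj]
        congr 2; push_cast; ring
  calc _ ≤ ∑ j ∈ S, C * D * growth (ε / 2) (-(ε / 2)) S T := Finset.sum_le_sum key
    _ = C * D * (S.card * growth (ε / 2) (-(ε / 2)) S T) := by
      rw [Finset.sum_const, nsmul_eq_mul]; ring
    _ ≤ C * D * (ENNReal.ofReal (ε / 2)⁻¹ * ENNReal.ofReal (Real.exp (ε / 2 * deg S)) *
        growth (ε / 2) (-(ε / 2)) S T) := by
      gcongr; exact card_le_exp (by linarith) S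
    _ ≤ C * D * ENNReal.ofReal (ε / 2)⁻¹ * growth ε (-ε) S T := by
      rw [mul_assoc (ENNReal.ofReal _), ← mul_assoc]
      gcongr
      unfold growth
      rw [← ENNReal.ofReal_mul (Real.exp_nonneg _), ← Real.exp_add]
      apply ENNReal.ofReal_le_ofReal
      apply Real.exp_le_exp.mpr
      have : (0 : ℝ) ≤ deg T := Nat.cast_nonneg _
      nlinarith

lemma isSubexp_swap {b : Finset ℕ → Finset ℕ → ℝ≥0∞} (hb : IsSubexp b) :
    IsSubexp fun S T => b T S := by
  intro ε hε
  obtain ⟨C, hC, h⟩ := hb ε hε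
  refine ⟨C, hC, fun S T => (h T S).trans (le_of_eq ?_)⟩
  unfold growth
  congr 3; ring

lemma isSubexp_sum_right {c : ℕ → ℂ} (hc : IsSubexpWeight c) {b : Finset ℕ → Finset ℕ → ℝ≥0∞}
    (hb : IsSubexp b) : IsSubexp fun S T => ∑ j ∈ T, ‖c j‖ₑ * b S (T.erase j) :=
  isSubexp_swap (isSubexp_sum_left hc (isSubexp_swap hb))

lemma enorm_parityConj (K : Kernel) (S T : Finset ℕ) : ‖parityConj K S T‖ₑ = ‖K S T‖ₑ := by
  rw [parityConj, enorm_mul, enorm_pow, enorm_neg, enorm_one, one_pow, one_mul]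

lemma enorm_orderSign (j : ℕ) (S : Finset ℕ) : ‖orderSign j S‖ₑ = 1 := by
  rw [orderSign, enorm_pow, enorm_neg, enorm_one, one_pow]

lemma tsum_enorm_leftMul (c : ℕ → ℂ) (K : Kernel) (S T : Finset ℕ) :
    ∑' j : ℕ, ‖c j * leftMul (-(j : ℤ) - 1) K S T‖ₑ = ∑ j ∈ S, ‖c j‖ₑ * ‖K (S.erase j) T‖ₑ := by
  rw [tsum_eq_sum (s := S)]
  · refine Finset.sum_congr rfl fun j hj => ?_
    rw [leftMul_neg_apply, if_pos hj, enorm_mul, enorm_mul, enorm_orderSign, one_mul]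
  · intro j hj
    rw [leftMul_neg_apply, if_neg hj, mul_zero, enorm_zero]

lemma tsum_enorm_rightMul (c : ℕ → ℂ) (K : Kernel) (S T : Finset ℕ) :
    ∑' j : ℕ, ‖c j * rightMul j K S T‖ₑ = ∑ j ∈ T, ‖c j‖ₑ * ‖K S (T.erase j)‖ₑ := by
  rw [tsum_eq_sum (s := T)]
  · refine Finset.sum_congr rfl fun j hj => ?_
    rw [rightMul_natCast_apply, if_pos hj, enorm_mul, enorm_mul, enorm_orderSign, one_mul,
      enorm_parityConj]
  · intro j hj
    rw [rightMul_natCast_apply, if_neg hj, mul_zero, enorm_zero]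

/-- A kernel of subexponential growth. -/
abbrev IsSubexpKernel (K : Kernel) : Prop := IsSubexp fun S T => ‖K S T‖ₑ

lemma isSubexp_leftMul {c : ℕ → ℂ} (hc : IsSubexpWeight c) {K : Kernel} (hK : IsSubexpKernel K) :
    IsSubexp fun S T => ∑' j : ℕ, ‖c j * leftMul (-(j : ℤ) - 1) K S T‖ₑ := by
  simp only [tsum_enorm_leftMul]
  exact isSubexp_sum_left hc hK

lemma isSubexp_rightMul {c : ℕ → ℂ} (hc : IsSubexpWeight c) {K : Kernel} (hK : IsSubexpKernel K) :
    IsSubexp fun S T => ∑' j : ℕ, ‖c j * rightMul j K S T‖ₑ := by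
  simp only [tsum_enorm_rightMul]
  exact isSubexp_sum_right hc hK

lemma isSubexpKernel_normalOp {w : ℤ → ℂ} (h1 : IsSubexpWeight fun j => w j)
    (h2 : IsSubexpWeight fun j => w (-(j : ℤ) - 1)) {K : Kernel} (hK : IsSubexpKernel K) :
    IsSubexpKernel (normalOp w K) := by
  refine IsSubexp.mono ((isSubexp_sum_left h1 hK).add (isSubexp_sum_right h2 hK)) fun S T => ?_
  refine (enorm_add_le _ _).trans (add_le_add ?_ ?_)
  · refine (enorm_sum_le _ _).trans (Finset.sum_le_sum fun j hj => le_of_eq ?_)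
    rw [leftMul_neg_apply, if_pos hj, enorm_mul, enorm_mul, enorm_orderSign, one_mul]
  · refine (enorm_sum_le _ _).trans (Finset.sum_le_sum fun j hj => le_of_eq ?_)
    rw [rightMul_natCast_apply, if_pos hj, enorm_mul, enorm_mul, enorm_orderSign, one_mul,
      enorm_parityConj]

lemma isSubexpKernel_fieldKernel (l : List ℕ) : IsSubexpKernel (fieldKernel l) := by
  induction l with
  | nil => exact isSubexp_idKernel
  | cons i is ih =>
    exact isSubexpKernel_normalOp (isSubexpWeight_binomZ i) (isSubexpWeight_binomZ_neg i) ih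

/-! ### Modes at a given energy -/

/-- The entry of the mode `v(n)`. -/
noncomputable def modeEntry (v : Fock) (n : ℤ) : Kernel := fun S T =>
  ∑ R ∈ v.support, v R * if (deg S : ℤ) = deg T + deg R - 2 * (n + 1)
    then fieldKernel (R.sort (· ≤ ·)) S T else 0

lemma listDeg_sort (R : Finset ℕ) : listDeg (R.sort (· ≤ ·)) = deg R := by
  unfold listDeg deg
  rw [← Multiset.sum_coe, ← Multiset.map_coe, Finset.sort_eq]
  rfl

lemma vertexTerm_apply (v : Fock) (z : ℂ) (n : ℤ) (S T : Finset ℕ) :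
    vertexTerm v z n (fockBasis T) S =
      Complex.exp (((deg S : ℂ) - deg T) / 2 * z) * modeEntry v n S T := by
  rw [vertexTerm, Finsupp.linearCombination_apply, Finsupp.sum, LinearMap.sum_apply,
    Finsupp.finsetSum_apply, modeEntry, Finset.mul_sum]
  refine Finset.sum_congr rfl fun R _ => ?_
  rw [LinearMap.smul_apply, LinearMap.smul_apply, Finsupp.smul_apply, Finsupp.smul_apply, mode,
    linearCombination_fockBasis, fieldMode_apply, listDeg_sort, smul_eq_mul, smul_eq_mul]
  split_ifs with h
  · have h2 : (deg S : ℂ) = deg T + deg R - 2 * (n + 1) := by exact_mod_cast congrArg (Int.cast (R := ℂ)) h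
    have h3 : weight R - n - 1 = ((deg S : ℂ) - deg T) / 2 := by
      rw [weight_eq_deg, h2]; ring
    rw [h3]; ring
  · simp

lemma deg_mod_two (S : Finset ℕ) : (-1 : ℤ) ^ deg S = (-1) ^ S.card := by
  unfold deg
  rw [← Finset.prod_pow_eq_pow_sum, ← Finset.prod_const]
  exact Finset.prod_congr rfl fun i _ => by rw [pow_succ, pow_mul]; simp

/-- The degree has the parity of the cardinality, and a nonzero entry respects fermion parity; hence
the required mode is an integer and not a half-integer. -/
lemma exists_mode_of_ne_zero {R S T : Finset ℕ} (h : fieldKernel (R.sort (· ≤ ·)) S T ≠ 0) :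
    ∃ n : ℤ, (deg S : ℤ) = deg T + deg R - 2 * (n + 1) := by
  have h1 := congrFun (congrFun (parityConj_fieldKernel (R.sort (· ≤ ·))) S) T
  simp only [parityConj, Pi.smul_apply, smul_eq_mul, Finset.length_sort] at h1
  have h2 := mul_right_cancel₀ h h1
  have h3 : (-1 : ℤ) ^ (S.card + T.card) = (-1) ^ R.card := by exact_mod_cast h2
  have h4 : (-1 : ℤ) ^ (deg S + deg T) = (-1) ^ deg R := by
    rw [pow_add, deg_mod_two, deg_mod_two, deg_mod_two, ← pow_add, h3]
  have h5 : Even (deg S + deg T) ↔ Even (deg R) := by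
    rw [← neg_one_pow_eq_one_iff_even (R := ℤ) (by decide), h4,
      neg_one_pow_eq_one_iff_even (by decide)]
  have h6 : ((deg S : ℤ) + deg T + deg R) % 2 = 0 := by
    rw [Nat.even_iff, Nat.even_iff] at h5
    omega
  exact ⟨((deg T : ℤ) + deg R - deg S) / 2 - 1, by omega⟩

lemma tsum_enorm_modeEntry_le (v : Fock) (S T : Finset ℕ) : ∑' n, ‖modeEntry v n S T‖ₑ ≤
    ∑ R ∈ v.support, ‖v R‖ₑ * ‖fieldKernel (R.sort (· ≤ ·)) S T‖ₑ := by
  calc _ ≤ ∑' n : ℤ, ∑ R ∈ v.support, ‖v R‖ₑ * ‖if (deg S : ℤ) = deg T + deg R - 2 * (n + 1)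
        then fieldKernel (R.sort (· ≤ ·)) S T else 0‖ₑ := by
        refine ENNReal.tsum_le_tsum fun n => (enorm_sum_le _ _).trans (le_of_eq ?_)
        exact Finset.sum_congr rfl fun R _ => enorm_mul _ _
    _ = ∑ R ∈ v.support, ∑' n : ℤ, ‖v R‖ₑ * ‖if (deg S : ℤ) = deg T + deg R - 2 * (n + 1)
        then fieldKernel (R.sort (· ≤ ·)) S T else 0‖ₑ :=
      Summable.tsum_finsetSum fun _ _ => ENNReal.summable
    _ ≤ _ := by
      refine Finset.sum_le_sum fun R _ => ?_
      rw [ENNReal.tsum_mul_left]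
      gcongr
      rw [tsum_eq_single (((deg T : ℤ) + deg R - deg S) / 2 - 1)]
      · split_ifs <;> simp
      · intro n hn
        rw [if_neg (by omega), enorm_zero]

lemma isSubexp_modeEntry (v : Fock) : IsSubexp fun S T => ∑' n, ‖modeEntry v n S T‖ₑ := by
  refine IsSubexp.mono ?_ (tsum_enorm_modeEntry_le v)
  exact IsSubexp.finset_sum _ fun R => (isSubexpKernel_fieldKernel _).const_mul (by simp)

/-- For each basis component of `v` at most one mode contributes to a given entry, and exactly one
does when the entry is nonzero. -/
lemma hasSum_modeEntry (v : Fock) (S T : Finset ℕ) :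
    HasSum (fun n => modeEntry v n S T) (vertexKernel v S T) := by
  rw [vertexKernel, Finsupp.linearCombination_apply, Finsupp.sum, Finset.sum_apply,
    Finset.sum_apply]
  refine hasSum_sum fun R _ => ?_
  rw [Pi.smul_apply, Pi.smul_apply, smul_eq_mul]
  refine HasSum.mul_left _ ?_
  by_cases h : fieldKernel (R.sort (· ≤ ·)) S T = 0
  · simp [h]
  · obtain ⟨n, hn⟩ := exists_mode_of_ne_zero h
    have : ∀ n' : ℤ, (deg S : ℤ) = deg T + deg R - 2 * (n' + 1) ↔ n' = n := by intro n'; omega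
    simp only [this]
    exact hasSum_ite_eq n _

lemma isSubexpKernel_vertexKernel (v : Fock) : IsSubexpKernel (vertexKernel v) := by
  refine (isSubexp_modeEntry v).mono fun S T => ?_
  rw [← (hasSum_modeEntry v S T).tsum_eq]
  exact enorm_tsum_le_tsum_enorm

end FreeFermion

namespace FreeFermion

open scoped ENNReal Topology

/-! ### Products of vertex operators -/

/-- Conjugation of a matrix by `e^{z L(0)}`. -/
noncomputable def twist (z : ℂ) (K : Kernel) : Kernel := fun S T =>
  Complex.exp (((deg S : ℂ) - deg T) / 2 * z) * K S T

/-- The matrix product. -/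
noncomputable def kernelMul (A B : Kernel) : Kernel := fun S U => ∑' T, A S T * B T U

/-- The matrix of a product of vertex operators at given points. -/
noncomputable def prodKernel : List (Kernel × ℂ) → Kernel
  | [] => idKernel
  | x :: L => kernelMul (twist x.2 x.1) (prodKernel L)

lemma enorm_twistFactor (z : ℂ) (S T : Finset ℕ) :
    ‖Complex.exp (((deg S : ℂ) - deg T) / 2 * z)‖ₑ = growth (z.re / 2) (z.re / 2) S T := by
  rw [← ofReal_norm, Complex.norm_exp, growth]
  congr 2
  rw [show ((deg S : ℂ) - deg T) / 2 * z = ((((deg S : ℝ) - deg T) / 2 : ℝ) : ℂ) * z by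
    push_cast; ring, Complex.re_ofReal_mul]
  ring

/-- The exponent is linear in `x`, so it is largest at one of the endpoints. This gives bounds
uniform over a strip of insertion points. -/
lemma growth_le_add {lo hi x : ℝ} (h1 : lo ≤ x) (h2 : x ≤ hi) (S T : Finset ℕ) :
    growth x x S T ≤ growth lo lo S T + growth hi hi S T := by
  rcases le_or_gt (deg T : ℝ) (deg S : ℝ) with h | h
  · refine le_trans ?_ le_add_self
    unfold growth
    apply ENNReal.ofReal_le_ofReal
    apply Real.exp_le_exp.mpr
    nlinarith
  · refine le_trans ?_ le_self_add
    unfold growth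
    apply ENNReal.ofReal_le_ofReal
    apply Real.exp_le_exp.mpr
    nlinarith

lemma IsSubexp.growth_mul {b : Finset ℕ → Finset ℕ → ℝ≥0∞} (hb : IsSubexp b) {x α β : ℝ}
    (h1 : β < x) (h2 : x < α) : IsBddKernel α β fun S T => growth x x S T * b S T := by
  have hε : 0 < min (α - x) (x - β) := lt_min (by linarith) (by linarith)
  refine ((hb _ hε).growth_mul x x).weaken ?_ ?_
  · have := min_le_left (α - x) (x - β); linarith
  · have := min_le_right (α - x) (x - β); linarith

lemma isBddKernel_twist {b : Finset ℕ → Finset ℕ → ℝ≥0∞} (hb : IsSubexp b) {z : ℂ} {α β : ℝ}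
    (h1 : β < z.re / 2) (h2 : z.re / 2 < α) :
    IsBddKernel α β fun S T => ‖Complex.exp (((deg S : ℂ) - deg T) / 2 * z)‖ₑ * b S T := by
  simp only [enorm_twistFactor]
  exact hb.growth_mul h1 h2

lemma IsSubexpKernel.twist {K : Kernel} (hK : IsSubexpKernel K) {z : ℂ} {α β : ℝ}
    (h1 : β < z.re / 2) (h2 : z.re / 2 < α) : IsBddKernel α β fun S T => ‖twist z K S T‖ₑ := by
  simp only [FreeFermion.twist, enorm_mul]
  exact isBddKernel_twist hK h1 h2

lemma isBddKernel_kernelMul {A B : Kernel} {α β α' β' : ℝ}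
    (hA : IsBddKernel α β fun S T => ‖A S T‖ₑ) (hB : IsBddKernel α' β' fun S T => ‖B S T‖ₑ)
    (h : α' < β) : IsBddKernel α β' fun S T => ‖kernelMul A B S T‖ₑ :=
  (hA.comp hB h).mono fun S U => enorm_tsum_le_tsum_enorm.trans (by simp only [enorm_mul, le_refl])

/-- Provides the two exponents used when the leftmost operator is split off: `γ` as row exponent of
the remaining product, `γ'` as column exponent of the first factor. -/
lemma exists_gap {ι : Type*} [Fintype ι] (f : ι → ℝ) {β x : ℝ} (hf : ∀ i, f i < x) (hβ : β < x) :
    ∃ γ γ' : ℝ, (∀ i, f i < γ) ∧ β < γ ∧ γ < γ' ∧ γ' < x := by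
  classical
  obtain ⟨γ, h1, h2⟩ := Order.exists_between_finsets (insert β (Finset.univ.image f)) {x}
    (by simpa using ⟨hβ, hf⟩)
  obtain ⟨γ', h3, h4⟩ := exists_between (h2 x (by simp))
  exact ⟨γ, γ', fun i => h1 _ (by simp), h1 _ (by simp), h3, h4⟩

/-- The order of insertion points in which products of vertex operators converge. -/
abbrev IsOrdered (L : List (Kernel × ℂ)) : Prop := L.Pairwise fun x y => y.2.re < x.2.re

lemma isBddKernel_prodKernel (L : List (Kernel × ℂ)) (hK : ∀ x ∈ L, IsSubexpKernel x.1)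
    (hL : IsOrdered L) {α β : ℝ} (hαβ : β < α) (hα : ∀ x ∈ L, x.2.re / 2 < α)
    (hβ : ∀ x ∈ L, β < x.2.re / 2) : IsBddKernel α β fun S T => ‖prodKernel L S T‖ₑ := by
  induction L generalizing α with
  | nil => exact isBddKernel_idKernel hαβ.le
  | cons x L ih =>
    obtain ⟨h1, h2⟩ := List.pairwise_cons.mp hL
    obtain ⟨γ, γ', h3, h4, h5, h6⟩ := exists_gap (fun i : Fin L.length => (L.get i).2.re / 2)
      (β := β) (x := x.2.re / 2) (fun i => by have := h1 _ (L.get_mem i); linarith)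
      (hβ x (by simp))
    have h7 : ∀ y ∈ L, y.2.re / 2 < γ := fun y hy => by
      obtain ⟨i, rfl⟩ := List.get_of_mem hy; exact h3 i
    exact isBddKernel_kernelMul ((hK x (by simp)).twist h6 (hα x (by simp)))
      (ih (fun y hy => hK y (by simp [hy])) h2 h4 h7 fun y hy => hβ y (by simp [hy])) h5

/-- Fubini for the triple sum over the intermediate basis vector and the modes of the two factors.
-/
lemma hasSum_kernel_mul {ι κ X : Type*} (a : ι → X → ℂ) (b : κ → X → ℂ)
    (ha : ∀ T, ∑' i, ‖a i T‖ₑ ≠ ∞) (hb : ∀ T, ∑' k, ‖b k T‖ₑ ≠ ∞)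
    (h : ∑' T, (∑' i, ‖a i T‖ₑ) * (∑' k, ‖b k T‖ₑ) ≠ ∞) :
    HasSum (fun p : ι × κ => ∑' T, a p.1 T * b p.2 T) (∑' T, (∑' i, a i T) * (∑' k, b k T)) := by
  have e : ∀ T, ∑' p : ι × κ, ‖a p.1 T * b p.2 T‖ₑ = (∑' i, ‖a i T‖ₑ) * (∑' k, ‖b k T‖ₑ) := by
    intro T
    simp only [enorm_mul]
    rw [ENNReal.tsum_prod (f := fun i k => ‖a i T‖ₑ * ‖b k T‖ₑ)]
    simp only [ENNReal.tsum_mul_left, ENNReal.tsum_mul_right]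
  have hs : Summable fun q : X × (ι × κ) => a q.2.1 q.1 * b q.2.2 q.1 := by
    apply Summable.of_enorm
    rw [ENNReal.tsum_prod (f := fun T (p : ι × κ) => ‖a p.1 T * b p.2 T‖ₑ)]
    simpa only [e] using h
  have h1 : ∀ T, (∑' i, a i T) * (∑' k, b k T) = ∑' p : ι × κ, a p.1 T * b p.2 T := fun T =>
    tsum_mul_tsum_of_summable_norm (tsum_enorm_ne_top_iff_summable_norm.mp (ha T))
      (tsum_enorm_ne_top_iff_summable_norm.mp (hb T))
  simp only [h1]
  rw [← hs.tsum_prod, ← (Equiv.prodComm _ _).tsum_eq]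
  have hs' := (Equiv.prodComm (ι × κ) X).summable_iff.mpr hs
  exact hs'.hasSum.prod_fiberwise fun p => (hs'.prod_factor p).hasSum

lemma mul_fockBasis_apply (A B : Module.End ℂ Fock) (S U : Finset ℕ) :
    (A * B) (fockBasis U) S = ∑' T, A (fockBasis T) S * B (fockBasis U) T := by
  rw [Module.End.mul_apply, linearMap_apply_eq_sum A, Finsupp.sum, Finsupp.finsetSum_apply,
    tsum_eq_sum (s := (B (fockBasis U)).support)]
  · exact Finset.sum_congr rfl fun T _ => by rw [Finsupp.smul_apply, smul_eq_mul, mul_comm]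
  · intro T hT
    rw [Finsupp.notMem_support_iff.mp hT, mul_zero]

/-- The product of the vertex operator summands with the modes `p`. -/
noncomputable def vertexProd {n : ℕ} (v : Fin n → Fock) (z : Fin n → ℂ) (p : Fin n → ℤ) :
    Module.End ℂ Fock := (List.ofFn fun i => vertexTerm (v i) (z i) (p i)).prod

lemma vertexProd_succ {n : ℕ} (v : Fin (n + 1) → Fock) (z : Fin (n + 1) → ℂ)
    (p : Fin (n + 1) → ℤ) : vertexProd v z p = vertexTerm (v 0) (z 0) (p 0) *
      vertexProd (fun i => v i.succ) (fun i => z i.succ) (fun i => p i.succ) := by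
  simp [vertexProd, List.ofFn_succ]

/-- The majorant does not depend on `z` within the box, which is what locally uniform convergence
requires. It is built one operator at a time from the left, and the disjointness of the ordered
intervals leaves room for the exponents of `exists_gap`. -/
lemma exists_majorant {n : ℕ} (v : Fin n → Fock) (lo hi : Fin n → ℝ)
    (hord : ∀ i j, i < j → hi j < lo i) {α β : ℝ} (hαβ : β < α)
    (hα : ∀ i, lo i / 2 < α ∧ hi i / 2 < α) (hβ : ∀ i, β < lo i / 2 ∧ β < hi i / 2)
    (hlh : ∀ i, lo i ≤ hi i) :
    ∃ B : (Fin n → ℤ) → Finset ℕ → Finset ℕ → ℝ≥0∞,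
      (∀ p z S T, (∀ i, lo i ≤ (z i).re ∧ (z i).re ≤ hi i) →
        ‖vertexProd v z p (fockBasis T) S‖ₑ ≤ B p S T) ∧
      IsBddKernel α β fun S T => ∑' p, B p S T := by
  induction n generalizing α with
  | zero =>
    refine ⟨fun _ S T => ‖idKernel S T‖ₑ, fun p z S T _ => ?_, ?_⟩
    · simp [vertexProd, fockBasis_apply, idKernel, eq_comm]
    · simpa using isBddKernel_idKernel hαβ.le
  | succ n ih =>
    obtain ⟨γ, γ', h3, h4, h5, h6⟩ := exists_gap (fun i : Fin n => hi i.succ / 2)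
      (β := β) (x := lo 0 / 2) (fun i => by have := hord 0 i.succ (Fin.succ_pos i); linarith)
      (hβ 0).1
    obtain ⟨B, hB1, hB2⟩ := ih (fun i => v i.succ) (fun i => lo i.succ) (fun i => hi i.succ)
      (fun i j hij => hord _ _ (Fin.succ_lt_succ_iff.mpr hij)) h4
      (fun i => ⟨by have := hlh i.succ; have := h3 i; linarith, h3 i⟩) (fun i => hβ i.succ)
      (fun i => hlh i.succ)
    let b : ℤ → Finset ℕ → Finset ℕ → ℝ≥0∞ := fun m S T =>
      (growth (lo 0 / 2) (lo 0 / 2) S T + growth (hi 0 / 2) (hi 0 / 2) S T) *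
        ‖modeEntry (v 0) m S T‖ₑ
    have hb : IsBddKernel α γ' fun S T => ∑' m, b m S T := by
      have h := isSubexp_modeEntry (v 0)
      refine ((h.growth_mul h6 (hα 0).1).add (h.growth_mul (x := hi 0 / 2) ?_ (hα 0).2)).mono
        fun S T => ?_
      · have := hlh 0; linarith
      · simp only [b]
        rw [ENNReal.tsum_mul_left, add_mul]
    refine ⟨fun p S U => ∑' T, b (p 0) S T * B (fun i => p i.succ) T U,
      fun p z S U hz => ?_, (hb.comp hB2 h5).mono fun S U => le_of_eq ?_⟩
    · rw [vertexProd_succ, mul_fockBasis_apply]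
      refine enorm_tsum_le_tsum_enorm.trans (ENNReal.tsum_le_tsum fun T => ?_)
      rw [enorm_mul]
      refine mul_le_mul' ?_ (hB1 _ _ _ _ fun i => hz i.succ)
      rw [vertexTerm_apply, enorm_mul, enorm_twistFactor]
      have := hz 0
      exact mul_le_mul_left (growth_le_add (by linarith) (by linarith) S T) _
    · rw [← (Fin.consEquiv fun _ => ℤ).tsum_eq]
      simp only [Fin.consEquiv_apply, Fin.cons_zero, Fin.cons_succ]
      rw [ENNReal.tsum_comm]
      refine tsum_congr fun T => ?_
      rw [ENNReal.tsum_prod (f := fun m p => b m S T * B p T U)]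
      simp only [ENNReal.tsum_mul_left, ENNReal.tsum_mul_right]

/-- The list of matrices and insertion points of an `n`-point function. -/
noncomputable def kernelList {n : ℕ} (v : Fin n → Fock) (z : Fin n → ℂ) : List (Kernel × ℂ) :=
  List.ofFn fun i => (vertexKernel (v i), z i)

lemma exists_bounds {n : ℕ} (f : Fin n → ℝ) : ∃ β α : ℝ, β < α ∧ ∀ i, β < f i ∧ f i < α := by
  refine ⟨-(∑ i, |f i|) - 1, ∑ i, |f i| + 1, ?_, fun i => ?_⟩
  · have : 0 ≤ ∑ i, |f i| := Finset.sum_nonneg fun i _ => abs_nonneg _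
    linarith
  · have h1 := Finset.single_le_sum (fun i _ => abs_nonneg (f i)) (Finset.mem_univ i)
    have h2 := abs_le.mp h1
    constructor <;> linarith [h2.1, h2.2]

lemma hasSum_vertexProd {n : ℕ} (v : Fin n → Fock) (z : Fin n → ℂ)
    (hord : ∀ i j, i < j → (z j).re < (z i).re) (S U : Finset ℕ) :
    HasSum (fun p => vertexProd v z p (fockBasis U) S) (prodKernel (kernelList v z) S U) := by
  induction n generalizing S with
  | zero =>
    have : prodKernel (kernelList v z) S U = vertexProd v z default (fockBasis U) S := by
      simp [kernelList, vertexProd, prodKernel, idKernel, fockBasis_apply, eq_comm]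
    rw [this]
    exact hasSum_unique fun p : Fin 0 → ℤ => vertexProd v z p (fockBasis U) S
  | succ n ih =>
    obtain ⟨β, α, -, hαβ⟩ := exists_bounds fun i => (z i).re / 2
    have hβ : ∀ i, β < (z i).re / 2 := fun i => (hαβ i).1
    have hα : ∀ i, (z i).re / 2 < α := fun i => (hαβ i).2
    have hord' : ∀ i j : Fin n, i < j → (z j.succ).re < (z i.succ).re := fun i j hij =>
      hord i.succ j.succ (Fin.succ_lt_succ_iff.mpr hij)
    obtain ⟨γ, γ', h3, h4, h5, h6⟩ := exists_gap (fun i : Fin n => (z i.succ).re / 2)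
      (β := β) (x := (z 0).re / 2) (fun i => by have := hord 0 i.succ (Fin.succ_pos i); linarith)
      (hβ 0)
    -- At a single point the box degenerates: lower and upper bounds are both the real part.
    obtain ⟨B, hB1, hB2⟩ := exists_majorant (n := n) (α := γ) (β := β) (fun i => v i.succ)
      (fun i => (z i.succ).re) (fun i => (z i.succ).re) hord' h4
      (fun i => ⟨h3 i, h3 i⟩) (fun i => ⟨hβ i.succ, hβ i.succ⟩) (fun i => le_refl _)
    have hB3 : IsBddKernel γ β fun S T => ∑' p, ‖vertexProd (fun i => v i.succ)
        (fun i => z i.succ) p (fockBasis T) S‖ₑ :=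
      hB2.mono fun S T => ENNReal.tsum_le_tsum fun p =>
        hB1 p (fun i => z i.succ) S T fun i => ⟨le_rfl, le_rfl⟩
    have hb : IsBddKernel α γ' fun S T => ∑' m, ‖vertexTerm (v 0) (z 0) m (fockBasis T) S‖ₑ := by
      refine (isBddKernel_twist (isSubexp_modeEntry (v 0)) h6 (hα 0)).mono fun S T => ?_
      simp only [vertexTerm_apply, enorm_mul, ENNReal.tsum_mul_left, le_refl]
    have key := hasSum_kernel_mul (fun m T => vertexTerm (v 0) (z 0) m (fockBasis T) S)
      (fun p T => vertexProd (fun i => v i.succ) (fun i => z i.succ) p (fockBasis U) T)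
      (fun T => hb.ne_top S T) (fun T => hB3.ne_top T U) ((hb.comp hB3 h5).ne_top S U)
    rw [← (Fin.consEquiv fun _ => ℤ).hasSum_iff]
    convert key using 1
    · funext p
      simp only [Function.comp, vertexProd_succ, mul_fockBasis_apply, Fin.consEquiv_apply,
        Fin.cons_zero, Fin.cons_succ]
    · rw [kernelList, List.ofFn_succ, prodKernel, kernelMul]
      refine tsum_congr fun T => ?_
      rw [(ih (fun i => v i.succ) (fun i => z i.succ) hord' T).tsum_eq]
      congr 1
      simp only [vertexTerm_apply, tsum_mul_left, (hasSum_modeEntry (v 0) S T).tsum_eq, twist]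

/-! ### Torus functions as traces -/

/-- The entry of `σ g q^{L(0) - c/24}` at a Fock basis vector. -/
noncomputable def traceWeight (θ : ℂ) (τ : UpperHalfPlane) (T : Finset ℕ) : ℂ :=
  Complex.exp (2 * Real.pi * Complex.I * τ * (-1 / 48)) * ∏ j ∈ T, (-θ * qPow τ ((j : ℂ) + 1 / 2))

/-- The trace against `σ g q^{L(0) - c/24}`. -/
noncomputable def torusTrace (θ : ℂ) (τ : UpperHalfPlane) (K : Kernel) : ℂ :=
  ∑' T, traceWeight θ τ T * K T T

lemma parity_apply (v : Fock) (S : Finset ℕ) : parity v S = (-1) ^ S.card * v S := by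
  induction v using fock_induction with
  | h0 => simp
  | hadd v w hv hw => rw [map_add, Finsupp.add_apply, hv, hw, Finsupp.add_apply, mul_add]
  | hs c v hv =>
    rw [map_smul, Finsupp.smul_apply, hv, Finsupp.smul_apply, smul_eq_mul, smul_eq_mul]; ring
  | hb R =>
    rw [parity, linearCombination_fockBasis, Finsupp.smul_apply, fockBasis_apply]
    split_ifs with h
    · subst h; rfl
    · simp

lemma traceWeight_one (τ : UpperHalfPlane) (T : Finset ℕ) : traceWeight 1 τ T =
    (-1) ^ T.card * Complex.exp (2 * Real.pi * Complex.I * τ * (weight T - 1 / 48)) := by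
  unfold traceWeight
  simp only [neg_one_mul]
  rw [Finset.prod_neg]
  simp only [qPow]
  rw [← Complex.exp_sum, weight, mul_left_comm, ← Complex.exp_add, ← Finset.mul_sum]
  congr 2; ring

lemma traceWeight_neg (θ : ℂ) (τ : UpperHalfPlane) (T : Finset ℕ) :
    traceWeight (-θ) τ T = (-1) ^ T.card * traceWeight θ τ T := by
  unfold traceWeight
  rw [mul_left_comm, ← Finset.prod_neg]
  congr 1
  exact Finset.prod_congr rfl fun j _ => by ring

/-- For `g = 1` the parity of the supertrace supplies the signs in `traceWeight 1`; for `g = σ` the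
two parities cancel, in agreement with `-θ = 1`. -/
lemma supertraceTerm_eq {g : Module.End ℂ Fock} {θ : ℂ}
    (hg : (g = 1 ∧ θ = 1) ∨ (g = parity ∧ θ = -1)) (τ : UpperHalfPlane) (A : Module.End ℂ Fock)
    (T : Finset ℕ) : supertraceTerm (g * A * qL0 τ) T =
      traceWeight θ τ T * A (fockBasis T) T := by
  rw [supertraceTerm, Module.End.mul_apply, Module.End.mul_apply, parity_apply, qL0,
    linearCombination_fockBasis, map_smul, Finsupp.smul_apply, smul_eq_mul]
  rcases hg with ⟨rfl, rfl⟩ | ⟨rfl, rfl⟩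
  · rw [traceWeight_one, one_mul]; ring
  · rw [traceWeight_neg, traceWeight_one, Module.End.mul_apply, parity_apply]; ring

lemma nPointTerm_eq {g : Module.End ℂ Fock} {θ : ℂ}
    (hg : (g = 1 ∧ θ = 1) ∨ (g = parity ∧ θ = -1)) (τ : UpperHalfPlane) {n : ℕ} (v : Fin n → Fock)
    (p : Finset ℕ × (Fin n → ℤ)) (z : Fin n → ℂ) : nPointTerm g v τ p z =
      traceWeight θ τ p.1 * vertexProd v z p.2 (fockBasis p.1) p.1 :=
  supertraceTerm_eq hg τ _ _

lemma partitionFunction_eq {g : Module.End ℂ Fock} {θ : ℂ}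
    (hg : (g = 1 ∧ θ = 1) ∨ (g = parity ∧ θ = -1)) (τ : UpperHalfPlane) :
    partitionFunction g τ = torusTrace θ τ idKernel := by
  refine tsum_congr fun T => ?_
  have := supertraceTerm_eq hg τ 1 T
  rw [mul_one] at this
  rw [this]
  simp [fockBasis_apply, idKernel]

lemma norm_qPow (τ : UpperHalfPlane) (x : ℝ) :
    ‖qPow τ x‖ = Real.exp (-(2 * Real.pi * τ.im * x)) := by
  rw [qPow, Complex.norm_exp]
  congr 1
  simp

lemma enorm_traceWeight {θ : ℂ} (hθ : ‖θ‖ = 1) (τ : UpperHalfPlane) (T : Finset ℕ) :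
    ‖traceWeight θ τ T‖ₑ = ‖Complex.exp (2 * Real.pi * Complex.I * τ * (-1 / 48))‖ₑ *
      ENNReal.ofReal (Real.exp (-(Real.pi * τ.im) * deg T)) := by
  rw [traceWeight, enorm_mul]
  congr 1
  rw [← ofReal_norm, norm_prod]
  congr 1
  have : ∀ j ∈ T, ‖-θ * qPow τ ((j : ℂ) + 1 / 2)‖ =
      Real.exp (-(Real.pi * τ.im) * ((2 * j + 1 : ℕ) : ℝ)) := by
    intro j _
    rw [norm_mul, norm_neg, hθ, one_mul,
      show (j : ℂ) + 1 / 2 = (((j : ℝ) + 1 / 2 : ℝ) : ℂ) by push_cast; ring, norm_qPow]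
    congr 1; push_cast; ring
  rw [Finset.prod_congr rfl this, ← Real.exp_sum, ← Finset.mul_sum, deg]
  push_cast
  rfl

/-- Since `deg` is twice the weight, `|q^{wt T}| = e^{-π Im τ deg T}`; hence the condition is `α < β
+ π Im τ`, the half of `2π Im τ` corresponding to exponents that are half real parts. -/
lemma tsum_traceWeight_ne_top {θ : ℂ} (hθ : ‖θ‖ = 1) (τ : UpperHalfPlane) {α β : ℝ}
    {b : Finset ℕ → Finset ℕ → ℝ≥0∞} (hb : IsBddKernel α β b) (h : α < β + Real.pi * τ.im) :
    ∑' T, ‖traceWeight θ τ T‖ₑ * b T T ≠ ∞ := by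
  simp only [enorm_traceWeight hθ, mul_assoc]
  rw [ENNReal.tsum_mul_left]
  exact ENNReal.mul_ne_top (by simp) (hb.trace h)

lemma mem_orderedDomain_iff {n : ℕ} {τ : UpperHalfPlane} {z : Fin n → ℂ} :
    z ∈ orderedDomain n τ ↔ ∀ i j, i < j → (z j).re < (z i).re ∧
      (z i).re - (z j).re < 2 * (Real.pi * τ.im) := by
  have h1 := norm_qPow τ 1
  rw [Complex.ofReal_one] at h1
  unfold orderedDomain
  simp only [Set.mem_ofPred_eq, h1, Complex.norm_exp, Complex.sub_re, Real.exp_lt_exp,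
    Real.exp_lt_one_iff]
  refine forall_congr' fun i => forall_congr' fun j => imp_congr_right fun _ => ?_
  constructor <;> rintro ⟨h2, h3⟩ <;> constructor <;> linarith

lemma norm_theta {g : Module.End ℂ Fock} {θ : ℂ}
    (hg : (g = 1 ∧ θ = 1) ∨ (g = parity ∧ θ = -1)) : ‖θ‖ = 1 := by
  rcases hg with ⟨-, rfl⟩ | ⟨-, rfl⟩ <;> simp

/-- Near every point of the ordered domain the series is dominated by a convergent series. -/
lemma exists_local_majorant {g : Module.End ℂ Fock} {θ : ℂ}
    (hg : (g = 1 ∧ θ = 1) ∨ (g = parity ∧ θ = -1)) {τ : UpperHalfPlane} {n : ℕ} (v : Fin n → Fock)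
    {z₀ : Fin n → ℂ} (hz₀ : z₀ ∈ orderedDomain n τ) :
    ∃ u : Finset ℕ × (Fin n → ℤ) → ℝ, Summable u ∧
      ∀ᶠ z in 𝓝 z₀, ∀ p, ‖nPointTerm g v τ p z‖ ≤ u p := by
  rw [mem_orderedDomain_iff] at hz₀
  set δ := Real.pi * τ.im with hδ
  have hδ0 : 0 < δ := mul_pos Real.pi_pos τ.im_pos
  have hall : ∀ i j, (z₀ i).re - (z₀ j).re < 2 * δ := by
    intro i j
    rcases lt_trichotomy i j with h | h | h
    · exact (hz₀ i j h).2
    · subst h; simpa using hδ0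
    · have := (hz₀ j i h).1; linarith
  -- The radius is below half of every slack in the strict inequalities of the domain, so the boxes
  -- of radius `ε` around the real parts stay ordered and their spread stays below `2δ`.
  obtain ⟨ε, hε0, hε⟩ := Order.exists_between_finsets {(0 : ℝ)}
    (Finset.univ.image (fun x : Fin n × Fin n => (2 * δ - ((z₀ x.1).re - (z₀ x.2).re)) / 2) ∪
      (Finset.univ.filter fun x : Fin n × Fin n => x.1 < x.2).image
        (fun x : Fin n × Fin n => ((z₀ x.1).re - (z₀ x.2).re) / 2)) (by
      intro a ha b hb
      simp only [Finset.mem_singleton] at ha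
      subst ha
      simp only [Finset.mem_union, Finset.mem_image, Finset.mem_univ, true_and,
        Finset.mem_filter] at hb
      rcases hb with ⟨x, rfl⟩ | ⟨x, hx, rfl⟩
      · have := hall x.1 x.2; linarith
      · have := (hz₀ _ _ hx).1; linarith)
  have hε0 : 0 < ε := hε0 0 (by simp)
  have hε1 : ∀ i j, (z₀ i).re + ε - ((z₀ j).re - ε) < 2 * δ := by
    intro i j
    have := hε ((2 * δ - ((z₀ i).re - (z₀ j).re)) / 2) (by
      rw [Finset.mem_union]; left; exact Finset.mem_image.mpr ⟨(i, j), by simp, rfl⟩)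
    linarith
  have hε2 : ∀ i j, i < j → (z₀ j).re + ε < (z₀ i).re - ε := by
    intro i j hij
    have := hε (((z₀ i).re - (z₀ j).re) / 2) (by
      rw [Finset.mem_union]; right; exact Finset.mem_image.mpr ⟨(i, j), by simp [hij], rfl⟩)
    linarith
  -- The exponents must enclose all half real parts in the boxes and satisfy `α < β + δ`. So `α` is
  -- kept below every lower end shifted by `δ`, and `β` is then chosen above `α - δ`.
  obtain ⟨α, hα1, hα2⟩ := Order.exists_between_finsets
    (Finset.univ.image fun i => ((z₀ i).re + ε) / 2)
    (Finset.univ.image fun i => ((z₀ i).re - ε) / 2 + δ) (by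
      intro a ha b hb
      simp only [Finset.mem_image, Finset.mem_univ, true_and] at ha hb
      obtain ⟨i, rfl⟩ := ha
      obtain ⟨j, rfl⟩ := hb
      have := hε1 i j; linarith)
  obtain ⟨β, hβ1, hβ2⟩ := Order.exists_between_finsets {α - δ}
    (insert α (Finset.univ.image fun i => ((z₀ i).re - ε) / 2)) (by
      intro a ha b hb
      simp only [Finset.mem_singleton] at ha
      subst ha
      simp only [Finset.mem_insert, Finset.mem_image, Finset.mem_univ, true_and] at hb
      rcases hb with rfl | ⟨i, rfl⟩
      · linarith
      · have := hα2 (((z₀ i).re - ε) / 2 + δ) (by simp); linarith)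
  have hα1 : ∀ i, ((z₀ i).re + ε) / 2 < α := fun i => hα1 _ (by simp)
  have hβ2' : ∀ i, β < ((z₀ i).re - ε) / 2 := fun i => hβ2 _ (by simp)
  obtain ⟨B, hB1, hB2⟩ := exists_majorant v (fun i => (z₀ i).re - ε) (fun i => (z₀ i).re + ε) hε2
    (hβ2 α (by simp)) (fun i => ⟨by have := hα1 i; linarith, hα1 i⟩)
    (fun i => ⟨hβ2' i, by have := hβ2' i; linarith⟩) (fun i => by linarith)
  have hfin : ∑' p : Finset ℕ × (Fin n → ℤ), ‖traceWeight θ τ p.1‖ₑ * B p.2 p.1 p.1 ≠ ∞ := by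
    rw [ENNReal.tsum_prod (f := fun T p => ‖traceWeight θ τ T‖ₑ * B p T T)]
    simp only [ENNReal.tsum_mul_left]
    exact tsum_traceWeight_ne_top (norm_theta hg) τ hB2 (by have := hβ1 (α - δ) (by simp); linarith)
  refine ⟨_, ENNReal.summable_toReal hfin, ?_⟩
  have hnhds : ∀ᶠ z in 𝓝 z₀, ∀ i, (z₀ i).re - ε ≤ (z i).re ∧ (z i).re ≤ (z₀ i).re + ε := by
    rw [Filter.eventually_all]
    intro i
    have hc : Continuous fun z : Fin n → ℂ => (z i).re := by fun_prop
    have := hc.continuousAt.eventually (Icc_mem_nhds (show (z₀ i).re - ε < (z₀ i).re by linarith)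
      (show (z₀ i).re < (z₀ i).re + ε by linarith))
    exact this
  filter_upwards [hnhds] with z hz p
  rw [← toReal_enorm]
  refine ENNReal.toReal_mono (ENNReal.ne_top_of_tsum_ne_top hfin p) ?_
  rw [nPointTerm_eq hg, enorm_mul]
  exact mul_le_mul_right (hB1 _ _ _ _ hz) _

lemma summable_norm_nPointTerm {g : Module.End ℂ Fock} {θ : ℂ}
    (hg : (g = 1 ∧ θ = 1) ∨ (g = parity ∧ θ = -1)) {τ : UpperHalfPlane} {n : ℕ} (v : Fin n → Fock)
    {z : Fin n → ℂ} (hz : z ∈ orderedDomain n τ) :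
    Summable fun p => ‖nPointTerm g v τ p z‖ := by
  obtain ⟨u, hu, h⟩ := exists_local_majorant hg v hz
  exact Summable.of_nonneg_of_le (fun _ => norm_nonneg _) h.self_of_nhds hu

lemma hasSumUniformlyOn_nPointTerm {g : Module.End ℂ Fock} {θ : ℂ}
    (hg : (g = 1 ∧ θ = 1) ∨ (g = parity ∧ θ = -1)) {τ : UpperHalfPlane} {n : ℕ} (v : Fin n → Fock)
    {K : Set (Fin n → ℂ)} (hK : K ⊆ orderedDomain n τ) (hc : IsCompact K) :
    HasSumUniformlyOn (nPointTerm g v τ) (nPoint g v τ) K := by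
  rw [hasSumUniformlyOn_iff_tendstoUniformlyOn,
    ← tendstoLocallyUniformlyOn_iff_tendstoUniformlyOn_of_compact hc,
    ← hasSumLocallyUniformlyOn_iff_tendstoLocallyUniformlyOn]
  refine hasSumLocallyUniformlyOn_of_of_forall_exists_nhds fun z hz => ?_
  obtain ⟨u, hu, h⟩ := exists_local_majorant hg v (hK hz)
  exact ⟨_, mem_nhdsWithin_of_mem_nhds h, HasSumUniformlyOn.of_norm_le_summable hu
    fun p z hz => hz p⟩

/-- Absolute convergence allows summing over the modes before the diagonal entries, which replaces
mode products by products of complete vertex operators. -/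
lemma nPoint_eq_torusTrace {g : Module.End ℂ Fock} {θ : ℂ}
    (hg : (g = 1 ∧ θ = 1) ∨ (g = parity ∧ θ = -1)) {τ : UpperHalfPlane} {n : ℕ} (v : Fin n → Fock)
    {z : Fin n → ℂ} (hz : z ∈ orderedDomain n τ) :
    nPoint g v τ z = torusTrace θ τ (prodKernel (kernelList v z)) := by
  have hs := (summable_norm_nPointTerm hg v hz).of_norm
  rw [nPoint, hs.tsum_prod]
  refine tsum_congr fun T => ?_
  simp only [nPointTerm_eq hg]
  rw [tsum_mul_left, (hasSum_vertexProd v z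
    (fun i j hij => (mem_orderedDomain_iff.mp hz i j hij).1) T T).tsum_eq]

end FreeFermion

namespace FreeFermion

open scoped Topology

/-! ### Twisted Weierstrass functions and Eisenstein series -/

/-- `θ q^{j+1/2} / (1 - θ q^{j+1/2})`. -/
noncomputable def lambertCoeff (θ : ℂ) (τ : UpperHalfPlane) (j : ℕ) : ℂ :=
  θ * qPow τ ((j : ℂ) + 1 / 2) / (1 - θ * qPow τ ((j : ℂ) + 1 / 2))

/-- `1 / (1 - θ q^{m+1/2})`. -/
noncomputable def modeCoeff (θ : ℂ) (τ : UpperHalfPlane) (m : ℤ) : ℂ :=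
  (1 - θ * qPow τ ((m : ℂ) + 1 / 2))⁻¹

lemma norm_qPow_half (τ : UpperHalfPlane) (j : ℕ) :
    ‖qPow τ ((j : ℂ) + 1 / 2)‖ = Real.exp (-(2 * Real.pi * τ.im * ((j : ℝ) + 1 / 2))) := by
  rw [← norm_qPow]; congr 2; push_cast; ring

lemma two_pi_im_pos (τ : UpperHalfPlane) : 0 < 2 * Real.pi * τ.im :=
  mul_pos Real.two_pi_pos τ.im_pos

lemma norm_theta_eq {θ : ℂ} (hθ : θ = 1 ∨ θ = -1) : ‖θ‖ = 1 := by
  rcases hθ with rfl | rfl <;> simp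

lemma theta_mul_self {θ : ℂ} (hθ : θ = 1 ∨ θ = -1) : θ * θ = 1 := by
  rcases hθ with rfl | rfl <;> simp

lemma norm_one_sub_ge {θ : ℂ} (hθ : θ = 1 ∨ θ = -1) (τ : UpperHalfPlane) (j : ℕ) :
    1 - Real.exp (-(2 * Real.pi * τ.im * (1 / 2))) ≤ ‖1 - θ * qPow τ ((j : ℂ) + 1 / 2)‖ := by
  have h1 : ‖θ * qPow τ ((j : ℂ) + 1 / 2)‖ ≤ Real.exp (-(2 * Real.pi * τ.im * (1 / 2))) := by
    rw [norm_mul, norm_theta_eq hθ, one_mul, norm_qPow_half]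
    apply Real.exp_le_exp.mpr
    have := two_pi_im_pos τ
    have hj : (0 : ℝ) ≤ j := Nat.cast_nonneg j
    nlinarith
  have h2 := norm_sub_norm_le (1 : ℂ) (θ * qPow τ ((j : ℂ) + 1 / 2))
  rw [norm_one] at h2
  linarith

lemma one_sub_exp_pos (τ : UpperHalfPlane) :
    0 < 1 - Real.exp (-(2 * Real.pi * τ.im * (1 / 2))) := by
  have := two_pi_im_pos τ
  rw [sub_pos, Real.exp_lt_one_iff]
  linarith

lemma one_sub_theta_qPow_ne_zero {θ : ℂ} (hθ : θ = 1 ∨ θ = -1) (τ : UpperHalfPlane) (j : ℕ) :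
    1 - θ * qPow τ ((j : ℂ) + 1 / 2) ≠ 0 :=
  norm_pos_iff.mp ((one_sub_exp_pos τ).trans_le (norm_one_sub_ge hθ τ j))

lemma qPow_ne_zero (τ : UpperHalfPlane) (x : ℂ) : qPow τ x ≠ 0 := Complex.exp_ne_zero _

lemma qPow_neg (τ : UpperHalfPlane) (x : ℂ) : qPow τ (-x) = (qPow τ x)⁻¹ := by
  rw [qPow, qPow, ← Complex.exp_neg]; congr 1; ring

lemma modeCoeff_natCast {θ : ℂ} (hθ : θ = 1 ∨ θ = -1) (τ : UpperHalfPlane) (j : ℕ) :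
    modeCoeff θ τ j = 1 + lambertCoeff θ τ j := by
  have h := one_sub_theta_qPow_ne_zero hθ τ j
  rw [modeCoeff, lambertCoeff, Int.cast_natCast, one_add_div h, sub_add_cancel]
  exact (one_div _).symm

lemma neg_mode_cast (j : ℕ) : ((-(j : ℤ) - 1 : ℤ) : ℂ) + 1 / 2 = -((j : ℂ) + 1 / 2) := by
  push_cast; ring

lemma modeDenom_neg {θ : ℂ} (hθ : θ = 1 ∨ θ = -1) (τ : UpperHalfPlane) (j : ℕ) :
    1 - θ * qPow τ ((-(j : ℤ) - 1 : ℤ) + 1 / 2) =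
      -θ * (1 - θ * qPow τ ((j : ℂ) + 1 / 2)) / qPow τ ((j : ℂ) + 1 / 2) := by
  have h2 := qPow_ne_zero τ ((j : ℂ) + 1 / 2)
  rw [neg_mode_cast, qPow_neg]
  generalize qPow τ ((j : ℂ) + 1 / 2) = Q at h2 ⊢
  rw [eq_div_iff h2, sub_mul, mul_assoc, inv_mul_cancel₀ h2]
  linear_combination -Q * theta_mul_self hθ

/-- Together with `modeCoeff_natCast` this splits off the part without `q` from the coefficients,
using `θ⁻¹ = θ`. The remaining Lambert coefficients decay exponentially, so their series converges
on the whole strip. -/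
lemma modeCoeff_neg {θ : ℂ} (hθ : θ = 1 ∨ θ = -1) (τ : UpperHalfPlane) (j : ℕ) :
    modeCoeff θ τ (-(j : ℤ) - 1) = -lambertCoeff θ τ j := by
  have h := one_sub_theta_qPow_ne_zero hθ τ j
  have h2 := qPow_ne_zero τ ((j : ℂ) + 1 / 2)
  have h3 : θ ≠ 0 := by rcases hθ with rfl | rfl <;> simp
  rw [modeCoeff, modeDenom_neg hθ, lambertCoeff]
  generalize qPow τ ((j : ℂ) + 1 / 2) = Q at h h2 ⊢
  rw [inv_div, ← neg_div, div_eq_div_iff (mul_ne_zero (neg_ne_zero.mpr h3) h) h]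
  linear_combination -(Q * (1 - θ * Q)) * theta_mul_self hθ

lemma modeDenom_ne_zero {θ : ℂ} (hθ : θ = 1 ∨ θ = -1) (τ : UpperHalfPlane) (m : ℤ) :
    1 - θ * qPow τ ((m : ℂ) + 1 / 2) ≠ 0 := by
  obtain ⟨j, rfl | rfl⟩ := exists_mode m
  · simpa using one_sub_theta_qPow_ne_zero hθ τ j
  · rw [modeDenom_neg hθ]
    have h3 : θ ≠ 0 := by rcases hθ with rfl | rfl <;> simp
    exact div_ne_zero (mul_ne_zero (neg_ne_zero.mpr h3) (one_sub_theta_qPow_ne_zero hθ τ j))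
      (qPow_ne_zero _ _)

lemma norm_lambertCoeff_le {θ : ℂ} (hθ : θ = 1 ∨ θ = -1) (τ : UpperHalfPlane) (j : ℕ) :
    ‖lambertCoeff θ τ j‖ ≤ (1 - Real.exp (-(2 * Real.pi * τ.im * (1 / 2))))⁻¹ *
      Real.exp (-(2 * Real.pi * τ.im * ((j : ℝ) + 1 / 2))) := by
  rw [lambertCoeff, norm_div, norm_mul, norm_theta_eq hθ, one_mul, norm_qPow_half, div_eq_inv_mul]
  gcongr
  · exact one_sub_exp_pos τ
  · exact norm_one_sub_ge hθ τ j

lemma summable_half_pow_mul_exp (p : ℕ) {y : ℝ} (hy : 0 < y) :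
    Summable fun j : ℕ => ((j : ℝ) + 1 / 2) ^ p * Real.exp (-(y * ((j : ℝ) + 1 / 2))) := by
  have h := ((summable_nat_add_iff 1).mpr (Real.summable_pow_mul_exp_neg_nat_mul p hy)).mul_left
    (Real.exp (y / 2))
  refine Summable.of_nonneg_of_le (fun j => by positivity) (fun j => ?_) h
  rw [mul_left_comm, ← Real.exp_add]
  push_cast
  rw [show y / 2 + -y * ((j : ℝ) + 1) = -(y * ((j : ℝ) + 1 / 2)) by ring]
  gcongr
  norm_num

lemma norm_half (j : ℕ) : ‖(j : ℂ) + 1 / 2‖ = (j : ℝ) + 1 / 2 := by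
  rw [show (j : ℂ) + 1 / 2 = (((j : ℝ) + 1 / 2 : ℝ) : ℂ) by push_cast; ring, Complex.norm_real,
    Real.norm_of_nonneg (by positivity)]

lemma norm_exp_half (j : ℕ) (z : ℂ) :
    ‖Complex.exp (((j : ℂ) + 1 / 2) * z)‖ = Real.exp (((j : ℝ) + 1 / 2) * z.re) := by
  rw [Complex.norm_exp,
    show ((j : ℂ) + 1 / 2) * z = (((j : ℝ) + 1 / 2 : ℝ) : ℂ) * z by push_cast; ring,
    Complex.re_ofReal_mul]

lemma summable_half_exp (p : ℕ) {z : ℂ} (hz : z.re < 0) :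
    Summable fun j : ℕ => ‖((j : ℂ) + 1 / 2) ^ p * Complex.exp (((j : ℂ) + 1 / 2) * z)‖ := by
  refine (summable_half_pow_mul_exp p (neg_pos.mpr hz)).congr fun j => ?_
  rw [norm_mul, norm_pow, norm_half, norm_exp_half]
  congr 2; ring

lemma summable_half_exp_lambert {θ : ℂ} (hθ : θ = 1 ∨ θ = -1) (τ : UpperHalfPlane) (p : ℕ) {z : ℂ}
    (hz : z.re < 2 * Real.pi * τ.im) : Summable fun j : ℕ =>
      ‖((j : ℂ) + 1 / 2) ^ p * Complex.exp (((j : ℂ) + 1 / 2) * z) * lambertCoeff θ τ j‖ := by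
  refine Summable.of_nonneg_of_le (fun _ => norm_nonneg _) (fun j => ?_)
    ((summable_half_pow_mul_exp p (sub_pos.mpr hz)).mul_left
      (1 - Real.exp (-(2 * Real.pi * τ.im * (1 / 2))))⁻¹)
  rw [norm_mul, norm_mul, norm_pow, norm_half, norm_exp_half]
  calc _ ≤ ((j : ℝ) + 1 / 2) ^ p * Real.exp (((j : ℝ) + 1 / 2) * z.re) *
        ((1 - Real.exp (-(2 * Real.pi * τ.im * (1 / 2))))⁻¹ *
          Real.exp (-(2 * Real.pi * τ.im * ((j : ℝ) + 1 / 2)))) := by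
        gcongr; exact norm_lambertCoeff_le hθ τ j
    _ = (1 - Real.exp (-(2 * Real.pi * τ.im * (1 / 2))))⁻¹ * (((j : ℝ) + 1 / 2) ^ p *
        (Real.exp (((j : ℝ) + 1 / 2) * z.re) *
          Real.exp (-(2 * Real.pi * τ.im * ((j : ℝ) + 1 / 2))))) := by ring
    _ = _ := by rw [← Real.exp_add]; congr 3; ring

/-- A term of the defining series of the twisted Weierstrass functions. -/
noncomputable def modeTerm (θ : ℂ) (τ : UpperHalfPlane) (p : ℕ) (m : ℤ) (z : ℂ) : ℂ :=
  ((m : ℂ) + 1 / 2) ^ p * Complex.exp (((m : ℂ) + 1 / 2) * z) * modeCoeff θ τ m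

/-- The fundamental strip `|q| < |e^z| < 1`. -/
def leftStrip (τ : UpperHalfPlane) : Set ℂ := {z | -(2 * Real.pi * τ.im) < z.re ∧ z.re < 0}

lemma modeTerm_natCast {θ : ℂ} (hθ : θ = 1 ∨ θ = -1) (τ : UpperHalfPlane) (p j : ℕ) (z : ℂ) :
    modeTerm θ τ p j z = ((j : ℂ) + 1 / 2) ^ p * Complex.exp (((j : ℂ) + 1 / 2) * z) +
      ((j : ℂ) + 1 / 2) ^ p * Complex.exp (((j : ℂ) + 1 / 2) * z) * lambertCoeff θ τ j := by
  rw [modeTerm, modeCoeff_natCast hθ, Int.cast_natCast]; ring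

lemma modeTerm_neg {θ : ℂ} (hθ : θ = 1 ∨ θ = -1) (τ : UpperHalfPlane) (p j : ℕ) (z : ℂ) :
    modeTerm θ τ p (-(j : ℤ) - 1) z = (-1) ^ (p + 1) *
      (((j : ℂ) + 1 / 2) ^ p * Complex.exp (((j : ℂ) + 1 / 2) * -z) * lambertCoeff θ τ j) := by
  rw [modeTerm, modeCoeff_neg hθ, neg_mode_cast, neg_pow, pow_succ,
    show -((j : ℂ) + 1 / 2) * z = ((j : ℂ) + 1 / 2) * -z by ring]
  ring

lemma summable_norm_modeTerm {θ : ℂ} (hθ : θ = 1 ∨ θ = -1) {τ : UpperHalfPlane} (p : ℕ) {z : ℂ}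
    (hz : z ∈ leftStrip τ) : Summable fun m => ‖modeTerm θ τ p m z‖ := by
  apply Summable.of_nat_of_neg_add_one
  · simp only [modeTerm_natCast hθ]
    refine Summable.of_nonneg_of_le (fun _ => norm_nonneg _) (fun j => norm_add_le _ _)
      ((summable_half_exp p hz.2).add (summable_half_exp_lambert hθ τ p ?_))
    have := hz.2; have := two_pi_im_pos τ; linarith
  · have : ∀ n : ℕ, -((n : ℤ) + 1) = -(n : ℤ) - 1 := fun n => by ring
    refine (summable_half_exp_lambert hθ τ p (z := -z) ?_).congr fun j => ?_
    · have := hz.1; simp; linarith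
    · rw [this, modeTerm_neg hθ, norm_mul ((-1) ^ (p + 1)), norm_pow, norm_neg, norm_one, one_pow,
        one_mul]

lemma norm_exp_mode (m : ℤ) (z : ℂ) :
    ‖Complex.exp (((m : ℂ) + 1 / 2) * z)‖ = Real.exp (((m : ℝ) + 1 / 2) * z.re) := by
  rw [Complex.norm_exp,
    show ((m : ℂ) + 1 / 2) * z = (((m : ℝ) + 1 / 2 : ℝ) : ℂ) * z by push_cast; ring,
    Complex.re_ofReal_mul]

/-- The exponential is monotone in the real part, so on a strip the terms are dominated by their
values at the two edges. This justifies termwise differentiation. -/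
lemma norm_modeTerm_le {θ : ℂ} {τ : UpperHalfPlane} (p : ℕ) (m : ℤ) {z : ℂ} {a b : ℝ}
    (ha : a ≤ z.re) (hb : z.re ≤ b) :
    ‖modeTerm θ τ p m z‖ ≤ ‖modeTerm θ τ p m a‖ + ‖modeTerm θ τ p m b‖ := by
  simp only [modeTerm, norm_mul, norm_exp_mode, Complex.ofReal_re]
  rw [← add_mul, ← mul_add]
  gcongr
  rcases le_or_gt 0 ((m : ℝ) + 1 / 2) with h | h
  · exact (Real.exp_le_exp.mpr (mul_le_mul_of_nonneg_left hb h)).trans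
      (le_add_of_nonneg_left (Real.exp_nonneg _))
  · exact (Real.exp_le_exp.mpr (mul_le_mul_of_nonpos_left ha h.le)).trans
      (le_add_of_nonneg_right (Real.exp_nonneg _))

lemma isOpen_reStrip (a b : ℝ) : IsOpen {z : ℂ | a < z.re ∧ z.re < b} :=
  (isOpen_lt continuous_const Complex.continuous_re).inter
    (isOpen_lt Complex.continuous_re continuous_const)

lemma hasDerivAt_modeTerm (θ : ℂ) (τ : UpperHalfPlane) (p : ℕ) (m : ℤ) (z : ℂ) :
    HasDerivAt (modeTerm θ τ p m) (modeTerm θ τ (p + 1) m z) z := by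
  have h := (((hasDerivAt_id z).const_mul ((m : ℂ) + 1 / 2)).cexp.const_mul
    (((m : ℂ) + 1 / 2) ^ p)).mul_const (modeCoeff θ τ m)
  refine h.congr_deriv ?_
  rw [modeTerm, id]
  ring

lemma deriv_tsum_modeTerm {θ : ℂ} (hθ : θ = 1 ∨ θ = -1) {τ : UpperHalfPlane} (p : ℕ) {z : ℂ}
    (hz : z ∈ leftStrip τ) : deriv (fun w => ∑' m, modeTerm θ τ p m w) z =
      ∑' m, modeTerm θ τ (p + 1) m z := by
  obtain ⟨a, ha1, ha2⟩ := exists_between hz.1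
  obtain ⟨b, hb1, hb2⟩ := exists_between hz.2
  have hsa := summable_norm_modeTerm hθ p (τ := τ) (z := (a : ℂ))
    ⟨by simpa using ha1, by have := hz.2; simp; linarith⟩
  have hsb := summable_norm_modeTerm hθ p (τ := τ) (z := (b : ℂ))
    ⟨by have := hz.1; simp; linarith, by simpa using hb2⟩
  have h := Complex.hasSum_deriv_of_summable_norm (hsa.add hsb)
    (F := modeTerm θ τ p) (U := {w : ℂ | a < w.re ∧ w.re < b})
    (fun m w _ => (hasDerivAt_modeTerm θ τ p m w).differentiableAt.differentiableWithinAt)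
    (isOpen_reStrip a b) (fun m w hw => norm_modeTerm_le p m hw.1.le hw.2.le) (z := z) ⟨ha2, hb1⟩
  rw [← h.tsum_eq]
  exact tsum_congr fun m => (hasDerivAt_modeTerm θ τ p m z).deriv

lemma norm_qPow_one (τ : UpperHalfPlane) : ‖qPow τ 1‖ = Real.exp (-(2 * Real.pi * τ.im)) := by
  have := norm_qPow τ 1
  rwa [Complex.ofReal_one, mul_one] at this

lemma mem_leftStrip_iff {τ : UpperHalfPlane} {z : ℂ} : z ∈ leftStrip τ ↔
    ‖qPow τ 1‖ < ‖Complex.exp z‖ ∧ ‖Complex.exp z‖ < 1 := by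
  rw [norm_qPow_one, Complex.norm_exp, Real.exp_lt_exp, Real.exp_lt_one_iff]
  rfl

lemma mem_puncturedStrip_iff {τ : UpperHalfPlane} {z : ℂ} : z ∈ puncturedStrip τ ↔
    -(2 * Real.pi * τ.im) < z.re ∧ z.re < 2 * Real.pi * τ.im ∧ Complex.exp z ≠ 1 := by
  unfold puncturedStrip
  rw [Set.mem_ofPred_eq, norm_qPow_one, Complex.norm_exp, Real.exp_lt_exp, ← Real.exp_neg, neg_neg,
    Real.exp_lt_exp]

lemma twistedSeries_half {θ : ℂ} (hθ : θ = 1 ∨ θ = -1) (p : ℕ) (τ : UpperHalfPlane) (z : ℂ) :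
    twistedSeries θ (1 / 2) (p + 1) τ z =
      (-1) ^ (p + 1) / (p.factorial : ℂ) * ∑' m, modeTerm θ τ p m z := by
  have h3 : θ⁻¹ = θ := by rcases hθ with rfl | rfl <;> norm_num
  rw [twistedSeries, Nat.add_sub_cancel, h3]
  congr 1
  refine tsum_congr fun m => ?_
  rw [if_neg (by norm_num), modeTerm, modeCoeff, div_eq_mul_inv]
  push_cast
  rfl

/-- The twisted Weierstrass function of weight one as a function on the whole strip. -/
noncomputable def weierstrassOne (θ : ℂ) (τ : UpperHalfPlane) (z : ℂ) : ℂ :=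
  -(Complex.exp (z / 2) / (1 - Complex.exp z) +
    ∑' j : ℕ, (Complex.exp (((j : ℂ) + 1 / 2) * z) - Complex.exp (((j : ℂ) + 1 / 2) * -z)) *
      lambertCoeff θ τ j)

/-- The twisted Weierstrass function of weight `p + 1`. -/
noncomputable def weierstrass (θ : ℂ) (τ : UpperHalfPlane) (p : ℕ) (z : ℂ) : ℂ :=
  (-1) ^ p / (p.factorial : ℂ) * iteratedDeriv p (weierstrassOne θ τ) z

lemma tsum_exp_half {z : ℂ} (hz : z.re < 0) :
    ∑' j : ℕ, Complex.exp (((j : ℂ) + 1 / 2) * z) = Complex.exp (z / 2) / (1 - Complex.exp z) := by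
  have h : ∀ j : ℕ, Complex.exp (((j : ℂ) + 1 / 2) * z) = Complex.exp (z / 2) * Complex.exp z ^ j := by
    intro j; rw [← Complex.exp_nat_mul, ← Complex.exp_add]; congr 1; ring
  simp only [h]
  rw [tsum_mul_left, tsum_geometric_of_norm_lt_one (by rwa [Complex.norm_exp, Real.exp_lt_one_iff])]
  rfl

/-- Resumming the geometric part of the modes `m ≥ 0` gives `e^{z/2}/(1 - e^z)`, the only term that
obstructs crossing `Re z = 0`; the closed form therefore supplies the continuation explicitly. -/
lemma weierstrassOne_eq {θ : ℂ} (hθ : θ = 1 ∨ θ = -1) {τ : UpperHalfPlane} {z : ℂ}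
    (hz : z ∈ leftStrip τ) : weierstrassOne θ τ z = -∑' m, modeTerm θ τ 0 m z := by
  have hpos := two_pi_im_pos τ
  have s1 := (summable_half_exp 0 hz.2).of_norm
  have s2 := (summable_half_exp_lambert hθ τ 0 (z := z) (by have := hz.2; linarith)).of_norm
  have s3 := (summable_half_exp_lambert hθ τ 0 (z := -z)
    (by have := hz.1; simp; linarith)).of_norm
  have key : HasSum (fun m => modeTerm θ τ 0 m z) _ := HasSum.of_nat_of_neg_add_one
    (f := fun m => modeTerm θ τ 0 m z)
    (((s1.hasSum.add s2.hasSum)).congr_fun fun j => modeTerm_natCast hθ τ 0 j z)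
    ((s3.hasSum.mul_left ((-1) ^ (0 + 1))).congr_fun fun j => by
      rw [show -((j : ℤ) + 1) = -(j : ℤ) - 1 by ring]; exact modeTerm_neg hθ τ 0 j z)
  rw [key.tsum_eq, weierstrassOne]
  simp only [pow_zero, one_mul] at s2 s3 ⊢
  simp only [sub_mul]
  rw [s2.tsum_sub s3, tsum_exp_half hz.2]
  ring

lemma weierstrass_eq {θ : ℂ} (hθ : θ = 1 ∨ θ = -1) {τ : UpperHalfPlane} (p : ℕ) {z : ℂ}
    (hz : z ∈ leftStrip τ) : weierstrass θ τ p z = twistedSeries θ (1 / 2) (p + 1) τ z := by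
  have key : ∀ p, ∀ z ∈ leftStrip τ, iteratedDeriv p (weierstrassOne θ τ) z =
      -∑' m, modeTerm θ τ p m z := by
    intro p
    induction p with
    | zero => intro z hz; rw [iteratedDeriv_zero]; exact weierstrassOne_eq hθ hz
    | succ p ih =>
      intro z hz
      have ho : leftStrip τ ∈ 𝓝 z := (isOpen_reStrip _ _).mem_nhds hz
      rw [iteratedDeriv_succ, Filter.EventuallyEq.deriv_eq (Filter.eventuallyEq_of_mem ho ih),
        deriv.fun_neg, deriv_tsum_modeTerm hθ p hz]
  rw [weierstrass, key p z hz, twistedSeries_half hθ, pow_succ]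
  ring

lemma weierstrassOne_neg (θ : ℂ) (τ : UpperHalfPlane) (z : ℂ) :
    weierstrassOne θ τ (-z) = -weierstrassOne θ τ z := by
  unfold weierstrassOne
  have h1 : Complex.exp (-z / 2) / (1 - Complex.exp (-z)) =
      -(Complex.exp (z / 2) / (1 - Complex.exp z)) := by
    by_cases h : Complex.exp z = 1
    -- At a pole both quotients are zero by the convention for division by zero, so oddness holds
    -- there as well.
    · rw [Complex.exp_neg, h]; simp
    · have h2 : (1 : ℂ) - Complex.exp z ≠ 0 := sub_ne_zero.mpr (Ne.symm h)
      have h3 := Complex.exp_ne_zero z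
      have h4 : Complex.exp z - 1 ≠ 0 := sub_ne_zero.mpr h
      have h5 : Complex.exp (-z / 2) = Complex.exp (z / 2) * Complex.exp (-z) := by
        rw [← Complex.exp_add]; congr 1; ring
      rw [h5, Complex.exp_neg]
      have h6 : 1 - (Complex.exp z)⁻¹ = -((1 - Complex.exp z) * (Complex.exp z)⁻¹) := by
        field_simp; ring
      rw [h6, div_neg, mul_div_mul_right _ _ (inv_ne_zero h3)]
  rw [h1, neg_neg, neg_neg, neg_add]
  rw [neg_neg, ← tsum_neg]
  congr 1
  refine tsum_congr fun j => ?_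
  ring

lemma weierstrass_neg (θ : ℂ) (τ : UpperHalfPlane) (p : ℕ) (z : ℂ) :
    weierstrass θ τ p (-z) = (-1) ^ (p + 1) * weierstrass θ τ p z := by
  have h := iteratedDeriv_comp_neg p (weierstrassOne θ τ) z
  have h2 : (fun x => weierstrassOne θ τ (-x)) = -weierstrassOne θ τ :=
    funext (weierstrassOne_neg θ τ)
  rw [h2, iteratedDeriv_neg, smul_eq_mul] at h
  have h3 : ((-1 : ℂ) ^ p) * (-1) ^ p = 1 := by rw [← mul_pow]; simp
  rw [weierstrass, weierstrass, pow_succ]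
  linear_combination ((-1) ^ p / (p.factorial : ℂ)) * (-(-1 : ℂ) ^ p * h
    - iteratedDeriv p (weierstrassOne θ τ) (-z) * h3)

lemma isOpen_puncturedStrip (τ : UpperHalfPlane) : IsOpen (puncturedStrip τ) := by
  have : puncturedStrip τ = {z : ℂ | -(2 * Real.pi * τ.im) < z.re ∧ z.re < 2 * Real.pi * τ.im} ∩
      {z | Complex.exp z ≠ 1} := by
    ext z; rw [mem_puncturedStrip_iff, ← and_assoc]; rfl
  rw [this]
  exact (isOpen_reStrip _ _).inter (isOpen_ne_fun Complex.continuous_exp continuous_const)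

lemma analyticOnNhd_weierstrassOne {θ : ℂ} (hθ : θ = 1 ∨ θ = -1) (τ : UpperHalfPlane) :
    AnalyticOnNhd ℂ (weierstrassOne θ τ) (puncturedStrip τ) := by
  refine DifferentiableOn.analyticOnNhd (fun z hz => ?_) (isOpen_puncturedStrip τ)
  rw [mem_puncturedStrip_iff] at hz
  refine (DifferentiableAt.neg (DifferentiableAt.add ?_ ?_)).differentiableWithinAt
  · refine DifferentiableAt.div (by fun_prop) (by fun_prop) (sub_ne_zero.mpr (Ne.symm hz.2.2))
  · have hr : |z.re| < 2 * Real.pi * τ.im := abs_lt.mpr ⟨hz.1, hz.2.1⟩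
    obtain ⟨r, hr1, hr2⟩ := exists_between hr
    have hs := (summable_half_exp_lambert hθ τ 0 (z := (r : ℂ)) (by simpa using hr2)).mul_left 2
    refine DifferentiableOn.differentiableAt (s := {w : ℂ | -r < w.re ∧ w.re < r}) ?_
      ((isOpen_reStrip _ _).mem_nhds (abs_lt.mp hr1))
    refine Complex.differentiableOn_tsum_of_summable_norm hs (fun j => by fun_prop)
      (isOpen_reStrip _ _) fun j w hw => ?_
    rw [pow_zero, one_mul, norm_mul, norm_mul, ← mul_assoc, two_mul]
    gcongr
    refine (norm_sub_le _ _).trans (add_le_add ?_ ?_) <;>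
      rw [norm_exp_half, norm_exp_half] <;> apply Real.exp_le_exp.mpr <;>
      apply mul_le_mul_of_nonneg_left _ (by positivity)
    · simpa using hw.2.le
    · have := hw.1; simp; linarith

lemma analyticOnNhd_weierstrass {θ : ℂ} (hθ : θ = 1 ∨ θ = -1) (τ : UpperHalfPlane) (p : ℕ) :
    AnalyticOnNhd ℂ (weierstrass θ τ p) (puncturedStrip τ) := by
  have h := (analyticOnNhd_weierstrassOne hθ τ).iterated_deriv p
  rw [← iteratedDeriv_eq_iterate] at h
  exact fun z hz => analyticAt_const.mul (h z hz)

lemma exp_ne_one_of_re {z : ℂ} (hz : z.re ≠ 0) : Complex.exp z ≠ 1 := by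
  intro h
  have := congrArg norm h
  rw [Complex.norm_exp, norm_one, Real.exp_eq_one_iff] at this
  exact hz this

lemma leftStrip_subset (τ : UpperHalfPlane) : leftStrip τ ⊆ puncturedStrip τ := fun z hz =>
  mem_puncturedStrip_iff.mpr ⟨hz.1, by have := hz.2; have := two_pi_im_pos τ; linarith,
    exp_ne_one_of_re hz.2.ne⟩

/-- The open half strips `A` and `B` are joined by the rectangle `C`, which crosses the imaginary
axis between the poles `0` and `2πi`. Every other point of the axis is a limit of points of `A`, and
a set between a preconnected set and its closure is preconnected. -/
lemma isPreconnected_puncturedStrip (τ : UpperHalfPlane) : IsPreconnected (puncturedStrip τ) := by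
  have hpos := two_pi_im_pos τ
  set l := 2 * Real.pi * τ.im with hl
  set A := {z : ℂ | -l < z.re ∧ z.re < 0}
  set B := {z : ℂ | 0 < z.re ∧ z.re < l}
  set C := {z : ℂ | (-l < z.re ∧ z.re < l) ∧ (0 < z.im ∧ z.im < 2 * Real.pi)}
  have hA : Convex ℝ A := (convex_halfSpace_re_gt _).inter (convex_halfSpace_re_lt _)
  have hB : Convex ℝ B := (convex_halfSpace_re_gt _).inter (convex_halfSpace_re_lt _)
  have hC : Convex ℝ C := ((convex_halfSpace_re_gt _).inter (convex_halfSpace_re_lt _)).inter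
    ((convex_halfSpace_im_gt _).inter (convex_halfSpace_im_lt _))
  have hpi := Real.pi_pos
  have hAC : IsPreconnected (A ∪ C) := hA.isPreconnected.union' ⟨⟨-l / 2, 1⟩,
    ⟨by dsimp only; linarith, by dsimp only; linarith⟩,
    ⟨by dsimp only; linarith, by dsimp only; linarith⟩, by norm_num,
    by have := Real.pi_gt_three; dsimp only; linarith⟩ hC.isPreconnected
  have hACB : IsPreconnected (A ∪ C ∪ B) := hAC.union' ⟨⟨l / 2, 1⟩,
    Or.inr ⟨⟨by dsimp only; linarith, by dsimp only; linarith⟩, by norm_num,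
      by have := Real.pi_gt_three; dsimp only; linarith⟩,
    ⟨by dsimp only; linarith, by dsimp only; linarith⟩⟩ hB.isPreconnected
  refine hACB.subset_closure ?_ ?_
  · rintro z ((hz | hz) | hz) <;> rw [mem_puncturedStrip_iff]
    · exact ⟨hz.1, by have := hz.2; linarith, exp_ne_one_of_re hz.2.ne⟩
    · refine ⟨hz.1.1, hz.1.2, fun h => ?_⟩
      rw [Complex.exp_eq_one_iff] at h
      obtain ⟨n, hn⟩ := h
      have him := congrArg Complex.im hn
      have h1 := hz.2.1
      have h2 := hz.2.2
      simp at him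
      rw [him] at h1 h2
      have h3 : (0 : ℝ) < n := by
        by_contra h; push Not at h; nlinarith
      have h4 : (n : ℝ) < 1 := by
        by_contra h; push Not at h; nlinarith
      have h5 : 0 < n := by exact_mod_cast h3
      have h6 : n < 1 := by exact_mod_cast h4
      omega
    · exact ⟨by have := hz.1; linarith, hz.2, exp_ne_one_of_re hz.1.ne'⟩
  · intro z hz
    rw [mem_puncturedStrip_iff] at hz
    rcases lt_trichotomy z.re 0 with h | h | h
    · exact subset_closure (Or.inl (Or.inl ⟨hz.1, h⟩))
    · refine closure_mono (Set.subset_union_left.trans Set.subset_union_left : A ⊆ A ∪ C ∪ B) ?_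
      have hlim : Filter.Tendsto (fun t : ℝ => z + (t : ℂ)) (𝓝[<] 0) (𝓝 z) := by
        have : ContinuousAt (fun t : ℝ => z + (t : ℂ)) 0 := by fun_prop
        have h2 := this.tendsto
        simp only [Complex.ofReal_zero, add_zero] at h2
        exact h2.mono_left nhdsWithin_le_nhds
      refine mem_closure_of_tendsto hlim ?_
      filter_upwards [Ioo_mem_nhdsLT (show -l < 0 by linarith)] with t ht
      exact ⟨by simp [h]; exact ht.1, by simp [h]; exact ht.2⟩
    · exact subset_closure (Or.inr ⟨h, hz.2.1⟩)

/-- The twisted Weierstrass functions on the punctured strip. -/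
lemma twistedWeierstrass_eq {θ : ℂ} (hθ : θ = 1 ∨ θ = -1) {τ : UpperHalfPlane} (p : ℕ) {z : ℂ}
    (hz : z ∈ puncturedStrip τ) : twistedWeierstrass θ (1 / 2) (p + 1) τ z = weierstrass θ τ p z := by
  have hc : IsContinuation θ (1 / 2) (p + 1) τ (weierstrass θ τ p) :=
    ⟨analyticOnNhd_weierstrass hθ τ p, fun z h1 h2 =>
      weierstrass_eq hθ p (mem_leftStrip_iff.mpr ⟨h1, h2⟩)⟩
  have hex : ∃ f : ℂ → ℂ, IsContinuation θ (1 / 2) (p + 1) τ f := ⟨_, hc⟩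
  rw [twistedWeierstrass, dif_pos hex]
  have hpos := two_pi_im_pos τ
  have hz₀ : ((-(Real.pi * τ.im) : ℝ) : ℂ) ∈ leftStrip τ :=
    ⟨by simp; linarith, by simp; linarith⟩
  refine hex.choose_spec.1.eqOn_of_preconnected_of_eventuallyEq hc.1
    (isPreconnected_puncturedStrip τ) (leftStrip_subset τ hz₀) ?_ hz
  filter_upwards [(isOpen_reStrip _ _).mem_nhds hz₀] with w hw
  have hw' := mem_leftStrip_iff.mp hw
  rw [hex.choose_spec.2 w hw'.1 hw'.2, hc.2 w hw'.1 hw'.2]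

lemma neg_mem_puncturedStrip {τ : UpperHalfPlane} {z : ℂ} (hz : z ∈ puncturedStrip τ) :
    -z ∈ puncturedStrip τ := by
  rw [mem_puncturedStrip_iff] at hz ⊢
  refine ⟨by simp; linarith [hz.2.1], by simp; linarith [hz.1], fun h => hz.2.2 ?_⟩
  rw [Complex.exp_neg, inv_eq_one] at h
  exact h

lemma twistedWeierstrass_neg {θ : ℂ} (hθ : θ = 1 ∨ θ = -1) {τ : UpperHalfPlane} (p : ℕ) {z : ℂ}
    (hz : z ∈ puncturedStrip τ) : twistedWeierstrass θ (1 / 2) (p + 1) τ (-z) =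
      (-1) ^ (p + 1) * twistedWeierstrass θ (1 / 2) (p + 1) τ z := by
  rw [twistedWeierstrass_eq hθ p hz, twistedWeierstrass_eq hθ p (neg_mem_puncturedStrip hz),
    weierstrass_neg]

lemma analyticOnNhd_twistedWeierstrass {θ : ℂ} (hθ : θ = 1 ∨ θ = -1) (τ : UpperHalfPlane) (p : ℕ) :
    AnalyticOnNhd ℂ (twistedWeierstrass θ (1 / 2) (p + 1) τ) (puncturedStrip τ) :=
  (analyticOnNhd_weierstrass hθ τ p).congr (isOpen_puncturedStrip τ)
    fun _ hz => (twistedWeierstrass_eq hθ p hz).symm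

/-- For the shift `1/2` and `θ⁻¹ = θ` the two Lambert sums coincide. Consequently the Eisenstein
series of odd index vanish, since `B_n(1/2) = 0` for odd `n`. -/
lemma twistedEisenstein_half {θ : ℂ} (hθ : θ = 1 ∨ θ = -1) (τ : UpperHalfPlane) (p : ℕ) :
    twistedEisenstein θ (1 / 2) (p + 1) τ =
      -(Polynomial.aeval (((1 / 2 : ℝ) : ℝ) : ℂ) (Polynomial.bernoulli (p + 1)) /
        ((p + 1).factorial : ℂ)) + (1 - (-1) ^ p) / (p.factorial : ℂ) *
          ∑' j : ℕ, ((j : ℂ) + 1 / 2) ^ p * lambertCoeff θ τ j := by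
  have h3 : θ⁻¹ = θ := by rcases hθ with rfl | rfl <;> norm_num
  rw [twistedEisenstein, Nat.add_sub_cancel, h3]
  have e1 : ∀ r : ℕ, (if θ = 1 ∧ (1 / 2 : ℝ) = 0 ∧ r = 0 then 0
       else ((r : ℂ) + (1 / 2 : ℝ)) ^ p * (θ * qPow τ ((r : ℂ) + (1 / 2 : ℝ))) /
        (1 - θ * qPow τ ((r : ℂ) + (1 / 2 : ℝ)))) =
        ((r : ℂ) + 1 / 2) ^ p * lambertCoeff θ τ r := by
    intro r
    rw [if_neg (by norm_num), lambertCoeff, mul_div_assoc]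
    push_cast
    rfl
  have e2 : ∀ r : ℕ, ((r : ℂ) + 1 - (1 / 2 : ℝ)) ^ p * (θ * qPow τ ((r : ℂ) + 1 - (1 / 2 : ℝ))) /
        (1 - θ * qPow τ ((r : ℂ) + 1 - (1 / 2 : ℝ))) =
        ((r : ℂ) + 1 / 2) ^ p * lambertCoeff θ τ r := by
    intro r
    rw [show (r : ℂ) + 1 - ((1 / 2 : ℝ) : ℂ) = (r : ℂ) + 1 / 2 by push_cast; ring, lambertCoeff,
      mul_div_assoc]
  simp only [e1, e2]
  rw [pow_succ]
  ring

lemma aeval_bernoulli_half_of_odd {n : ℕ} (hn : Odd n) :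
    Polynomial.aeval (((1 / 2 : ℝ) : ℝ) : ℂ) (Polynomial.bernoulli n) = 0 := by
  have h := Polynomial.bernoulli_eval_one_sub n (1 / 2)
  rw [hn.neg_one_pow, show (1 : ℚ) - 1 / 2 = 1 / 2 by norm_num, neg_one_mul] at h
  have h2 : (Polynomial.bernoulli n).eval (1 / 2 : ℚ) = 0 := by linarith
  have h3 : (((1 / 2 : ℝ) : ℝ) : ℂ) = algebraMap ℚ ℂ (1 / 2) := by push_cast; simp
  rw [h3, Polynomial.aeval_algebraMap_apply, Polynomial.coe_aeval_eq_eval, h2, map_zero]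

lemma twistedEisenstein_of_odd {θ : ℂ} (hθ : θ = 1 ∨ θ = -1) (τ : UpperHalfPlane) {p : ℕ}
    (hp : Even p) : twistedEisenstein θ (1 / 2) (p + 1) τ = 0 := by
  rw [twistedEisenstein_half hθ, aeval_bernoulli_half_of_odd hp.add_one, hp.neg_one_pow]
  simp

/-- If `p + r` is even the Eisenstein series has odd index and is zero; if it is odd the two signs
are opposite. -/
lemma coeffC_antisymm {θ : ℂ} (hθ : θ = 1 ∨ θ = -1) (τ : UpperHalfPlane) (p r : ℕ) :
    coeffC θ (1 / 2) (p + 1) (r + 1) τ = -coeffC θ (1 / 2) (r + 1) (p + 1) τ := by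
  simp only [coeffC]
  rw [show p + 1 + (r + 1) - 2 = p + r by omega, show r + 1 + (p + 1) - 2 = p + r by omega,
    show p + 1 + (r + 1) - 1 = p + r + 1 by omega, show r + 1 + (p + 1) - 1 = p + r + 1 by omega,
    Nat.add_sub_cancel, Nat.add_sub_cancel, Nat.choose_symm_add]
  rcases Nat.even_or_odd (p + r) with h | h
  · rw [twistedEisenstein_of_odd hθ τ h]; simp
  · have : (-1 : ℂ) ^ (r + 1) = -(-1) ^ (p + 1) := by
      have h2 : (-1 : ℂ) ^ (p + r) = -1 := h.neg_one_pow
      have h3 : (-1 : ℂ) ^ p * (-1) ^ p = 1 := by rw [← mul_pow]; simp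
      rw [pow_add] at h2
      rw [pow_succ, pow_succ]
      linear_combination (-(-1 : ℂ) ^ p) * h2 + (-1 : ℂ) ^ r * h3
    rw [this]; ring

lemma coeffD_antisymm {θ : ℂ} (hθ : θ = 1 ∨ θ = -1) {τ : UpperHalfPlane} (p r : ℕ) {z : ℂ}
    (hz : z ∈ puncturedStrip τ) :
    coeffD θ (1 / 2) (p + 1) (r + 1) τ z = -coeffD θ (1 / 2) (r + 1) (p + 1) τ (-z) := by
  simp only [coeffD]
  rw [show p + 1 + (r + 1) - 2 = p + r by omega, show r + 1 + (p + 1) - 2 = p + r by omega,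
    show p + 1 + (r + 1) - 1 = p + r + 1 by omega, show r + 1 + (p + 1) - 1 = p + r + 1 by omega,
    Nat.add_sub_cancel, Nat.add_sub_cancel, Nat.choose_symm_add, twistedWeierstrass_neg hθ _ hz]
  have h3 : (-1 : ℂ) ^ r * (-1) ^ r = 1 := by rw [← mul_pow]; simp
  simp only [pow_succ, pow_add]
  linear_combination (-((-1 : ℂ) ^ p * ((p + r).choose r : ℕ) *
    twistedWeierstrass θ (1 / 2) (p + r + 1) τ z)) * h3

end FreeFermion

namespace FreeFermion

open scoped ENNReal

/-! ### Bounded matrices -/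

/-- The matrices whose entries are bounded by a multiple of `exp(α deg S - β deg T)`. -/
def boundedKernels (α β : ℝ) : Submodule ℂ Kernel where
  carrier := {K | IsBddKernel α β fun S T => ‖K S T‖ₑ}
  add_mem' h h' := (h.add h').mono fun _ _ => enorm_add_le _ _
  zero_mem' := ⟨0, by simp, fun _ _ => by simp⟩
  smul_mem' c _ h := (h.const_mul (c := ‖c‖ₑ) (by simp)).mono fun _ _ => by
    rw [Pi.smul_apply, Pi.smul_apply, smul_eq_mul, enorm_mul]

lemma abs_deg_toggle_sub (j : ℕ) (S : Finset ℕ) :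
    |(deg (toggle j S) : ℝ) - deg S| ≤ 2 * j + 1 := by
  rw [abs_le]
  have h0 : (0 : ℝ) ≤ j := Nat.cast_nonneg j
  by_cases h : j ∈ S
  · have := deg_erase h
    rw [toggle_of_mem h]
    have h2 : (deg (S.erase j) : ℝ) + (2 * j + 1) = deg S := by exact_mod_cast this
    constructor <;> linarith
  · have := deg_insert h
    rw [toggle_of_notMem h]
    have h2 : (deg (insert j S) : ℝ) = deg S + (2 * j + 1) := by exact_mod_cast this
    constructor <;> linarith

lemma enorm_op_le (b : Bool) (j : ℕ) (f : Finset ℕ → ℂ) (S : Finset ℕ) :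
    ‖op b j f S‖ₑ ≤ ‖f (toggle j S)‖ₑ := by
  unfold op
  split_ifs
  · rw [enorm_mul, enorm_orderSign, one_mul]
  · simp

lemma growth_toggle_left_le (α β : ℝ) (j : ℕ) (S T : Finset ℕ) : growth α β (toggle j S) T ≤
    ENNReal.ofReal (Real.exp (|α| * (2 * j + 1))) * growth α β S T := by
  unfold growth
  rw [← ENNReal.ofReal_mul (Real.exp_nonneg _), ← Real.exp_add]
  apply ENNReal.ofReal_le_ofReal
  apply Real.exp_le_exp.mpr
  have h1 := mul_le_mul_of_nonneg_left (abs_deg_toggle_sub j S) (abs_nonneg α)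
  rw [← abs_mul] at h1
  have := le_abs_self (α * ((deg (toggle j S) : ℝ) - deg S))
  linarith

lemma growth_toggle_right_le (α β : ℝ) (j : ℕ) (S T : Finset ℕ) : growth α β S (toggle j T) ≤
    ENNReal.ofReal (Real.exp (|β| * (2 * j + 1))) * growth α β S T := by
  unfold growth
  rw [← ENNReal.ofReal_mul (Real.exp_nonneg _), ← Real.exp_add]
  apply ENNReal.ofReal_le_ofReal
  apply Real.exp_le_exp.mpr
  have h1 := mul_le_mul_of_nonneg_left (abs_deg_toggle_sub j T) (abs_nonneg β)
  rw [← abs_mul] at h1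
  have := neg_le_abs (β * ((deg (toggle j T) : ℝ) - deg T))
  linarith

/-- A single mode changes the degree by a bounded amount, so only the constant changes and the
exponents survive. -/
lemma leftMul_mem {α β : ℝ} {K : Kernel} (hK : K ∈ boundedKernels α β) (m : ℤ) :
    leftMul m K ∈ boundedKernels α β := by
  obtain ⟨C, hC, h⟩ := hK
  refine ⟨C * ENNReal.ofReal (Real.exp (|α| * (2 * (level m : ℕ) + 1))),
    ENNReal.mul_ne_top hC ENNReal.ofReal_ne_top, fun S T => ?_⟩
  rw [mul_assoc]
  exact (enorm_op_le _ _ _ _).trans ((h _ _).trans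
    (mul_le_mul_right (growth_toggle_left_le α β _ S T) C))

lemma rightMul_mem {α β : ℝ} {K : Kernel} (hK : K ∈ boundedKernels α β) (m : ℤ) :
    rightMul m K ∈ boundedKernels α β := by
  obtain ⟨C, hC, h⟩ := hK
  refine ⟨C * ENNReal.ofReal (Real.exp (|β| * (2 * (level (-m - 1) : ℕ) + 1))),
    ENNReal.mul_ne_top hC ENNReal.ofReal_ne_top, fun S T => ?_⟩
  rw [mul_assoc]
  refine (enorm_op_le _ _ _ _).trans ?_
  rw [enorm_parityConj]
  exact (h _ _).trans (mul_le_mul_right (growth_toggle_right_le α β _ S T) C)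

lemma gradedComm_mem {α β : ℝ} {K : Kernel} (hK : K ∈ boundedKernels α β) (m : ℤ) :
    gradedComm m K ∈ boundedKernels α β :=
  Submodule.sub_mem _ (leftMul_mem hK m) (rightMul_mem hK m)

lemma parityConj_mem {α β : ℝ} {K : Kernel} (hK : K ∈ boundedKernels α β) :
    parityConj K ∈ boundedKernels α β :=
  IsBddKernel.mono hK fun _ _ => (enorm_parityConj _ _ _).le

lemma kernelMul_mem {α β α' β' : ℝ} {A B : Kernel} (hA : A ∈ boundedKernels α β)
    (hB : B ∈ boundedKernels α' β') (h : α' < β) : kernelMul A B ∈ boundedKernels α β' :=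
  isBddKernel_kernelMul hA hB h

lemma list_sum_mem {ι : Type*} {α β : ℝ} {l : List ι} {c : ι → ℂ} {K : ι → Kernel}
    (h : ∀ i ∈ l, K i ∈ boundedKernels α β) :
    (l.map fun i => c i • K i).sum ∈ boundedKernels α β := by
  induction l with
  | nil => exact Submodule.zero_mem _
  | cons i l ih =>
    rw [List.map_cons, List.sum_cons]
    exact Submodule.add_mem _ (Submodule.smul_mem _ _ (h i (by simp)))
      (ih fun j hj => h j (by simp [hj]))

lemma summable_kernelMul {α β α' β' : ℝ} {A B : Kernel} (hA : A ∈ boundedKernels α β)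
    (hB : B ∈ boundedKernels α' β') (h : α' < β) (S U : Finset ℕ) :
    Summable fun T => A S T * B T U := by
  apply Summable.of_enorm
  simp only [enorm_mul]
  exact (IsBddKernel.comp hA hB h).ne_top S U

/-! ### Products and fermionic modes -/

lemma kernelMul_sub_left {α β α' β' : ℝ} {A A' B : Kernel} (hA : A ∈ boundedKernels α β)
    (hA' : A' ∈ boundedKernels α β) (hB : B ∈ boundedKernels α' β') (h : α' < β) :
    kernelMul (A - A') B = kernelMul A B - kernelMul A' B := by
  funext S U
  rw [Pi.sub_apply, Pi.sub_apply, kernelMul, kernelMul, kernelMul,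
    ← (summable_kernelMul hA hB h S U).tsum_sub (summable_kernelMul hA' hB h S U)]
  exact tsum_congr fun T => sub_mul _ _ _

lemma kernelMul_add_left {α β α' β' : ℝ} {A A' B : Kernel} (hA : A ∈ boundedKernels α β)
    (hA' : A' ∈ boundedKernels α β) (hB : B ∈ boundedKernels α' β') (h : α' < β) :
    kernelMul (A + A') B = kernelMul A B + kernelMul A' B := by
  funext S U
  rw [Pi.add_apply, Pi.add_apply, kernelMul, kernelMul, kernelMul,
    ← (summable_kernelMul hA hB h S U).tsum_add (summable_kernelMul hA' hB h S U)]
  exact tsum_congr fun T => add_mul _ _ _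

lemma kernelMul_add_right {α β α' β' : ℝ} {A B B' : Kernel} (hA : A ∈ boundedKernels α β)
    (hB : B ∈ boundedKernels α' β') (hB' : B' ∈ boundedKernels α' β') (h : α' < β) :
    kernelMul A (B + B') = kernelMul A B + kernelMul A B' := by
  funext S U
  rw [Pi.add_apply, Pi.add_apply, kernelMul, kernelMul, kernelMul,
    ← (summable_kernelMul hA hB h S U).tsum_add (summable_kernelMul hA hB' h S U)]
  exact tsum_congr fun T => mul_add _ _ _

lemma kernelMul_sub_right {α β α' β' : ℝ} {A B B' : Kernel} (hA : A ∈ boundedKernels α β)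
    (hB : B ∈ boundedKernels α' β') (hB' : B' ∈ boundedKernels α' β') (h : α' < β) :
    kernelMul A (B - B') = kernelMul A B - kernelMul A B' := by
  funext S U
  rw [Pi.sub_apply, Pi.sub_apply, kernelMul, kernelMul, kernelMul,
    ← (summable_kernelMul hA hB h S U).tsum_sub (summable_kernelMul hA hB' h S U)]
  exact tsum_congr fun T => mul_sub _ _ _

lemma kernelMul_smul_left (c : ℂ) (A B : Kernel) : kernelMul (c • A) B = c • kernelMul A B := by
  funext S U
  rw [Pi.smul_apply, Pi.smul_apply, kernelMul, kernelMul, smul_eq_mul, ← tsum_mul_left]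
  exact tsum_congr fun T => mul_assoc _ _ _

lemma kernelMul_smul_right (c : ℂ) (A B : Kernel) : kernelMul A (c • B) = c • kernelMul A B := by
  funext S U
  rw [Pi.smul_apply, Pi.smul_apply, kernelMul, kernelMul, smul_eq_mul, ← tsum_mul_left]
  exact tsum_congr fun T => mul_left_comm _ _ _

lemma kernelMul_zero_left (B : Kernel) : kernelMul 0 B = 0 := by
  funext S U; simp [kernelMul]

lemma kernelMul_zero_right (A : Kernel) : kernelMul A 0 = 0 := by
  funext S U; simp [kernelMul]

lemma kernelMul_list_sum_left {ι : Type*} {α β α' β' : ℝ} {l : List ι} {c : ι → ℂ}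
    {K : ι → Kernel} {B : Kernel} (hK : ∀ i ∈ l, K i ∈ boundedKernels α β)
    (hB : B ∈ boundedKernels α' β') (h : α' < β) :
    kernelMul (l.map fun i => c i • K i).sum B = (l.map fun i => c i • kernelMul (K i) B).sum := by
  induction l with
  | nil => exact kernelMul_zero_left B
  | cons i l ih =>
    have h1 : ∀ j ∈ l, K j ∈ boundedKernels α β := fun j hj => hK j (by simp [hj])
    simp only [List.map_cons, List.sum_cons]
    rw [kernelMul_add_left (Submodule.smul_mem _ _ (hK i (by simp))) (list_sum_mem h1) hB h,
      kernelMul_smul_left, ih h1]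

lemma kernelMul_list_sum_right {ι : Type*} {α β α' β' : ℝ} {l : List ι} {c : ι → ℂ}
    {K : ι → Kernel} {A : Kernel} (hA : A ∈ boundedKernels α β)
    (hK : ∀ i ∈ l, K i ∈ boundedKernels α' β') (h : α' < β) :
    kernelMul A (l.map fun i => c i • K i).sum = (l.map fun i => c i • kernelMul A (K i)).sum := by
  induction l with
  | nil => exact kernelMul_zero_right A
  | cons i l ih =>
    have h1 : ∀ j ∈ l, K j ∈ boundedKernels α' β' := fun j hj => hK j (by simp [hj])
    simp only [List.map_cons, List.sum_cons]
    rw [kernelMul_add_right hA (Submodule.smul_mem _ _ (hK i (by simp))) (list_sum_mem h1) h,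
      kernelMul_smul_right, ih h1]

lemma leftMul_kernelMul (m : ℤ) (A B : Kernel) :
    leftMul m (kernelMul A B) = kernelMul (leftMul m A) B := by
  funext S U
  simp only [leftMul_apply, kernelMul, psiFun, op]
  split_ifs
  · rw [← tsum_mul_left]
    exact tsum_congr fun T => (mul_assoc _ _ _).symm
  · simp

lemma neg_one_pow_card_mul (S T U : Finset ℕ) : (-1 : ℂ) ^ (S.card + U.card) =
    (-1) ^ (S.card + T.card) * (-1) ^ (T.card + U.card) := by
  have h : (-1 : ℂ) ^ T.card * (-1) ^ T.card = 1 := by rw [← mul_pow]; simp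
  simp only [pow_add]
  linear_combination (-((-1 : ℂ) ^ S.card * (-1) ^ U.card)) * h

lemma rightMul_kernelMul (m : ℤ) (A B : Kernel) :
    rightMul m (kernelMul A B) = kernelMul (parityConj A) (rightMul m B) := by
  funext S U
  simp only [kernelMul, rightMul_apply']
  simp only [psiFun, op, parityConj]
  split_ifs
  · rw [← tsum_mul_left, ← tsum_mul_left, ← tsum_neg]
    refine tsum_congr fun T => ?_
    rw [neg_one_pow_card_mul S T U]
    ring
  · simp

/-- Associativity of the product with `ψ(m)` placed between the factors, in the form of the
transposition rule `tsum_op_mul`. -/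
lemma kernelMul_rightMul (m : ℤ) (A B : Kernel) :
    kernelMul (rightMul m A) B = kernelMul (parityConj A) (leftMul m B) := by
  funext S U
  obtain ⟨j, rfl | rfl⟩ := exists_mode m
  · simp only [kernelMul, rightMul_apply, leftMul_apply, psiFun_natCast, psiFun_neg]
    exact tsum_op_mul true j _ _
  · have h : -(-(j : ℤ) - 1) - 1 = j := by ring
    simp only [kernelMul, rightMul_apply, leftMul_apply, h, psiFun_natCast, psiFun_neg]
    exact tsum_op_mul false j _ _

/-- The super Leibniz rule: the mode placed between the factors appears once with each sign and
cancels. Boundedness is needed only to split the infinite matrix products. -/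
lemma gradedComm_kernelMul {α β α' β' : ℝ} {A B : Kernel} (hA : A ∈ boundedKernels α β)
    (hB : B ∈ boundedKernels α' β') (h : α' < β) (m : ℤ) :
    gradedComm m (kernelMul A B) =
      kernelMul (gradedComm m A) B + kernelMul (parityConj A) (gradedComm m B) := by
  simp only [gradedComm, LinearMap.sub_apply]
  rw [kernelMul_sub_left (leftMul_mem hA m) (rightMul_mem hA m) hB h,
    kernelMul_sub_right (parityConj_mem hA) (leftMul_mem hB m) (rightMul_mem hB m) h,
    leftMul_kernelMul, rightMul_kernelMul, kernelMul_rightMul]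
  abel

/-! ### Twisting -/

lemma rightMul_neg_apply (j : ℕ) (K : Kernel) (S T : Finset ℕ) :
    rightMul (-(j : ℤ) - 1) K S T =
      if j ∈ T then 0 else orderSign j T * parityConj K S (insert j T) := by
  rw [rightMul_apply, show -(-(j : ℤ) - 1) - 1 = j by ring, psiFun_natCast]
  by_cases h : j ∈ T <;> simp [op, h, toggle_of_notMem]

lemma cast_deg_insert {j : ℕ} {S : Finset ℕ} (h : j ∉ S) :
    (deg (insert j S) : ℂ) = deg S + (2 * j + 1) := by
  exact_mod_cast deg_insert h

lemma cast_deg_erase {j : ℕ} {S : Finset ℕ} (h : j ∈ S) :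
    (deg (S.erase j) : ℂ) = deg S - (2 * j + 1) := by
  rw [eq_sub_iff_add_eq]
  exact_mod_cast deg_erase h

/-- Conjugation by `e^{zL(0)}` rescales `ψ(m)`, which lowers the weight by `m + 1/2`. -/
lemma leftMul_twist (m : ℤ) (z : ℂ) (K : Kernel) :
    leftMul m (twist z K) = Complex.exp (((m : ℂ) + 1 / 2) * z) • twist z (leftMul m K) := by
  funext S T
  rw [Pi.smul_apply, Pi.smul_apply, smul_eq_mul]
  obtain ⟨j, rfl | rfl⟩ := exists_mode m
  · simp only [leftMul_natCast_apply, twist]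
    split_ifs with h
    · simp
    · rw [cast_deg_insert h, ← mul_assoc (Complex.exp _), ← Complex.exp_add, mul_left_comm]
      congr 2
      push_cast; ring
  · simp only [leftMul_neg_apply, twist]
    split_ifs with h
    · rw [cast_deg_erase h, ← mul_assoc (Complex.exp _), ← Complex.exp_add, mul_left_comm]
      congr 2
      push_cast; ring
    · simp

lemma rightMul_twist (m : ℤ) (z : ℂ) (K : Kernel) :
    rightMul m (twist z K) = Complex.exp (((m : ℂ) + 1 / 2) * z) • twist z (rightMul m K) := by
  funext S T
  rw [Pi.smul_apply, Pi.smul_apply, smul_eq_mul]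
  obtain ⟨j, rfl | rfl⟩ := exists_mode m
  · simp only [rightMul_natCast_apply, twist, parityConj]
    split_ifs with h
    · rw [cast_deg_erase h, ← mul_assoc (Complex.exp _), ← Complex.exp_add, mul_left_comm (_ ^ _),
        mul_left_comm (orderSign _ _)]
      congr 2
      push_cast; ring
    · simp
  · simp only [rightMul_neg_apply, twist, parityConj]
    split_ifs with h
    · simp
    · rw [cast_deg_insert h, ← mul_assoc (Complex.exp _), ← Complex.exp_add, mul_left_comm (_ ^ _),
        mul_left_comm (orderSign _ _)]
      congr 2
      push_cast; ring

lemma twist_add (z : ℂ) (K K' : Kernel) : twist z (K + K') = twist z K + twist z K' := by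
  funext S T; exact mul_add _ _ _

lemma twist_sub (z : ℂ) (K K' : Kernel) : twist z (K - K') = twist z K - twist z K' := by
  funext S T; exact mul_sub _ _ _

lemma twist_smul (z c : ℂ) (K : Kernel) : twist z (c • K) = c • twist z K := by
  funext S T; exact mul_left_comm _ _ _

lemma twist_list_sum {ι : Type*} (z : ℂ) (l : List ι) (c : ι → ℂ) (K : ι → Kernel) :
    twist z (l.map fun i => c i • K i).sum = (l.map fun i => c i • twist z (K i)).sum := by
  induction l with
  | nil => funext S T; simp [twist]
  | cons i l ih => simp only [List.map_cons, List.sum_cons, twist_add, twist_smul, ih]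

lemma gradedComm_twist (m : ℤ) (z : ℂ) (K : Kernel) :
    gradedComm m (twist z K) = Complex.exp (((m : ℂ) + 1 / 2) * z) • twist z (gradedComm m K) := by
  simp only [gradedComm, LinearMap.sub_apply]
  rw [leftMul_twist, rightMul_twist, twist_sub, smul_sub]

lemma parityConj_twist (z : ℂ) (K : Kernel) : parityConj (twist z K) = twist z (parityConj K) := by
  funext S T; exact mul_left_comm _ _ _

/-! ### The trace -/

lemma summable_torusTrace {θ : ℂ} (hθ : ‖θ‖ = 1) {τ : UpperHalfPlane} {α β : ℝ}
    (h : α < β + Real.pi * τ.im) {K : Kernel} (hK : K ∈ boundedKernels α β) :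
    Summable fun T => traceWeight θ τ T * K T T := by
  apply Summable.of_enorm
  simp only [enorm_mul]
  exact tsum_traceWeight_ne_top hθ τ hK h

lemma torusTrace_add {θ : ℂ} (hθ : ‖θ‖ = 1) {τ : UpperHalfPlane} {α β : ℝ}
    (h : α < β + Real.pi * τ.im) {K K' : Kernel} (hK : K ∈ boundedKernels α β)
    (hK' : K' ∈ boundedKernels α β) :
    torusTrace θ τ (K + K') = torusTrace θ τ K + torusTrace θ τ K' := by
  rw [torusTrace, torusTrace, torusTrace,
    ← (summable_torusTrace hθ h hK).tsum_add (summable_torusTrace hθ h hK')]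
  exact tsum_congr fun T => mul_add _ _ _

lemma torusTrace_smul (θ : ℂ) (τ : UpperHalfPlane) (c : ℂ) (K : Kernel) :
    torusTrace θ τ (c • K) = c * torusTrace θ τ K := by
  rw [torusTrace, torusTrace, ← tsum_mul_left]
  exact tsum_congr fun T => mul_left_comm _ _ _

lemma torusTrace_sub {θ : ℂ} (hθ : ‖θ‖ = 1) {τ : UpperHalfPlane} {α β : ℝ}
    (h : α < β + Real.pi * τ.im) {K K' : Kernel} (hK : K ∈ boundedKernels α β)
    (hK' : K' ∈ boundedKernels α β) :
    torusTrace θ τ (K - K') = torusTrace θ τ K - torusTrace θ τ K' := by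
  rw [torusTrace, torusTrace, torusTrace,
    ← (summable_torusTrace hθ h hK).tsum_sub (summable_torusTrace hθ h hK')]
  exact tsum_congr fun T => mul_sub _ _ _

lemma torusTrace_list_sum {θ : ℂ} (hθ : ‖θ‖ = 1) {τ : UpperHalfPlane} {α β : ℝ}
    (h : α < β + Real.pi * τ.im) {ι : Type*} {l : List ι} {c : ι → ℂ} {K : ι → Kernel}
    (hK : ∀ i ∈ l, K i ∈ boundedKernels α β) :
    torusTrace θ τ (l.map fun i => c i • K i).sum =
      (l.map fun i => c i * torusTrace θ τ (K i)).sum := by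
  induction l with
  | nil => simp [torusTrace]
  | cons i l ih =>
    have h1 : ∀ j ∈ l, K j ∈ boundedKernels α β := fun j hj => hK j (by simp [hj])
    simp only [List.map_cons, List.sum_cons]
    rw [torusTrace_add hθ h (Submodule.smul_mem _ _ (hK i (by simp))) (list_sum_mem h1),
      torusTrace_smul, ih h1]

lemma traceWeight_insert (θ : ℂ) (τ : UpperHalfPlane) {j : ℕ} {T : Finset ℕ} (h : j ∉ T) :
    traceWeight θ τ (insert j T) = -θ * qPow τ ((j : ℂ) + 1 / 2) * traceWeight θ τ T := by
  rw [traceWeight, traceWeight, Finset.prod_insert h]; ring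

/-- Cyclicity of the trace for a fermionic mode. -/
lemma torusTrace_rightMul {θ : ℂ} (hθ : θ = 1 ∨ θ = -1) (τ : UpperHalfPlane) (m : ℤ) (K : Kernel) :
    torusTrace θ τ (rightMul m K) =
      θ * qPow τ ((m : ℂ) + 1 / 2) * torusTrace θ τ (leftMul m K) := by
  rw [torusTrace, torusTrace, ← tsum_mul_left]
  have hs : ∀ T : Finset ℕ, (-1 : ℂ) ^ T.card * (-1) ^ T.card = 1 := fun T => by
    rw [← mul_pow]; simp
  obtain ⟨j, rfl | rfl⟩ := exists_mode m
  -- Reindexing by `toggle j` matches the diagonal entries on the two sides term by term, without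
  -- any summability. The factor is the ratio of the trace weights with and without level `j`; the
  -- parity conjugation turns its sign.
  · rw [← (toggleEquiv j).tsum_eq]
    refine tsum_congr fun T => ?_
    change traceWeight θ τ (toggle j T) * rightMul j K (toggle j T) (toggle j T) = _
    rw [rightMul_natCast_apply, leftMul_natCast_apply]
    simp only [mem_toggle_self]
    by_cases h : j ∈ T
    · simp [h]
    · rw [if_pos h, if_neg h, orderSign_toggle_self, toggle_of_notMem h, Finset.erase_insert h,
        traceWeight_insert θ τ h, parityConj, Finset.card_insert_of_notMem h, Int.cast_natCast,
        pow_add, pow_succ]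
      linear_combination (θ * qPow τ ((j : ℂ) + 1 / 2) * traceWeight θ τ T * orderSign j T *
        K (insert j T) T) * hs T
  · rw [← (toggleEquiv j).tsum_eq]
    refine tsum_congr fun T => ?_
    change traceWeight θ τ (toggle j T) * rightMul (-(j : ℤ) - 1) K (toggle j T) (toggle j T) = _
    rw [rightMul_neg_apply, leftMul_neg_apply]
    simp only [mem_toggle_self]
    by_cases h : j ∈ T
    · have h1 : j ∉ T.erase j := by simp
      have h2 := traceWeight_insert θ τ h1
      rw [Finset.insert_erase h] at h2
      have h3 : (-1 : ℂ) ^ T.card = (-1) ^ (T.erase j).card * -1 := by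
        rw [← Finset.card_erase_add_one h, pow_succ]
      rw [if_neg (not_not.mpr h), if_pos h, orderSign_toggle_self, toggle_of_mem h,
        Finset.insert_erase h, h2, parityConj, neg_mode_cast, qPow_neg, pow_add, h3]
      have h4 := qPow_ne_zero τ ((j : ℂ) + 1 / 2)
      have h5 := mul_inv_cancel₀ h4
      linear_combination (-(traceWeight θ τ (T.erase j) * orderSign j T * K (T.erase j) T)) *
        hs (T.erase j) + θ * θ * (traceWeight θ τ (T.erase j) * orderSign j T * K (T.erase j) T) *
        h5 + (traceWeight θ τ (T.erase j) * orderSign j T * K (T.erase j) T) * theta_mul_self hθ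
    · simp [h]

/-- Solving the cyclicity relation for the trace of `ψ(m) K`; this is where the denominators `1 - θ
q^{m+1/2}` of the elliptic functions arise. -/
lemma torusTrace_leftMul {θ : ℂ} (hθ : θ = 1 ∨ θ = -1) {τ : UpperHalfPlane} {α β : ℝ}
    (h : α < β + Real.pi * τ.im) {K : Kernel} (hK : K ∈ boundedKernels α β) (m : ℤ) :
    torusTrace θ τ (leftMul m K) = modeCoeff θ τ m * torusTrace θ τ (gradedComm m K) := by
  rw [gradedComm, LinearMap.sub_apply, torusTrace_sub (norm_theta_eq hθ) h (leftMul_mem hK m)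
    (rightMul_mem hK m), torusTrace_rightMul hθ, modeCoeff]
  have := modeDenom_ne_zero hθ τ m
  rw [← one_sub_mul, inv_mul_cancel_left₀ this]

end FreeFermion

namespace FreeFermion

open scoped ENNReal

/-! ### The recursion for torus functions -/

/-- The matrix of the product of the vertex operators of `ψ[-p₁-1] ⋯ ψ[-pᵣ-1] 𝟏` at `z`, for
the entries `([p₁, …, pᵣ], z)` of a list. -/
noncomputable def blockProd (L : List (List ℕ × ℂ)) : Kernel :=
  prodKernel (L.map fun b => (vertexKernel (squareVector b.1), b.2))

lemma blockProd_cons (ps : List ℕ) (z : ℂ) (L : List (List ℕ × ℂ)) :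
    blockProd ((ps, z) :: L) = kernelMul (twist z (vertexKernel (squareVector ps))) (blockProd L) :=
  rfl

/-- The signed ways to remove one fermion from a list of blocks. -/
noncomputable def blockRemovals :
    List (List ℕ × ℂ) → List (ℂ × (ℕ × ℂ) × List (List ℕ × ℂ))
  | [] => []
  | (ps, z) :: L => ((removals ps).map fun r => (r.1, (r.2.1, z), (r.2.2, z) :: L)) ++
      (blockRemovals L).map fun r => ((-1) ^ ps.length * r.1, r.2.1, (ps, z) :: r.2.2)

lemma of_mem_blockRemovals {L : List (List ℕ × ℂ)} {r : ℂ × (ℕ × ℂ) × List (List ℕ × ℂ)}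
    (h : r ∈ blockRemovals L) :
    r.2.1.2 ∈ L.map Prod.snd ∧ r.2.2.map Prod.snd = L.map Prod.snd := by
  induction L generalizing r with
  | nil => simp [blockRemovals] at h
  | cons b L ih =>
    obtain ⟨ps, z⟩ := b
    simp only [blockRemovals, List.mem_append, List.mem_map] at h
    rcases h with ⟨r', -, rfl⟩ | ⟨r', h', rfl⟩
    · simp
    · obtain ⟨h1, h2⟩ := ih h'
      exact ⟨by rw [List.map_cons]; exact List.mem_cons_of_mem _ h1, by simp [h2]⟩

/-- Insertion points in decreasing order with half real parts in an interval `(β, α)`. -/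
structure IsAdmissible (α β : ℝ) (zs : List ℂ) : Prop where
  lt : β < α
  ordered : zs.Pairwise fun x y => y.re < x.re
  bound : ∀ x ∈ zs, β < x.re / 2 ∧ x.re / 2 < α

lemma blockProd_mem {α β : ℝ} {L : List (List ℕ × ℂ)} (h : IsAdmissible α β (L.map Prod.snd)) :
    blockProd L ∈ boundedKernels α β := by
  refine isBddKernel_prodKernel _ ?_ ?_ h.lt ?_ ?_
  · simp only [List.mem_map]
    rintro x ⟨b, -, rfl⟩
    exact isSubexpKernel_vertexKernel _
  · have := h.ordered
    rw [List.pairwise_map] at this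
    exact List.pairwise_map.mpr this
  · simp only [List.mem_map]
    rintro x ⟨b, hb, rfl⟩
    exact (h.bound _ (List.mem_map_of_mem hb)).2
  · simp only [List.mem_map]
    rintro x ⟨b, hb, rfl⟩
    exact (h.bound _ (List.mem_map_of_mem hb)).1

lemma IsAdmissible.exists_split {α β : ℝ} {z : ℂ} {zs : List ℂ} (h : IsAdmissible α β (z :: zs)) :
    ∃ γ γ' : ℝ, IsAdmissible γ β zs ∧ γ < γ' ∧ γ' < z.re / 2 ∧ z.re / 2 < α := by
  obtain ⟨h1, h2⟩ := List.pairwise_cons.mp h.ordered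
  obtain ⟨γ, γ', h3, h4, h5, h6⟩ := exists_gap (fun i : Fin zs.length => (zs.get i).re / 2)
    (β := β) (x := z.re / 2) (fun i => by have := h1 _ (zs.get_mem i); linarith)
    (h.bound z (by simp)).1
  refine ⟨γ, γ', ⟨h4, h2, fun y hy => ⟨(h.bound y (by simp [hy])).1, ?_⟩⟩, h5, h6,
    (h.bound z (by simp)).2⟩
  obtain ⟨i, rfl⟩ := List.get_of_mem hy
  exact h3 i

lemma twist_vertexKernel_mem (v : Fock) {z : ℂ} {α β : ℝ} (h1 : β < z.re / 2) (h2 : z.re / 2 < α) :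
    twist z (vertexKernel v) ∈ boundedKernels α β :=
  (isSubexpKernel_vertexKernel v).twist h1 h2

lemma kernelMul_gradedComm_twist {α β γ γ' : ℝ} {z : ℂ} {L : List (List ℕ × ℂ)}
    (hL : IsAdmissible γ β (L.map Prod.snd)) (hγ : γ < γ') (h1 : γ' < z.re / 2)
    (h2 : z.re / 2 < α) (m : ℤ) (ps : List ℕ) :
    kernelMul (gradedComm m (twist z (vertexKernel (squareVector ps)))) (blockProd L) =
      ((removals ps).map fun r => (r.1 * (modeWeight r.2.1 m * Complex.exp (((m : ℂ) + 1 / 2) * z))) •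
        blockProd ((r.2.2, z) :: L)).sum := by
  rw [gradedComm_twist, gradedComm_vertexKernel_squareVector, twist_list_sum, kernelMul_smul_left,
    kernelMul_list_sum_left (fun r _ => twist_vertexKernel_mem _ h1 h2) (blockProd_mem hL) hγ,
    List.smul_sum, List.map_map]
  congr 1
  refine List.map_congr_left fun r _ => ?_
  rw [Function.comp, smul_smul, blockProd_cons]
  congr 1; ring

/-- The super Leibniz rule over all blocks: passing a block costs the sign of its number of
fermions, which is the sign recorded in `blockRemovals`. -/
lemma gradedComm_blockProd {α β : ℝ} {L : List (List ℕ × ℂ)}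
    (h : IsAdmissible α β (L.map Prod.snd)) (m : ℤ) :
    gradedComm m (blockProd L) = ((blockRemovals L).map fun r =>
      (r.1 * (modeWeight r.2.1.1 m * Complex.exp (((m : ℂ) + 1 / 2) * r.2.1.2))) •
        blockProd r.2.2).sum := by
  induction L generalizing α with
  | nil => exact gradedComm_idKernel m
  | cons b L ih =>
    obtain ⟨ps, z⟩ := b
    obtain ⟨γ, γ', hL, hγ, h1, h2⟩ := h.exists_split
    rw [blockProd_cons, gradedComm_kernelMul (twist_vertexKernel_mem _ h1 h2) (blockProd_mem hL) hγ,
      kernelMul_gradedComm_twist hL hγ h1 h2, ih hL, parityConj_twist,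
      parityConj_vertexKernel_squareVector, twist_smul, kernelMul_smul_left,
      kernelMul_list_sum_right (twist_vertexKernel_mem _ h1 h2) (fun r hr => blockProd_mem (by
        rw [(of_mem_blockRemovals hr).2]; exact hL)) hγ,
      blockRemovals, List.map_append, List.sum_append, List.map_map, List.map_map, List.smul_sum,
      List.map_map]
    congr 2
    refine List.map_congr_left fun r _ => ?_
    rw [Function.comp, Function.comp, smul_smul, blockProd_cons]
    congr 1; ring

/-- Exchanges the sum over the modes of the leftmost field with the matrix product and the trace, by
absolute summability of the joint family. -/
lemma hasSum_torusTrace_kernelMul {θ : ℂ} (hθ : ‖θ‖ = 1) {τ : UpperHalfPlane} {α β γ γ' : ℝ}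
    (h : α < β + Real.pi * τ.im) {N : ℕ → Kernel} {P : Kernel}
    (hN : IsBddKernel α γ' fun S T => ∑' j, ‖N j S T‖ₑ) (hP : P ∈ boundedKernels γ β)
    (hγ : γ < γ') : HasSum (fun j => torusTrace θ τ (kernelMul (N j) P))
      (torusTrace θ τ (kernelMul (fun S T => ∑' j, N j S T) P)) := by
  let F : (Finset ℕ × Finset ℕ) × ℕ → ℂ := fun q =>
    traceWeight θ τ q.1.1 * (N q.2 q.1.1 q.1.2 * P q.1.2 q.1.1)
  have hs : Summable F := by
    apply Summable.of_enorm
    rw [ENNReal.tsum_prod (f := fun (x : Finset ℕ × Finset ℕ) j =>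
        ‖traceWeight θ τ x.1 * (N j x.1 x.2 * P x.2 x.1)‖ₑ),
      ENNReal.tsum_prod (f := fun T U => ∑' j, ‖traceWeight θ τ T * (N j T U * P U T)‖ₑ)]
    simp only [enorm_mul, ENNReal.tsum_mul_left, ENNReal.tsum_mul_right]
    exact tsum_traceWeight_ne_top hθ τ (hN.comp hP hγ) h
  have e : torusTrace θ τ (kernelMul (fun S T => ∑' j, N j S T) P) = ∑' q, F q := by
    rw [hs.tsum_prod, hs.prod.tsum_prod]
    refine tsum_congr fun T => ?_
    rw [kernelMul, ← tsum_mul_left]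
    refine tsum_congr fun U => ?_
    simp only [F]
    rw [tsum_mul_left, tsum_mul_right]
  have hs' : Summable (F ∘ Equiv.prodComm ℕ (Finset ℕ × Finset ℕ)) :=
    (Equiv.prodComm _ _).summable_iff.mpr hs
  rw [e, ← (Equiv.prodComm ℕ (Finset ℕ × Finset ℕ)).tsum_eq]
  refine hs'.hasSum.prod_fiberwise fun j => ?_
  have hj := hs'.prod_factor j
  have : torusTrace θ τ (kernelMul (N j) P) =
      ∑' x, (F ∘ Equiv.prodComm ℕ (Finset ℕ × Finset ℕ)) (j, x) := by
    rw [hj.tsum_prod]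
    refine tsum_congr fun T => ?_
    rw [kernelMul, ← tsum_mul_left]
    rfl
  rw [this]
  exact hj.hasSum

/-- The entry of the Pfaffian pairing two fermions. -/
noncomputable def pairEntry (θ : ℂ) (τ : UpperHalfPlane) (x y : ℕ × ℂ) : ℂ :=
  if x.2 = y.2 then coeffC θ (1 / 2) (x.1 + 1) (y.1 + 1) τ
  else coeffD θ (1 / 2) (x.1 + 1) (y.1 + 1) τ (x.2 - y.2)

lemma choose_div_factorial (p r : ℕ) :
    (((p + r).choose p : ℕ) : ℂ) / ((p + r).factorial : ℂ) =
      1 / ((p.factorial : ℂ) * r.factorial) := by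
  have h := Nat.add_choose_mul_factorial_mul_factorial p r
  rw [← Nat.choose_symm_add] at h
  have h' : (((p + r).choose p : ℕ) : ℂ) * p.factorial * r.factorial = (p + r).factorial := by
    exact_mod_cast h
  have h1 : (p.factorial : ℂ) ≠ 0 := by exact_mod_cast p.factorial_ne_zero
  have h2 : (r.factorial : ℂ) ≠ 0 := by exact_mod_cast r.factorial_ne_zero
  have h3 : ((p + r).factorial : ℂ) ≠ 0 := by exact_mod_cast (p + r).factorial_ne_zero
  rw [div_eq_div_iff h3 (mul_ne_zero h1 h2)]
  linear_combination h'

lemma modeWeight_mul (p r : ℕ) (m : ℤ) : modeWeight p m * modeWeight r m =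
    (((p + r).choose p : ℕ) : ℂ) / ((p + r).factorial : ℂ) * ((m : ℂ) + 1 / 2) ^ (p + r) := by
  rw [choose_div_factorial, modeWeight, modeWeight, pow_add]
  ring

/-- Pairings inside one block carry no exponentials. The `-1` comes from moving `ψ(j)` across its
own block; it removes the divergent part of the mode sum, and what is left is the Lambert part of
the Eisenstein series. The Bernoulli part of `C` is the contraction. -/
lemma hasSum_coeffC {θ : ℂ} (hθ : θ = 1 ∨ θ = -1) (τ : UpperHalfPlane) (p r : ℕ) :
    HasSum (fun j : ℕ => modeWeight p j * modeCoeff θ τ (-(j : ℤ) - 1) * modeWeight r (-(j : ℤ) - 1) +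
        modeWeight p (-(j : ℤ) - 1) * (modeCoeff θ τ j - 1) * modeWeight r j)
      (coeffC θ (1 / 2) (p + 1) (r + 1) τ - contraction (p + 1) r) := by
  have hs := (summable_half_exp_lambert hθ τ (p + r) (z := 0) (by simpa using two_pi_im_pos τ)).of_norm
  simp only [mul_zero, Complex.exp_zero, mul_one] at hs
  have hsgn : (-1 : ℂ) ^ r * (-1) ^ r = 1 := by rw [← mul_pow]; simp
  have h := hs.hasSum.mul_left (((-1) ^ p - (-1) ^ r) * ((((p + r).choose p : ℕ) : ℂ) /
    ((p + r).factorial : ℂ)))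
  suffices hv : coeffC θ (1 / 2) (p + 1) (r + 1) τ - contraction (p + 1) r = _ by
    rw [hv]
    refine h.congr_fun fun j => ?_
    rw [modeCoeff_neg hθ, modeCoeff_natCast hθ, modeWeight_neg, modeWeight_neg]
    have := modeWeight_mul p r j
    rw [Int.cast_natCast] at this
    linear_combination (((-1) ^ p - (-1) ^ r) * lambertCoeff θ τ j) * this
  rw [coeffC, show p + 1 + (r + 1) - 2 = p + r by omega,
    show p + 1 + (r + 1) - 1 = p + r + 1 by omega, Nat.add_sub_cancel, twistedEisenstein_half hθ,
    contraction_eq, ← Nat.choose_symm_add]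
  rw [pow_succ, pow_add]
  linear_combination (-(((p + r).choose p : ℕ) : ℂ) / ((p + r).factorial : ℂ) * (-1) ^ p *
      (-∑' j : ℕ, ((j : ℂ) + 1 / 2) ^ (p + r) * lambertCoeff θ τ j)) * hsgn

/-- The terms `j` and `-j-1` together run through the bilateral series of `P_{p+r+1}` at `w - z`,
where it converges; parity of the Weierstrass function moves it to `z - w`. -/
lemma hasSum_coeffD {θ : ℂ} (hθ : θ = 1 ∨ θ = -1) {τ : UpperHalfPlane} (p r : ℕ) {z w : ℂ}
    (h : w - z ∈ leftStrip τ) :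
    HasSum (fun j : ℕ => modeWeight p j * Complex.exp (((j : ℂ) + 1 / 2) * z) *
          modeCoeff θ τ (-(j : ℤ) - 1) *
          (modeWeight r (-(j : ℤ) - 1) * Complex.exp (((-(j : ℤ) - 1 : ℤ) + 1 / 2) * w)) +
        modeWeight p (-(j : ℤ) - 1) * Complex.exp (-(((j : ℂ) + 1 / 2) * z)) * modeCoeff θ τ j *
          (modeWeight r j * Complex.exp (((j : ℂ) + 1 / 2) * w)))
      (coeffD θ (1 / 2) (p + 1) (r + 1) τ (z - w)) := by
  have hs := (summable_norm_modeTerm hθ (p + r) h).of_norm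
  have h1 := hs.hasSum.mul_left ((-1) ^ p * ((((p + r).choose p : ℕ) : ℂ) /
    ((p + r).factorial : ℂ)))
  have h2 := h1.nat_add_neg_add_one
  suffices hv : coeffD θ (1 / 2) (p + 1) (r + 1) τ (z - w) = _ by
    rw [hv]
    refine h2.congr_fun fun j => ?_
    have e := modeWeight_mul p r j
    have e' := modeWeight_mul p r (-(j : ℤ) - 1)
    rw [show -((j : ℤ) + 1) = -(j : ℤ) - 1 by ring, modeTerm, modeTerm, neg_mode_cast,
      modeWeight_neg p]
    rw [neg_mode_cast, modeWeight_neg p] at e'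
    rw [Int.cast_natCast] at e ⊢
    have h3 : Complex.exp (((j : ℂ) + 1 / 2) * (w - z)) =
        Complex.exp (-(((j : ℂ) + 1 / 2) * z)) * Complex.exp (((j : ℂ) + 1 / 2) * w) := by
      rw [← Complex.exp_add]; congr 1; ring
    have h4 : Complex.exp (-((j : ℂ) + 1 / 2) * (w - z)) =
        Complex.exp (((j : ℂ) + 1 / 2) * z) * Complex.exp (-((j : ℂ) + 1 / 2) * w) := by
      rw [← Complex.exp_add]; congr 1; ring
    rw [h3, h4]
    have hsgn : (-1 : ℂ) ^ p * (-1) ^ p = 1 := by rw [← mul_pow]; simp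
    linear_combination ((-1) ^ p * Complex.exp (-(((j : ℂ) + 1 / 2) * z)) *
      Complex.exp (((j : ℂ) + 1 / 2) * w) * modeCoeff θ τ j) * e +
      ((-1) ^ p * Complex.exp (((j : ℂ) + 1 / 2) * z) *
      Complex.exp (-((j : ℂ) + 1 / 2) * w) * modeCoeff θ τ (-(j : ℤ) - 1)) * e' -
      (modeWeight p j * modeWeight r (-(j : ℤ) - 1) * Complex.exp (((j : ℂ) + 1 / 2) * z) *
      Complex.exp (-((j : ℂ) + 1 / 2) * w) * modeCoeff θ τ (-(j : ℤ) - 1)) * hsgn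
  rw [coeffD, show p + 1 + (r + 1) - 2 = p + r by omega,
    show p + 1 + (r + 1) - 1 = p + r + 1 by omega, Nat.add_sub_cancel, ← neg_sub w z,
    twistedWeierstrass_neg hθ _ (leftStrip_subset τ h),
    twistedWeierstrass_eq hθ _ (leftStrip_subset τ h), weierstrass_eq hθ _ h,
    twistedSeries_half hθ]
  have hsgn : (-1 : ℂ) ^ (p + r + 1) * (-1) ^ (p + r + 1) = 1 := by rw [← mul_pow]; simp
  rw [pow_succ (-1 : ℂ) (p + 1), pow_succ (-1 : ℂ) p]
  linear_combination ((-1) ^ p * (((p + r).choose p : ℕ) : ℂ) / ((p + r).factorial : ℂ) *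
      ∑' m, modeTerm θ τ (p + r) m (w - z)) * hsgn

/-- The contribution of the modes `ψ(-j-1)` and `ψ(j)` to a twisted normally ordered product. -/
noncomputable def normalTerm (p : ℕ) (z : ℂ) (A : Kernel) (j : ℕ) : Kernel :=
  (modeWeight p j * Complex.exp (((j : ℂ) + 1 / 2) * z)) • leftMul (-(j : ℤ) - 1) A +
    (modeWeight p (-(j : ℤ) - 1) * Complex.exp (-(((j : ℂ) + 1 / 2) * z))) • rightMul j A

lemma normalTerm_twist (p : ℕ) (z : ℂ) (K : Kernel) (j : ℕ) (S T : Finset ℕ) :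
    normalTerm p z (twist z K) j S T = Complex.exp (((deg S : ℂ) - deg T) / 2 * z) *
      (modeWeight p j * leftMul (-(j : ℤ) - 1) K S T +
        modeWeight p (-(j : ℤ) - 1) * rightMul j K S T) := by
  have h : Complex.exp (((j : ℂ) + 1 / 2) * z) * Complex.exp (-(((j : ℂ) + 1 / 2) * z)) = 1 := by
    rw [← Complex.exp_add, add_neg_cancel, Complex.exp_zero]
  rw [normalTerm, leftMul_twist, rightMul_twist, neg_mode_cast, Int.cast_natCast]
  simp only [Pi.add_apply, Pi.smul_apply, smul_eq_mul, twist, neg_mul]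
  linear_combination (Complex.exp (((deg S : ℂ) - deg T) / 2 * z) *
    (modeWeight p j * leftMul (-(j : ℤ) - 1) K S T +
      modeWeight p (-(j : ℤ) - 1) * rightMul j K S T)) * h

lemma twist_normalOp (p : ℕ) (z : ℂ) (K : Kernel) : twist z (normalOp (modeWeight p) K) =
    fun S T => ∑' j, normalTerm p z (twist z K) j S T := by
  funext S T
  simp only [normalTerm_twist]
  rw [tsum_mul_left, twist, normalOp]
  congr 1
  have s1 : HasSum (fun j : ℕ => modeWeight p j * leftMul (-(j : ℤ) - 1) K S T)
      (∑ j ∈ S, modeWeight p j * leftMul (-(j : ℤ) - 1) K S T) :=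
    hasSum_sum_of_ne_finset_zero fun j hj => by rw [leftMul_neg_apply, if_neg hj, mul_zero]
  have s2 : HasSum (fun j : ℕ => modeWeight p (-(j : ℤ) - 1) * rightMul j K S T)
      (∑ j ∈ T, modeWeight p (-(j : ℤ) - 1) * rightMul j K S T) :=
    hasSum_sum_of_ne_finset_zero fun j hj => by rw [rightMul_natCast_apply, if_neg hj, mul_zero]
  exact (s1.add s2).tsum_eq.symm

lemma isBddKernel_normalTerm (p : ℕ) {z : ℂ} {α β : ℝ} {K : Kernel} (hK : IsSubexpKernel K)
    (h1 : β < z.re / 2) (h2 : z.re / 2 < α) :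
    IsBddKernel α β fun S T => ∑' j, ‖normalTerm p z (twist z K) j S T‖ₑ := by
  refine (isBddKernel_twist ((isSubexp_leftMul (isSubexpWeight_modeWeight p) hK).add
    (isSubexp_rightMul (isSubexpWeight_modeWeight_neg p) hK)) h1 h2).mono fun S T => ?_
  rw [← ENNReal.tsum_add, ← ENNReal.tsum_mul_left]
  refine ENNReal.tsum_le_tsum fun j => ?_
  rw [normalTerm_twist, enorm_mul]
  exact mul_le_mul_right (enorm_add_le _ _) _

lemma hasSum_list_sum {ι : Type*} {l : List ι} {f : ι → ℕ → ℂ} {a : ι → ℂ}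
    (h : ∀ i ∈ l, HasSum (f i) (a i)) :
    HasSum (fun j => (l.map fun i => f i j).sum) (l.map a).sum := by
  induction l with
  | nil => simp
  | cons i l ih =>
    simp only [List.map_cons, List.sum_cons]
    exact (h i (by simp)).add (ih fun k hk => h k (by simp [hk]))

/-- The torus function of a list of blocks. -/
noncomputable def blockTrace (θ : ℂ) (τ : UpperHalfPlane) (L : List (List ℕ × ℂ)) : ℂ :=
  torusTrace θ τ (blockProd L)

/-- The creation mode already stands leftmost. The annihilation mode stands to the right of `A` and
is brought to the front as `ψ(j)A - [ψ(j), A]`, which produces the correction term. Cyclicity then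
applies to both. -/
lemma torusTrace_normalTerm {θ : ℂ} (hθ : θ = 1 ∨ θ = -1) {τ : UpperHalfPlane} {α β γ γ' : ℝ}
    (hαβ : α < β + Real.pi * τ.im) {z : ℂ} {A P : Kernel} (hA : A ∈ boundedKernels α γ')
    (hP : P ∈ boundedKernels γ β) (hγ : γ < γ') (p j : ℕ) :
    torusTrace θ τ (kernelMul (normalTerm p z A j) P) =
      modeWeight p j * Complex.exp (((j : ℂ) + 1 / 2) * z) * (modeCoeff θ τ (-(j : ℤ) - 1) *
        torusTrace θ τ (gradedComm (-(j : ℤ) - 1) (kernelMul A P))) +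
      modeWeight p (-(j : ℤ) - 1) * Complex.exp (-(((j : ℂ) + 1 / 2) * z)) * (modeCoeff θ τ j *
        torusTrace θ τ (gradedComm j (kernelMul A P)) -
          torusTrace θ τ (kernelMul (gradedComm j A) P)) := by
  have hAP := kernelMul_mem hA hP hγ
  rw [normalTerm, kernelMul_add_left (Submodule.smul_mem _ _ (leftMul_mem hA _))
    (Submodule.smul_mem _ _ (rightMul_mem hA _)) hP hγ, kernelMul_smul_left, kernelMul_smul_left,
    torusTrace_add (norm_theta_eq hθ) hαβ
      (Submodule.smul_mem _ _ (kernelMul_mem (leftMul_mem hA _) hP hγ))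
      (Submodule.smul_mem _ _ (kernelMul_mem (rightMul_mem hA _) hP hγ)), torusTrace_smul,
    torusTrace_smul, ← leftMul_kernelMul, torusTrace_leftMul hθ hαβ hAP]
  have h : kernelMul (rightMul j A) P =
      leftMul j (kernelMul A P) - kernelMul (gradedComm j A) P := by
    rw [gradedComm, LinearMap.sub_apply,
      kernelMul_sub_left (leftMul_mem hA j) (rightMul_mem hA j) hP hγ, leftMul_kernelMul,
      sub_sub_cancel]
  rw [h, torusTrace_sub (norm_theta_eq hθ) hαβ (leftMul_mem hAP _)
    (kernelMul_mem (gradedComm_mem hA _) hP hγ), torusTrace_leftMul hθ hαβ hAP]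

lemma torusTrace_gradedComm {θ : ℂ} (hθ : ‖θ‖ = 1) {τ : UpperHalfPlane} {α β : ℝ}
    (hαβ : α < β + Real.pi * τ.im) {L : List (List ℕ × ℂ)}
    (h : IsAdmissible α β (L.map Prod.snd)) (m : ℤ) :
    torusTrace θ τ (gradedComm m (blockProd L)) = ((blockRemovals L).map fun r =>
      (r.1 * (modeWeight r.2.1.1 m * Complex.exp (((m : ℂ) + 1 / 2) * r.2.1.2))) *
        blockTrace θ τ r.2.2).sum := by
  rw [gradedComm_blockProd h, torusTrace_list_sum hθ hαβ fun r hr => blockProd_mem (by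
    rw [(of_mem_blockRemovals hr).2]; exact h)]
  rfl

/-- Pure bookkeeping, with `D` and `D'` standing for the cyclicity factors of the modes `-j-1` and
`j`. It regroups a mode's contribution by removed fermion: `l` for the same block, where the
exponentials cancel, `l'` for the other blocks. -/
lemma normalTerm_coeff {ι κ : Type*} (l : List ι) (l' : List κ) (j p : ℕ) (z D D' : ℂ)
    (s : ι → ℂ) (q : ι → ℕ) (F : ι → ℂ) (s' : κ → ℂ) (q' : κ → ℕ) (w : κ → ℂ) (F' : κ → ℂ) :
    (l.map fun r => s r * F r * (modeWeight p j * D * modeWeight (q r) (-(j : ℤ) - 1) +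
        modeWeight p (-(j : ℤ) - 1) * (D' - 1) * modeWeight (q r) j)).sum +
      (l'.map fun r => s' r * F' r *
        (modeWeight p j * Complex.exp (((j : ℂ) + 1 / 2) * z) * D *
          (modeWeight (q' r) (-(j : ℤ) - 1) * Complex.exp (((-(j : ℤ) - 1 : ℤ) + 1 / 2) * w r)) +
        modeWeight p (-(j : ℤ) - 1) * Complex.exp (-(((j : ℂ) + 1 / 2) * z)) * D' *
          (modeWeight (q' r) j * Complex.exp (((j : ℂ) + 1 / 2) * w r)))).sum =
    modeWeight p j * Complex.exp (((j : ℂ) + 1 / 2) * z) * (D *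
      ((l.map fun r => (s r * (modeWeight (q r) (-(j : ℤ) - 1) *
        Complex.exp (((-(j : ℤ) - 1 : ℤ) + 1 / 2) * z))) * F r).sum +
      (l'.map fun r => (s' r * (modeWeight (q' r) (-(j : ℤ) - 1) *
        Complex.exp (((-(j : ℤ) - 1 : ℤ) + 1 / 2) * w r))) * F' r).sum)) +
    modeWeight p (-(j : ℤ) - 1) * Complex.exp (-(((j : ℂ) + 1 / 2) * z)) * (D' *
      ((l.map fun r => (s r * (modeWeight (q r) j * Complex.exp (((j : ℂ) + 1 / 2) * z))) *
          F r).sum +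
        (l'.map fun r => (s' r * (modeWeight (q' r) j *
          Complex.exp (((j : ℂ) + 1 / 2) * w r))) * F' r).sum) -
      (l.map fun r => (s r * (modeWeight (q r) j * Complex.exp (((j : ℂ) + 1 / 2) * z))) *
        F r).sum) := by
  have hexp : Complex.exp (((j : ℂ) + 1 / 2) * z) * Complex.exp (-(((j : ℂ) + 1 / 2) * z)) = 1 := by
    rw [← Complex.exp_add, add_neg_cancel, Complex.exp_zero]
  have split : ∀ a b D D' X₁ X₂ Y₁ Y₂ Z : ℂ, a * (D * (X₁ + X₂)) + b * (D' * (Y₁ + Y₂) - Z) =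
    (a * D * X₁ + b * D' * Y₁ + -b * Z) + (a * D * X₂ + b * D' * Y₂) := by intros; ring
  rw [split]
  congr 1
  · simp only [← List.sum_map_mul_left, ← List.sum_map_add]
    congr 1
    refine List.map_congr_left fun r _ => ?_
    rw [neg_mode_cast, neg_mul]
    linear_combination (-(s r * F r * (modeWeight p j * D * modeWeight (q r) (-(j : ℤ) - 1) +
      modeWeight p (-(j : ℤ) - 1) * (D' - 1) * modeWeight (q r) j))) * hexp
  · simp only [← List.sum_map_mul_left, ← List.sum_map_add]
    congr 1
    refine List.map_congr_left fun r _ => ?_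
    ring

lemma torusTrace_gradedComm_cons {θ : ℂ} (hθ : ‖θ‖ = 1) {τ : UpperHalfPlane} {α β : ℝ}
    (hαβ : α < β + Real.pi * τ.im) {ps : List ℕ} {z : ℂ} {L : List (List ℕ × ℂ)}
    (h : IsAdmissible α β (z :: L.map Prod.snd)) (m : ℤ) :
    torusTrace θ τ (gradedComm m (blockProd ((ps, z) :: L))) =
      ((removals ps).map fun r => (r.1 * (modeWeight r.2.1 m *
        Complex.exp (((m : ℂ) + 1 / 2) * z))) * blockTrace θ τ ((r.2.2, z) :: L)).sum +
      ((blockRemovals L).map fun r => ((-1) ^ ps.length * r.1 * (modeWeight r.2.1.1 m *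
        Complex.exp (((m : ℂ) + 1 / 2) * r.2.1.2))) * blockTrace θ τ ((ps, z) :: r.2.2)).sum := by
  rw [torusTrace_gradedComm hθ hαβ (L := (ps, z) :: L) h, blockRemovals, List.map_append,
    List.sum_append, List.map_map, List.map_map]
  rfl

lemma torusTrace_kernelMul_gradedComm {θ : ℂ} (hθ : ‖θ‖ = 1) {τ : UpperHalfPlane} {α β : ℝ}
    (hαβ : α < β + Real.pi * τ.im) {ps : List ℕ} {z : ℂ} {L : List (List ℕ × ℂ)}
    (h : IsAdmissible α β (z :: L.map Prod.snd)) (m : ℤ) :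
    torusTrace θ τ (kernelMul (gradedComm m (twist z (vertexKernel (squareVector ps))))
        (blockProd L)) =
      ((removals ps).map fun r => (r.1 * (modeWeight r.2.1 m *
        Complex.exp (((m : ℂ) + 1 / 2) * z))) * blockTrace θ τ ((r.2.2, z) :: L)).sum := by
  obtain ⟨γ, γ', hL, hγ, h1, h2⟩ := h.exists_split
  rw [kernelMul_gradedComm_twist hL hγ h1 h2, torusTrace_list_sum hθ hαβ
    fun r hr => blockProd_mem (L := (r.2.2, z) :: L) h]
  rfl

lemma IsAdmissible.sub_mem_leftStrip {τ : UpperHalfPlane} {α β : ℝ}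
    (hαβ : α < β + Real.pi * τ.im) {z : ℂ} {zs : List ℂ} (h : IsAdmissible α β (z :: zs)) {w : ℂ}
    (hw : w ∈ zs) : w - z ∈ leftStrip τ := by
  have h1 := (List.pairwise_cons.mp h.ordered).1 _ hw
  have h2 := h.bound w (by simp [hw])
  have h3 := h.bound z (by simp)
  constructor
  · rw [Complex.sub_re]; linarith
  · rw [Complex.sub_re]; linarith

lemma torusTrace_normalOp {θ : ℂ} (hθ : θ = 1 ∨ θ = -1) {τ : UpperHalfPlane} {α β : ℝ}
    (hαβ : α < β + Real.pi * τ.im) {p : ℕ} {ps : List ℕ} {z : ℂ} {L : List (List ℕ × ℂ)}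
    (h : IsAdmissible α β (z :: L.map Prod.snd)) :
    torusTrace θ τ (kernelMul (twist z (normalOp (modeWeight p) (vertexKernel (squareVector ps))))
        (blockProd L)) =
      ((removals ps).map fun r => r.1 * blockTrace θ τ ((r.2.2, z) :: L) *
        (coeffC θ (1 / 2) (p + 1) (r.2.1 + 1) τ - contraction (p + 1) r.2.1)).sum +
      ((blockRemovals L).map fun r => (-1) ^ ps.length * r.1 * blockTrace θ τ ((ps, z) :: r.2.2) *
        coeffD θ (1 / 2) (p + 1) (r.2.1.1 + 1) τ (z - r.2.1.2)).sum := by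
  have hn := norm_theta_eq hθ
  obtain ⟨γ, γ', hL, hγ, h1, h2⟩ := h.exists_split
  have hP := blockProd_mem hL
  have hA := twist_vertexKernel_mem (squareVector ps) h1 h2
  have hsum := hasSum_torusTrace_kernelMul hn hαβ
    (isBddKernel_normalTerm p (isSubexpKernel_vertexKernel (squareVector ps)) h1 h2) hP hγ
  rw [← twist_normalOp] at hsum
  have hsum' := (hasSum_list_sum fun r (_ : r ∈ removals ps) =>
      (hasSum_coeffC hθ τ p r.2.1).mul_left (r.1 * blockTrace θ τ ((r.2.2, z) :: L))).add
    (hasSum_list_sum fun r (hr : r ∈ blockRemovals L) => (hasSum_coeffD hθ p r.2.1.1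
      (h.sub_mem_leftStrip hαβ (of_mem_blockRemovals hr).1)).mul_left
        ((-1) ^ ps.length * r.1 * blockTrace θ τ ((ps, z) :: r.2.2)))
  refine hsum.unique (hsum'.congr_fun fun j => ?_)
  rw [torusTrace_normalTerm hθ hαβ hA hP hγ, ← blockProd_cons, torusTrace_gradedComm_cons hn hαβ h,
    torusTrace_gradedComm_cons hn hαβ h, torusTrace_kernelMul_gradedComm hn hαβ h]
  simp only [Int.cast_natCast]
  exact (normalTerm_coeff (removals ps) (blockRemovals L) j p z _ _ (fun r => r.1)
    (fun r => r.2.1) _ (fun r => (-1) ^ ps.length * r.1) (fun r => r.2.1.1) (fun r => r.2.1.2)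
    _).symm

/-- The recursion for torus functions. -/
theorem blockTrace_cons {θ : ℂ} (hθ : θ = 1 ∨ θ = -1) {τ : UpperHalfPlane} {α β : ℝ}
    (hαβ : α < β + Real.pi * τ.im) {p : ℕ} {ps : List ℕ} {z : ℂ} {L : List (List ℕ × ℂ)}
    (h : IsAdmissible α β (z :: L.map Prod.snd)) :
    blockTrace θ τ ((p :: ps, z) :: L) = ((blockRemovals ((ps, z) :: L)).map fun r =>
      r.1 * pairEntry θ τ (p, z) r.2.1 * blockTrace θ τ r.2.2).sum := by
  have hn := norm_theta_eq hθ
  obtain ⟨γ, γ', hL, hγ, h1, h2⟩ := h.exists_split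
  have hP := blockProd_mem hL
  have hN : twist z (normalOp (modeWeight p) (vertexKernel (squareVector ps))) ∈
      boundedKernels α γ' :=
    (isSubexpKernel_normalOp (isSubexpWeight_modeWeight p) (isSubexpWeight_modeWeight_neg p)
      (isSubexpKernel_vertexKernel _)).twist h1 h2
  have hR : ∀ r ∈ removals ps, kernelMul (twist z (vertexKernel (squareVector r.2.2)))
      (blockProd L) ∈ boundedKernels α β := fun r _ => blockProd_mem (L := (r.2.2, z) :: L) h
  rw [blockTrace, blockProd_cons, vertexKernel_squareVector_cons, twist_add, twist_list_sum,
    kernelMul_add_left hN (list_sum_mem fun r _ => twist_vertexKernel_mem _ h1 h2) hP hγ,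
    kernelMul_list_sum_left (fun r _ => twist_vertexKernel_mem _ h1 h2) hP hγ,
    torusTrace_add hn hαβ (kernelMul_mem hN hP hγ) (list_sum_mem hR),
    torusTrace_list_sum hn hαβ hR, torusTrace_normalOp hθ hαβ h, blockRemovals, List.map_append,
    List.sum_append, List.map_map, List.map_map, add_right_comm, ← List.sum_map_add]
  congr 2
  -- Inside the block the contraction cancels against the one subtracted in `torusTrace_normalOp`,
  -- leaving `C`.
  · refine List.map_congr_left fun r _ => ?_
    rw [Function.comp, pairEntry, if_pos rfl]
    change _ + _ * blockTrace θ τ ((r.2.2, z) :: L) = _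
    ring
  -- The ordering of the real parts guarantees that a fermion of another block sits at a different
  -- point, so `pairEntry` selects `D`.
  · refine List.map_congr_left fun r hr => ?_
    have h3 := (List.pairwise_cons.mp h.ordered).1 _ (of_mem_blockRemovals hr).1
    rw [Function.comp, pairEntry, if_neg fun hz : z = r.2.1.2 => by
      rw [hz] at h3; exact lt_irrefl _ h3]
    ring

end FreeFermion

namespace FreeFermion

/-! ### Pfaffians of lists -/

/-- The Pfaffian of the pairing `A` on a list of `2 n` elements. -/
noncomputable def pfList {α : Type} (A : α → α → ℂ) : ℕ → List α → ℂ
  | 0, _ => 1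
  | _ + 1, [] => 0
  | n + 1, x :: xs => ((removals xs).map fun r => r.1 * A x r.2.1 * pfList A n r.2.2).sum

lemma removals_append {α : Type} (xs ys : List α) : removals (xs ++ ys) =
    ((removals xs).map fun r => (r.1, r.2.1, r.2.2 ++ ys)) ++
      (removals ys).map fun r => ((-1) ^ xs.length * r.1, r.2.1, xs ++ r.2.2) := by
  induction xs with
  | nil => simp [removals]
  | cons x xs ih =>
    simp [removals, ih, Function.comp_def, pow_succ]

lemma removals_map {α β : Type} (f : α → β) (xs : List α) : removals (xs.map f) =
    (removals xs).map fun r => (r.1, f r.2.1, r.2.2.map f) := by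
  induction xs with
  | nil => simp [removals]
  | cons x xs ih => simp [removals, ih, Function.comp_def]

lemma removals_ofFn {α : Type} {m : ℕ} (g : Fin (m + 1) → α) : removals (List.ofFn g) =
    List.ofFn fun j : Fin (m + 1) =>
      ((-1) ^ (j : ℕ), g j, List.ofFn fun x => g (j.succAbove x)) := by
  induction m with
  | zero => simp [removals]
  | succ m ih =>
    rw [List.ofFn_succ, removals, ih, List.ofFn_succ (n := m + 1), List.map_ofFn]
    congr 2
    funext j
    simp [List.ofFn_succ, pow_succ]

/-- The list of all fermions of a list of blocks. -/
def blockFlat (L : List (List ℕ × ℂ)) : List (ℕ × ℂ) := L.flatMap fun b => b.1.map fun p => (p, b.2)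

/-- The block signs are exactly the position signs in the concatenated list, so the recursion for
torus functions becomes the expansion of `pfList`. -/
lemma removals_blockFlat (L : List (List ℕ × ℂ)) : removals (blockFlat L) =
    (blockRemovals L).map fun r => (r.1, r.2.1, blockFlat r.2.2) := by
  induction L with
  | nil => simp [blockFlat, blockRemovals, removals]
  | cons b L ih =>
    obtain ⟨ps, z⟩ := b
    have h : ∀ ps, blockFlat ((ps, z) :: L) = ps.map (fun p => (p, z)) ++ blockFlat L :=
      fun _ => rfl
    rw [h, removals_append, ih, removals_map, blockRemovals]
    simp [Function.comp_def, blockFlat]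

lemma twist_idKernel (z : ℂ) : twist z idKernel = idKernel := by
  funext S T
  unfold twist idKernel
  split_ifs with h
  · subst h; simp
  · simp

lemma kernelMul_idKernel (P : Kernel) : kernelMul idKernel P = P := by
  funext S U
  simp [kernelMul, idKernel]

lemma blockTrace_nil_cons (θ : ℂ) (τ : UpperHalfPlane) (z : ℂ) (L : List (List ℕ × ℂ)) :
    blockTrace θ τ (([], z) :: L) = blockTrace θ τ L := by
  rw [blockTrace, blockProd_cons, squareVector, vertexKernel_vacuum, twist_idKernel,
    kernelMul_idKernel]
  rfl

lemma IsAdmissible.tail {α β : ℝ} {z : ℂ} {zs : List ℂ} (h : IsAdmissible α β (z :: zs)) :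
    IsAdmissible α β zs :=
  ⟨h.lt, (List.pairwise_cons.mp h.ordered).2, fun x hx => h.bound x (by simp [hx])⟩

lemma length_blockFlat_of_mem {L : List (List ℕ × ℂ)} {r : ℂ × (ℕ × ℂ) × List (List ℕ × ℂ)}
    (h : r ∈ blockRemovals L) : (blockFlat r.2.2).length + 1 = (blockFlat L).length := by
  have h1 : (r.1, r.2.1, blockFlat r.2.2) ∈ removals (blockFlat L) := by
    rw [removals_blockFlat]; exact List.mem_map_of_mem h
  exact length_of_mem_removals h1

/-- Outer induction on the number of pairs. The inner induction discards empty blocks in front,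
which carry the identity matrix, until a fermion is available for `blockTrace_cons`. -/
lemma blockTrace_eq_pfList {θ : ℂ} (hθ : θ = 1 ∨ θ = -1) {τ : UpperHalfPlane} {α β : ℝ}
    (hαβ : α < β + Real.pi * τ.im) (n : ℕ) {L : List (List ℕ × ℂ)}
    (h : IsAdmissible α β (L.map Prod.snd)) (hl : (blockFlat L).length = 2 * n) :
    blockTrace θ τ L = pfList (pairEntry θ τ) n (blockFlat L) * torusTrace θ τ idKernel := by
  induction n generalizing L with
  | zero =>
    induction L with
    | nil => simp [blockTrace, blockProd, prodKernel, pfList]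
    | cons b L ih =>
      obtain ⟨ps, z⟩ := b
      cases ps with
      | nil => rw [blockTrace_nil_cons]; exact ih h.tail hl
      | cons p ps => simp [blockFlat] at hl
  | succ n ihn =>
    induction L with
    | nil => simp [blockFlat] at hl
    | cons b L ih =>
      obtain ⟨ps, z⟩ := b
      cases ps with
      | nil => rw [blockTrace_nil_cons]; exact ih h.tail hl
      | cons p ps =>
        have e : blockFlat ((p :: ps, z) :: L) = (p, z) :: blockFlat ((ps, z) :: L) := rfl
        rw [e] at hl ⊢
        have hc := blockTrace_cons hθ hαβ (p := p) (ps := ps) (z := z) (L := L) h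
        rw [hc, pfList, removals_blockFlat, List.map_map,
          ← List.sum_map_mul_right]
        congr 1
        refine List.map_congr_left fun r hr => ?_
        have h1 := length_blockFlat_of_mem hr
        rw [List.length_cons] at hl
        rw [ihn (by rw [(of_mem_blockRemovals hr).2]; exact h) (by omega), Function.comp, ← mul_assoc]

lemma blockTrace_eq_zero {θ : ℂ} (hθ : θ = 1 ∨ θ = -1) {τ : UpperHalfPlane} {α β : ℝ}
    (hαβ : α < β + Real.pi * τ.im) (n : ℕ) {L : List (List ℕ × ℂ)}
    (h : IsAdmissible α β (L.map Prod.snd)) (hl : (blockFlat L).length = 2 * n + 1) :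
    blockTrace θ τ L = 0 := by
  induction n generalizing L with
  | zero =>
    induction L with
    | nil => simp [blockFlat] at hl
    | cons b L ih =>
      obtain ⟨ps, z⟩ := b
      cases ps with
      | nil => rw [blockTrace_nil_cons]; exact ih h.tail hl
      | cons p ps =>
        have e : blockFlat ((p :: ps, z) :: L) = (p, z) :: blockFlat ((ps, z) :: L) := rfl
        rw [e, List.length_cons] at hl
        -- A lone fermion has no partner, so its recursion is an empty sum.
        have h0 : blockRemovals ((ps, z) :: L) = [] := by
          rw [List.eq_nil_iff_forall_not_mem]
          intro r hr
          have := length_blockFlat_of_mem hr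
          omega
        rw [blockTrace_cons hθ hαβ h, h0]
        simp
  | succ n ihn =>
    induction L with
    | nil => simp [blockFlat] at hl
    | cons b L ih =>
      obtain ⟨ps, z⟩ := b
      cases ps with
      | nil => rw [blockTrace_nil_cons]; exact ih h.tail hl
      | cons p ps =>
        have e : blockFlat ((p :: ps, z) :: L) = (p, z) :: blockFlat ((ps, z) :: L) := rfl
        rw [e, List.length_cons] at hl
        have hc := blockTrace_cons hθ hαβ (p := p) (ps := ps) (z := z) (L := L) h
        rw [hc]
        refine List.sum_eq_zero fun x hx => ?_
        obtain ⟨r, hr, rfl⟩ := List.mem_map.mp hx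
        have h1 := length_blockFlat_of_mem hr
        rw [ihn (by rw [(of_mem_blockRemovals hr).2]; exact h) (by omega), mul_zero]

/-! ### Row expansion of the Pfaffian -/

/-- The permutation `(j, t 0, t 1, …)` with the values of `t` relabelled to avoid `j`. -/
def consPerm {m : ℕ} (j : Fin (m + 1)) (t : Equiv.Perm (Fin m)) : Equiv.Perm (Fin (m + 1)) :=
  j.cycleRange.symm * Equiv.Perm.decomposeFin.symm (0, t)

lemma consPerm_zero {m : ℕ} (j : Fin (m + 1)) (t : Equiv.Perm (Fin m)) : consPerm j t 0 = j := by
  simp [consPerm]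

lemma consPerm_succ {m : ℕ} (j : Fin (m + 1)) (t : Equiv.Perm (Fin m)) (i : Fin m) :
    consPerm j t i.succ = j.succAbove (t i) := by
  simp [consPerm]

lemma sign_consPerm {m : ℕ} (j : Fin (m + 1)) (t : Equiv.Perm (Fin m)) :
    Equiv.Perm.sign (consPerm j t) = (-1) ^ (j : ℕ) * Equiv.Perm.sign t := by
  rw [consPerm, Equiv.Perm.sign_mul, Equiv.Perm.sign_symm, Fin.sign_cycleRange]
  simp

lemma consPerm_bijective (m : ℕ) :
    Function.Bijective fun x : Fin (m + 1) × Equiv.Perm (Fin m) => consPerm x.1 x.2 := by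
  rw [Fintype.bijective_iff_injective_and_card]
  constructor
  · rintro ⟨j, t⟩ ⟨j', t'⟩ h
    have h' : consPerm j t = consPerm j' t' := h
    have h0 := DFunLike.congr_fun h' 0
    rw [consPerm_zero, consPerm_zero] at h0
    subst h0
    congr 1
    ext i
    have h1 := DFunLike.congr_fun h' i.succ
    rw [consPerm_succ, consPerm_succ] at h1
    rw [Fin.succAbove_right_injective h1]
  · simp [Fintype.card_perm, Nat.factorial_succ]

lemma sum_perm_succ {m : ℕ} (F : Equiv.Perm (Fin (m + 1)) → ℂ) :
    ∑ s, F s = ∑ j, ∑ t, F (consPerm j t) := by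
  rw [← Fintype.sum_prod_type']
  exact (Function.Bijective.sum_comp (consPerm_bijective m) F).symm

/-- The first element of the `a`-th pair. -/
def pairFst {n : ℕ} (a : Fin n) : Fin (2 * n) := ⟨2 * a, by omega⟩

/-- The second element of the `a`-th pair. -/
def pairSnd {n : ℕ} (a : Fin n) : Fin (2 * n) := ⟨2 * a + 1, by omega⟩

lemma isPairing_iff {n : ℕ} (s : Equiv.Perm (Fin (2 * n))) : IsPairing s ↔
    (∀ a : Fin n, s (pairFst a) < s (pairSnd a)) ∧
      ∀ a b : Fin n, a < b → s (pairFst a) < s (pairFst b) := by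
  have h : 2 * n / 2 = n := by omega
  constructor
  · rintro ⟨h1, h2⟩
    exact ⟨fun a => h1 ⟨a, by omega⟩, fun a b hab => h2 ⟨a, by omega⟩ ⟨b, by omega⟩ hab⟩
  · rintro ⟨h1, h2⟩
    exact ⟨fun a => h1 ⟨a, by omega⟩, fun a b hab => h2 ⟨a, by omega⟩ ⟨b, by omega⟩ hab⟩

/-- First elements increase and each is less than its partner, so the first entry is the minimum of
all values. -/
lemma IsPairing.apply_zero {n : ℕ} {s : Equiv.Perm (Fin (2 * (n + 1)))} (h : IsPairing s) :
    s 0 = 0 := by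
  rw [isPairing_iff] at h
  have hall : ∀ i, s 0 ≤ s i := by
    intro i
    have key : ∀ a : Fin (n + 1), s 0 ≤ s (pairFst a) := by
      intro a
      rcases Fin.eq_zero_or_eq_succ a with rfl | ⟨b, rfl⟩
      · exact le_rfl
      · exact (h.2 0 b.succ (Fin.succ_pos b)).le
    rcases Nat.even_or_odd' (i : ℕ) with ⟨c, hc | hc⟩
    · have : i = pairFst ⟨c, by omega⟩ := Fin.ext hc
      rw [this]; exact key _
    · have : i = pairSnd ⟨c, by omega⟩ := Fin.ext hc
      rw [this]; exact (key _).trans (h.1 _).le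
  have h0 := hall (s.symm 0)
  rw [Equiv.apply_symm_apply] at h0
  exact Fin.le_zero_iff.mp h0

lemma consPerm_pairFst_zero {n : ℕ} (j : Fin (2 * n + 1)) (t : Equiv.Perm (Fin (2 * n))) :
    consPerm 0 (consPerm j t) (pairFst (0 : Fin (n + 1))) = 0 := consPerm_zero _ _

lemma consPerm_pairSnd_zero {n : ℕ} (j : Fin (2 * n + 1)) (t : Equiv.Perm (Fin (2 * n))) :
    consPerm 0 (consPerm j t) (pairSnd (0 : Fin (n + 1))) = j.succ := by
  have h : (pairSnd (0 : Fin (n + 1)) : Fin (2 * n + 1 + 1)) = Fin.succ 0 := rfl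
  rw [h, consPerm_succ, consPerm_zero, Fin.zero_succAbove]

lemma consPerm_pairFst_succ {n : ℕ} (j : Fin (2 * n + 1)) (t : Equiv.Perm (Fin (2 * n)))
    (a : Fin n) : consPerm 0 (consPerm j t) (pairFst a.succ) =
      (j.succAbove (t (pairFst a))).succ := by
  have h : (pairFst a.succ : Fin (2 * n + 1 + 1)) = (pairFst a).succ.succ :=
    Fin.ext (by simp [pairFst]; omega)
  rw [h, consPerm_succ, consPerm_succ, Fin.zero_succAbove]

lemma consPerm_pairSnd_succ {n : ℕ} (j : Fin (2 * n + 1)) (t : Equiv.Perm (Fin (2 * n)))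
    (a : Fin n) : consPerm 0 (consPerm j t) (pairSnd a.succ) =
      (j.succAbove (t (pairSnd a))).succ := by
  have h : (pairSnd a.succ : Fin (2 * n + 1 + 1)) = (pairSnd a).succ.succ :=
    Fin.ext (by simp [pairSnd]; omega)
  rw [h, consPerm_succ, consPerm_succ, Fin.zero_succAbove]

lemma isPairing_consPerm {n : ℕ} (j : Fin (2 * n + 1)) (t : Equiv.Perm (Fin (2 * n))) :
    IsPairing (N := 2 * (n + 1)) (consPerm 0 (consPerm j t)) ↔ IsPairing t := by
  have hlt : ∀ x y, (j.succAbove x).succ < (j.succAbove y).succ ↔ x < y := fun x y =>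
    Fin.succ_lt_succ_iff.trans (Fin.strictMono_succAbove j).lt_iff_lt
  have key : IsPairing (N := 2 * (n + 1)) (consPerm 0 (consPerm j t)) ↔
      (∀ a : Fin (n + 1), consPerm 0 (consPerm j t) (pairFst a) <
        consPerm 0 (consPerm j t) (pairSnd a)) ∧
      ∀ a b : Fin (n + 1), a < b → consPerm 0 (consPerm j t) (pairFst a) <
        consPerm 0 (consPerm j t) (pairFst b) := isPairing_iff (n := n + 1) _
  rw [key, isPairing_iff t]
  simp only [Fin.forall_fin_succ, consPerm_pairFst_zero, consPerm_pairSnd_zero,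
    consPerm_pairFst_succ, consPerm_pairSnd_succ, hlt, Fin.succ_pos, Fin.succ_lt_succ_iff,
    Fin.not_lt_zero, true_and, false_imp_iff, implies_true]

open Classical in
lemma pfaffian_eq_sum {n : ℕ} (M : Matrix (Fin (2 * n)) (Fin (2 * n)) ℂ) : pfaffian M =
    ∑ s : Equiv.Perm (Fin (2 * n)), if IsPairing s then
      ((Equiv.Perm.sign s : ℤ) : ℂ) * ∏ a : Fin n, M (s (pairFst a)) (s (pairSnd a)) else 0 := by
  have h : 2 * n / 2 = n := by omega
  refine Finset.sum_congr rfl fun s _ => ?_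
  congr 2
  exact Fintype.prod_equiv (finCongr h) _ _ fun a => rfl

/-- A pairing permutation starts with `0`, followed by the partner `j.succ` and a pairing of the
rest. Writing it as `consPerm 0 (consPerm j t)` makes the sign `(-1)^j` times that of `t`. -/
lemma pfaffian_succ {n : ℕ} (M : Matrix (Fin (2 * (n + 1))) (Fin (2 * (n + 1))) ℂ) :
    pfaffian M = ∑ j : Fin (2 * n + 1), (-1) ^ (j : ℕ) * M 0 j.succ *
      pfaffian (Matrix.of fun x y : Fin (2 * n) =>
        M (j.succAbove x).succ (j.succAbove y).succ) := by
  classical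
  rw [pfaffian_eq_sum]
  change ∑ s : Equiv.Perm (Fin (2 * n + 1 + 1)), _ = _
  rw [sum_perm_succ, Finset.sum_eq_single 0]
  · rw [sum_perm_succ]
    refine Finset.sum_congr rfl fun j _ => ?_
    rw [pfaffian_eq_sum, Finset.mul_sum]
    refine Finset.sum_congr rfl fun t _ => ?_
    simp only [isPairing_consPerm]
    split_ifs with h
    · rw [sign_consPerm, sign_consPerm, Fin.prod_univ_succ]
      erw [consPerm_pairFst_zero, consPerm_pairSnd_zero]
      have hp : ∀ a : Fin n, M (consPerm 0 (consPerm j t) (pairFst a.succ))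
          (consPerm 0 (consPerm j t) (pairSnd a.succ)) =
          M (j.succAbove (t (pairFst a))).succ (j.succAbove (t (pairSnd a))).succ := fun a => by
        rw [consPerm_pairFst_succ, consPerm_pairSnd_succ]
      simp only [hp, Matrix.of_apply]
      push_cast
      simp only [Fin.val_zero, pow_zero, one_mul]
      ring
    · rw [mul_zero]
  · intro i _ hi
    refine Finset.sum_eq_zero fun e _ => if_neg fun h => hi ?_
    have := h.apply_zero
    rwa [← consPerm_zero i e]
  · simp

lemma pfaffian_eq_pfList {α : Type} (A : α → α → ℂ) {n : ℕ} (f : Fin (2 * n) → α) :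
    pfaffian (Matrix.of fun x y => A (f x) (f y)) = pfList A n (List.ofFn f) := by
  induction n with
  | zero =>
    have : Subsingleton (Equiv.Perm (Fin (2 * 0))) :=
      ⟨fun a b => Equiv.ext fun i => absurd i.2 (by omega)⟩
    rw [pfaffian_eq_sum, pfList, Fintype.sum_subsingleton _ 1, if_pos]
    · simp
    · rw [isPairing_iff]
      exact ⟨fun a => a.elim0, fun a => a.elim0⟩
  | succ n ih =>
    rw [pfaffian_succ]
    have e : List.ofFn f = f 0 :: List.ofFn fun i : Fin (2 * n + 1) => f i.succ :=
      List.ofFn_succ (n := 2 * n + 1)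
    rw [e, pfList, removals_ofFn, List.map_ofFn, List.sum_ofFn]
    refine Finset.sum_congr rfl fun j _ => ?_
    simp only [Function.comp]
    rw [← ih]
    rfl

end FreeFermion

namespace FreeFermion

/-! ### The torus functions as Pfaffians -/

/-- The offset is the prefix sum of the block sizes used by `finSigmaFinEquiv`, so list
concatenation and the indexing of the block matrix agree. -/
lemma getElem?_flatten_ofFn {α : Type} {n : ℕ} {m : Fin n → ℕ} (h : (a : Fin n) → Fin (m a) → α)
    (a : Fin n) (i : Fin (m a)) : (List.ofFn fun a => List.ofFn (h a)).flatten[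
      ∑ b : Fin (a : ℕ), m (Fin.castLE a.2.le b) + (i : ℕ)]? = some (h a i) := by
  induction n with
  | zero => exact a.elim0
  | succ n ih =>
    rw [List.ofFn_succ, List.flatten_cons]
    rcases Fin.eq_zero_or_eq_succ a with rfl | ⟨a, rfl⟩
    · have e : ∑ b : Fin ((0 : Fin (n + 1)) : ℕ), m (Fin.castLE (0 : Fin (n + 1)).2.le b) = 0 :=
        Finset.sum_of_isEmpty (ι := Fin 0) _
      rw [e, zero_add, List.getElem?_append_left (by simp)]
      simp
    · have e : ∑ b : Fin (a.succ : ℕ), m (Fin.castLE a.succ.2.le b) =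
          m 0 + ∑ b : Fin (a : ℕ), m (Fin.castLE a.2.le b).succ :=
        Fin.sum_univ_succ (n := a) _
      rw [e, add_assoc, List.getElem?_append_right (by simp), List.length_ofFn,
        Nat.add_sub_cancel_left]
      exact ih (fun a => h a.succ) a i

lemma flatten_ofFn {α : Type} {n : ℕ} {m : Fin n → ℕ} (h : (a : Fin n) → Fin (m a) → α) :
    (List.ofFn fun a => List.ofFn (h a)).flatten =
      List.ofFn fun x => h (finSigmaFinEquiv.symm x).1 (finSigmaFinEquiv.symm x).2 := by
  refine List.ext_getElem ?_ fun j h1 h2 => Option.some_injective _ ?_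
  · simp [List.length_flatten, List.map_ofFn, List.sum_ofFn, Function.comp_def]
  · rw [List.length_ofFn] at h2
    rw [← List.getElem?_eq_getElem, List.getElem_ofFn]
    have e := finSigmaFinEquiv_apply (finSigmaFinEquiv.symm (⟨j, h2⟩ : Fin (∑ a, m a)))
    rw [Equiv.apply_symm_apply] at e
    change j = _ at e
    rw [← getElem?_flatten_ofFn h, ← e]

lemma creationCoeff_zero_zero : creationCoeff 0 0 = 1 := by
  have h := sum_binomZ_mul_creationCoeff 0 0
  simpa [binomZ_zero] using h

lemma squareVector_zero : squareVector [0] = fermion := by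
  rw [squareVector, squareVector, squareCreation, LinearMap.add_apply, annihilationSum_vacuum,
    add_zero, Finset.sum_range_one, creationCoeff_zero_zero, one_smul, vacuum, creation_fockBasis]
  simp [orderSign, fermion]

lemma prod_squareMode (ps : List ℕ) :
    (ps.map fun p => squareMode fermion (-((p + 1 : ℕ) : ℤ))).prod vacuum = squareVector ps := by
  induction ps with
  | nil => rfl
  | cons p ps ih =>
    rw [List.map_cons, List.prod_cons, Module.End.mul_apply, ih, squareMode_fermion]
    rfl

lemma squareFock_eq {m : ℕ} {k : Fin m → ℕ} (hk : ∀ i, 1 ≤ k i) :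
    squareFock k = squareVector (List.ofFn fun i => k i - 1) := by
  have e : (fun i => squareMode fermion (-(k i : ℤ))) =
      (fun p => squareMode fermion (-((p + 1 : ℕ) : ℤ))) ∘ fun i => k i - 1 := by
    funext i
    rw [Function.comp, Nat.sub_add_cancel (hk i)]
  rw [← prod_squareMode, squareFock, List.map_ofFn, e]

lemma exists_isAdmissible {n : ℕ} {τ : UpperHalfPlane} {z : Fin n → ℂ}
    (hz : z ∈ orderedDomain n τ) :
    ∃ α β : ℝ, α < β + Real.pi * τ.im ∧ IsAdmissible α β (List.ofFn z) := by
  rw [mem_orderedDomain_iff] at hz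
  set δ := Real.pi * τ.im with hδ
  have hδ0 : 0 < δ := mul_pos Real.pi_pos τ.im_pos
  obtain ⟨α, hα1, hα2⟩ := Order.exists_between_finsets
    (Finset.univ.image fun i => (z i).re / 2) (Finset.univ.image fun i => (z i).re / 2 + δ) (by
      intro a ha b hb
      simp only [Finset.mem_image, Finset.mem_univ, true_and] at ha hb
      obtain ⟨i, rfl⟩ := ha
      obtain ⟨j, rfl⟩ := hb
      rcases lt_trichotomy i j with h | h | h
      · have := (hz i j h).2; linarith
      · subst h; linarith
      · have := (hz j i h).1; linarith)
  obtain ⟨β, hβ1, hβ2⟩ := Order.exists_between_finsets {α - δ}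
    (insert α (Finset.univ.image fun i => (z i).re / 2)) (by
      intro a ha b hb
      simp only [Finset.mem_singleton] at ha
      subst ha
      simp only [Finset.mem_insert, Finset.mem_image, Finset.mem_univ, true_and] at hb
      rcases hb with rfl | ⟨i, rfl⟩
      · linarith
      · have := hα2 ((z i).re / 2 + δ) (by simp); linarith)
  refine ⟨α, β, by have := hβ1 (α - δ) (by simp); linarith, hβ2 α (by simp), ?_, ?_⟩
  · exact List.pairwise_ofFn.mpr fun i j hij => (hz i j hij).1
  · intro x hx
    obtain ⟨i, rfl⟩ := (List.mem_ofFn' _ _).mp hx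
    exact ⟨hβ2 _ (by simp), hα1 _ (by simp)⟩

lemma theta_eq {g : Module.End ℂ Fock} {θ : ℂ}
    (hg : (g = 1 ∧ θ = 1) ∨ (g = parity ∧ θ = -1)) : θ = 1 ∨ θ = -1 :=
  hg.imp And.right And.right

lemma nPoint_eq_blockTrace {g : Module.End ℂ Fock} {θ : ℂ}
    (hg : (g = 1 ∧ θ = 1) ∨ (g = parity ∧ θ = -1)) {τ : UpperHalfPlane} {n : ℕ}
    (ps : Fin n → List ℕ) {z : Fin n → ℂ} (hz : z ∈ orderedDomain n τ) :
    nPoint g (fun a => squareVector (ps a)) τ z =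
      blockTrace θ τ (List.ofFn fun a => (ps a, z a)) := by
  rw [nPoint_eq_torusTrace hg _ hz, blockTrace, blockProd, List.map_ofFn]
  rfl

lemma nPoint_eq_pfList {g : Module.End ℂ Fock} {θ : ℂ}
    (hg : (g = 1 ∧ θ = 1) ∨ (g = parity ∧ θ = -1)) {τ : UpperHalfPlane} {n N : ℕ}
    (ps : Fin n → List ℕ) {z : Fin n → ℂ} (hz : z ∈ orderedDomain n τ)
    (hl : (blockFlat (List.ofFn fun a => (ps a, z a))).length = 2 * N) :
    nPoint g (fun a => squareVector (ps a)) τ z =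
      pfList (pairEntry θ τ) N (blockFlat (List.ofFn fun a => (ps a, z a))) *
        partitionFunction g τ := by
  obtain ⟨α, β, hαβ, h⟩ := exists_isAdmissible hz
  rw [nPoint_eq_blockTrace hg ps hz, partitionFunction_eq hg]
  exact blockTrace_eq_pfList (theta_eq hg) hαβ N (by rw [List.map_ofFn]; exact h) hl

lemma nPoint_eq_zero {g : Module.End ℂ Fock} {θ : ℂ}
    (hg : (g = 1 ∧ θ = 1) ∨ (g = parity ∧ θ = -1)) {τ : UpperHalfPlane} {n N : ℕ}
    (ps : Fin n → List ℕ) {z : Fin n → ℂ} (hz : z ∈ orderedDomain n τ)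
    (hl : (blockFlat (List.ofFn fun a => (ps a, z a))).length = 2 * N + 1) :
    nPoint g (fun a => squareVector (ps a)) τ z = 0 := by
  obtain ⟨α, β, hαβ, h⟩ := exists_isAdmissible hz
  rw [nPoint_eq_blockTrace hg ps hz]
  exact blockTrace_eq_zero (theta_eq hg) hαβ N (by rw [List.map_ofFn]; exact h) hl

lemma blockFlat_ofFn {n : ℕ} {m : Fin n → ℕ} (p : (a : Fin n) → Fin (m a) → ℕ) (z : Fin n → ℂ) :
    blockFlat (List.ofFn fun a => (List.ofFn (p a), z a)) = List.ofFn fun x : Fin (∑ a, m a) =>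
      (p (finSigmaFinEquiv.symm x).1 (finSigmaFinEquiv.symm x).2, z (finSigmaFinEquiv.symm x).1) := by
  rw [← flatten_ofFn fun a i => (p a i, z a), blockFlat, List.flatMap_def, List.map_ofFn]
  congr 2
  funext a
  exact List.map_ofFn

lemma pfaffian_of_even {α : Type} (A : α → α → ℂ) {N n : ℕ} (hN : N = 2 * n) (f : Fin N → α) :
    pfaffian (Matrix.of fun x y => A (f x) (f y)) = pfList A n (List.ofFn f) := by
  subst hN
  exact pfaffian_eq_pfList A f

lemma orderedDomain_subset (n : ℕ) (τ : UpperHalfPlane) : orderedDomain n τ ⊆ fullDomain n τ := by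
  intro z hz i j hij
  have key : ∀ i j : Fin n, i < j → z j - z i ∈ puncturedStrip τ := fun i j h =>
    leftStrip_subset τ (mem_leftStrip_iff.mpr (hz i j h))
  rcases lt_or_gt_of_ne hij with h | h
  · rw [← neg_sub]; exact neg_mem_puncturedStrip (key i j h)
  · exact key j i h

lemma injective_of_mem_orderedDomain {n : ℕ} {τ : UpperHalfPlane} {z : Fin n → ℂ}
    (hz : z ∈ orderedDomain n τ) : Function.Injective z := by
  intro i j hij
  by_contra hne
  have h := mem_puncturedStrip_iff.mp (orderedDomain_subset n τ hz i j hne)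
  exact h.2.2 (by rw [hij, sub_self, Complex.exp_zero])

lemma isOpen_orderedDomain (n : ℕ) (τ : UpperHalfPlane) : IsOpen (orderedDomain n τ) := by
  have e : orderedDomain n τ = ⋂ i : Fin n, ⋂ j : Fin n, ⋂ _ : i < j,
      {z | ‖qPow τ 1‖ < ‖Complex.exp (z j - z i)‖ ∧ ‖Complex.exp (z j - z i)‖ < 1} := by
    ext z; simp [orderedDomain]
  rw [e]
  refine isOpen_iInter_of_finite fun i => isOpen_iInter_of_finite fun j =>
    isOpen_iInter_of_finite fun _ => ?_
  have hc : Continuous fun z : Fin n → ℂ => ‖Complex.exp (z j - z i)‖ := by fun_prop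
  exact (isOpen_lt continuous_const hc).inter (isOpen_lt hc continuous_const)

lemma matrixM_apply {n : ℕ} {m : Fin n → ℕ} (θ : ℂ) (k : (a : Fin n) → Fin (m a) → ℕ)
    (τ : UpperHalfPlane) (z : Fin n → ℂ) (x y : Fin (∑ a, m a)) : matrixM θ k τ z x y =
      if (finSigmaFinEquiv.symm x).1 = (finSigmaFinEquiv.symm y).1 then
        coeffC θ (1 / 2) (k (finSigmaFinEquiv.symm x).1 (finSigmaFinEquiv.symm x).2)
          (k (finSigmaFinEquiv.symm y).1 (finSigmaFinEquiv.symm y).2) τ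
      else coeffD θ (1 / 2) (k (finSigmaFinEquiv.symm x).1 (finSigmaFinEquiv.symm x).2)
          (k (finSigmaFinEquiv.symm y).1 (finSigmaFinEquiv.symm y).2) τ
          (z (finSigmaFinEquiv.symm x).1 - z (finSigmaFinEquiv.symm y).1) := rfl

/-- `pairEntry` tells blocks apart by their insertion points, the matrix by their indices; on the
ordered domain the points are distinct. -/
lemma matrixM_eq_pairEntry {n : ℕ} {m : Fin n → ℕ} (θ : ℂ) {k : (a : Fin n) → Fin (m a) → ℕ}
    (hk : ∀ a i, 1 ≤ k a i) {τ : UpperHalfPlane} {z : Fin n → ℂ} (hz : z ∈ orderedDomain n τ) :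
    matrixM θ k τ z = Matrix.of fun x y => pairEntry θ τ
      (k (finSigmaFinEquiv.symm x).1 (finSigmaFinEquiv.symm x).2 - 1,
        z (finSigmaFinEquiv.symm x).1)
      (k (finSigmaFinEquiv.symm y).1 (finSigmaFinEquiv.symm y).2 - 1,
        z (finSigmaFinEquiv.symm y).1) := by
  ext x y
  simp only [matrixM_apply, Matrix.of_apply, pairEntry, Nat.sub_add_cancel (hk _ _),
    (injective_of_mem_orderedDomain hz).eq_iff]

lemma transpose_matrixM {n : ℕ} {m : Fin n → ℕ} {θ : ℂ} (hθ : θ = 1 ∨ θ = -1)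
    {k : (a : Fin n) → Fin (m a) → ℕ} (hk : ∀ a i, 1 ≤ k a i) {τ : UpperHalfPlane} {z : Fin n → ℂ}
    (hz : z ∈ fullDomain n τ) : (matrixM θ k τ z).transpose = -matrixM θ k τ z := by
  ext x y
  rw [Matrix.transpose_apply, Matrix.neg_apply, matrixM_apply, matrixM_apply]
  generalize finSigmaFinEquiv.symm x = x'
  generalize finSigmaFinEquiv.symm y = y'
  obtain ⟨p, hp⟩ := Nat.exists_eq_add_of_le' (hk x'.1 x'.2)
  obtain ⟨r, hr⟩ := Nat.exists_eq_add_of_le' (hk y'.1 y'.2)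
  rw [hp, hr]
  by_cases h : y'.1 = x'.1
  · rw [if_pos h, if_pos h.symm, coeffC_antisymm hθ]
  · rw [if_neg h, if_neg (Ne.symm h), coeffD_antisymm hθ _ _ (hz _ _ h), neg_sub]

lemma transpose_matrixP {n : ℕ} {θ : ℂ} (hθ : θ = 1 ∨ θ = -1) {τ : UpperHalfPlane} {z : Fin n → ℂ}
    (hz : z ∈ fullDomain n τ) : (matrixP θ τ z).transpose = -matrixP θ τ z := by
  ext i j
  rw [Matrix.transpose_apply, Matrix.neg_apply, matrixP, Matrix.of_apply, Matrix.of_apply]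
  by_cases h : j = i
  · rw [if_pos h, if_pos h.symm, neg_zero]
  · rw [if_neg h, if_neg (Ne.symm h), ← neg_sub (z i) (z j),
      twistedWeierstrass_neg hθ 0 (hz i j (Ne.symm h))]
    simp

lemma matrixP_eq_pairEntry {n : ℕ} {θ : ℂ} (hθ : θ = 1 ∨ θ = -1) {τ : UpperHalfPlane}
    {z : Fin n → ℂ} (hz : z ∈ orderedDomain n τ) :
    matrixP θ τ z = Matrix.of fun i j => pairEntry θ τ (0, z i) (0, z j) := by
  ext i j
  simp only [matrixP, Matrix.of_apply, pairEntry, (injective_of_mem_orderedDomain hz).eq_iff]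
  have hE := twistedEisenstein_of_odd hθ τ (p := 0) Even.zero
  -- The zero diagonal of the matrix is consistent with `C(1,1)` because `E_1` vanishes.
  have hC : coeffC θ (1 / 2) (0 + 1) (0 + 1) τ = 0 := by
    rw [coeffC, show 0 + 1 + (0 + 1) - 1 = 0 + 1 from rfl, hE, mul_zero]
  congr 1
  · exact hC.symm
  · simp [coeffD]

lemma analyticOnNhd_matrixM {n : ℕ} {m : Fin n → ℕ} {θ : ℂ} (hθ : θ = 1 ∨ θ = -1)
    {k : (a : Fin n) → Fin (m a) → ℕ} (hk : ∀ a i, 1 ≤ k a i) (τ : UpperHalfPlane)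
    (x y : Fin (∑ a, m a)) :
    AnalyticOnNhd ℂ (fun z => matrixM θ k τ z x y) (fullDomain n τ) := by
  intro z hz
  simp only [matrixM_apply]
  generalize finSigmaFinEquiv.symm x = x'
  generalize finSigmaFinEquiv.symm y = y'
  by_cases h : x'.1 = y'.1
  · simp only [if_pos h]
    exact analyticAt_const
  · simp only [if_neg h, coeffD]
    obtain ⟨p, hp⟩ := Nat.exists_eq_add_of_le' (hk x'.1 x'.2)
    obtain ⟨r, hr⟩ := Nat.exists_eq_add_of_le' (hk y'.1 y'.2)
    rw [hp, hr, show p + 1 + (r + 1) - 1 = p + r + 1 by omega]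
    refine analyticAt_const.mul ?_
    have h1 := analyticOnNhd_twistedWeierstrass hθ τ (p + r) (z x'.1 - z y'.1) (hz _ _ h)
    have h2 : AnalyticAt ℂ (fun w : Fin n → ℂ => w x'.1 - w y'.1) z := by
      have e : ∀ i : Fin n, AnalyticAt ℂ (fun w : Fin n → ℂ => w i) z := fun i =>
        (ContinuousLinearMap.proj (R := ℂ) (φ := fun _ : Fin n => ℂ) i).analyticAt z
      exact (e _).sub (e _)
    exact AnalyticAt.fun_comp h1 h2

lemma analyticOnNhd_pfaffian {E : Type*} [NormedAddCommGroup E] [NormedSpace ℂ E] {N : ℕ}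
    {M : E → Matrix (Fin N) (Fin N) ℂ} {s : Set E}
    (h : ∀ x y, AnalyticOnNhd ℂ (fun z => M z x y) s) :
    AnalyticOnNhd ℂ (fun z => pfaffian (M z)) s := by
  intro z hz
  refine Finset.analyticAt_fun_sum _ fun t _ => ?_
  split_ifs
  · exact analyticAt_const.mul (Finset.analyticAt_fun_prod _ fun a _ => h _ _ z hz)
  · exact analyticAt_const

lemma nPoint_squareFock {g : Module.End ℂ Fock} {θ : ℂ}
    (hg : (g = 1 ∧ θ = 1) ∨ (g = parity ∧ θ = -1)) {τ : UpperHalfPlane} {n : ℕ} {m : Fin n → ℕ}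
    {k : (a : Fin n) → Fin (m a) → ℕ} (hk : ∀ a i, 1 ≤ k a i) (he : Even (∑ a, m a))
    {z : Fin n → ℂ} (hz : z ∈ orderedDomain n τ) :
    nPoint g (fun a => squareFock (k a)) τ z =
      pfaffian (matrixM θ k τ z) * partitionFunction g τ := by
  obtain ⟨N, hN⟩ := he.exists_two_nsmul
  rw [smul_eq_mul] at hN
  simp only [squareFock_eq (hk _)]
  rw [nPoint_eq_pfList hg _ hz (by rw [blockFlat_ofFn, List.length_ofFn, hN]), blockFlat_ofFn,
    matrixM_eq_pairEntry θ hk hz, pfaffian_of_even (pairEntry θ τ) hN fun x =>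
      (k (finSigmaFinEquiv.symm x).1 (finSigmaFinEquiv.symm x).2 - 1, z (finSigmaFinEquiv.symm x).1)]

lemma nPoint_squareFock_of_odd {g : Module.End ℂ Fock} {θ : ℂ}
    (hg : (g = 1 ∧ θ = 1) ∨ (g = parity ∧ θ = -1)) {τ : UpperHalfPlane} {n : ℕ} {m : Fin n → ℕ}
    {k : (a : Fin n) → Fin (m a) → ℕ} (hk : ∀ a i, 1 ≤ k a i) (ho : Odd (∑ a, m a))
    {z : Fin n → ℂ} (hz : z ∈ orderedDomain n τ) :
    nPoint g (fun a => squareFock (k a)) τ z = 0 := by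
  obtain ⟨N, hN⟩ := ho
  simp only [squareFock_eq (hk _)]
  exact nPoint_eq_zero hg _ hz (by rw [blockFlat_ofFn, List.length_ofFn, hN])

lemma convergesAnalytically_squareFock {g : Module.End ℂ Fock} {θ : ℂ}
    (hg : (g = 1 ∧ θ = 1) ∨ (g = parity ∧ θ = -1)) (τ : UpperHalfPlane) {n : ℕ} {m : Fin n → ℕ}
    {k : (a : Fin n) → Fin (m a) → ℕ} (hk : ∀ a i, 1 ≤ k a i) :
    ConvergesAnalytically g (fun a => squareFock (k a)) τ := by
  refine ⟨fun z hz => summable_norm_nPointTerm hg _ hz,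
    fun K hK hc => hasSumUniformlyOn_nPointTerm hg _ hK hc, ?_⟩
  rcases Nat.even_or_odd (∑ a, m a) with h | h
  -- Analyticity is taken from the Pfaffian formula rather than from a limit theorem in several
  -- variables.
  · refine AnalyticOnNhd.congr (isOpen_orderedDomain n τ) ?_ fun z hz =>
      (nPoint_squareFock hg hk h hz).symm
    exact fun z hz => (analyticOnNhd_pfaffian (analyticOnNhd_matrixM (theta_eq hg) hk τ) z
      (orderedDomain_subset n τ hz)).mul analyticAt_const
  · exact AnalyticOnNhd.congr (isOpen_orderedDomain n τ) (fun _ _ => analyticAt_const)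
      fun z hz => (nPoint_squareFock_of_odd hg hk h hz).symm

lemma squareFock_one : squareFock (fun _ : Fin 1 => 1) = fermion := by
  rw [squareFock_eq fun _ => le_rfl, ← squareVector_zero]
  simp

lemma generatingFunction_eq {g : Module.End ℂ Fock} {θ : ℂ}
    (hg : (g = 1 ∧ θ = 1) ∨ (g = parity ∧ θ = -1)) {τ : UpperHalfPlane} {n : ℕ} (hn : Even n)
    {z : Fin n → ℂ} (hz : z ∈ orderedDomain n τ) :
    generatingFunction n g τ z = pfaffian (matrixP θ τ z) * partitionFunction g τ := by
  obtain ⟨N, hN⟩ := hn.exists_two_nsmul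
  rw [smul_eq_mul] at hN
  have e : blockFlat (List.ofFn fun a : Fin n => ([0], z a)) = List.ofFn fun a => (0, z a) := by
    rw [blockFlat, List.flatMap_def, List.map_ofFn]
    change (List.ofFn ((fun x => [x]) ∘ fun a => ((0 : ℕ), z a))).flatten = _
    rw [← List.map_ofFn, ← List.flatMap_def, List.flatMap_singleton']
  rw [generatingFunction, ← squareVector_zero,
    nPoint_eq_pfList hg (fun _ => [0]) hz (N := N) (by rw [e, List.length_ofFn, hN]), e,
    matrixP_eq_pairEntry (theta_eq hg) hz,
    pfaffian_of_even (pairEntry θ τ) hN fun a => ((0 : ℕ), z a)]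

end FreeFermion

/-! ### Assembly of the three statements -/

theorem mainTheorem5 (τ : UpperHalfPlane) (g : Module.End ℂ FreeFermion.Fock) (θ : ℂ)
    (hg : (g = 1 ∧ θ = 1) ∨ (g = FreeFermion.parity ∧ θ = -1)) :
    (∀ n : ℕ, Even n →
      FreeFermion.ConvergesAnalytically g (fun _ : Fin n => FreeFermion.fermion) τ ∧
      ∀ z ∈ FreeFermion.orderedDomain n τ,
        (FreeFermion.matrixP θ τ z).transpose = -FreeFermion.matrixP θ τ z ∧
        FreeFermion.generatingFunction n g τ z =
          FreeFermion.pfaffian (FreeFermion.matrixP θ τ z) *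
            FreeFermion.partitionFunction g τ) ∧
    (∀ (n : ℕ) (m : Fin n → ℕ) (k : (a : Fin n) → Fin (m a) → ℕ),
      (∀ a i, 1 ≤ k a i) → (∀ a, StrictMono (k a)) →
      FreeFermion.ConvergesAnalytically g (fun a => FreeFermion.squareFock (k a)) τ ∧
      (Odd (∑ a, m a) → ∀ z ∈ FreeFermion.orderedDomain n τ,
        FreeFermion.nPoint g (fun a => FreeFermion.squareFock (k a)) τ z = 0) ∧
      (Even (∑ a, m a) →
        (∀ z ∈ FreeFermion.orderedDomain n τ,
          (FreeFermion.matrixM θ k τ z).transpose = -FreeFermion.matrixM θ k τ z ∧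
          FreeFermion.nPoint g (fun a => FreeFermion.squareFock (k a)) τ z =
            FreeFermion.pfaffian (FreeFermion.matrixM θ k τ z) *
              FreeFermion.partitionFunction g τ) ∧
        AnalyticOnNhd ℂ
          (fun z => FreeFermion.pfaffian (FreeFermion.matrixM θ k τ z) *
            FreeFermion.partitionFunction g τ)
          (FreeFermion.fullDomain n τ))) := by
  have hθ := FreeFermion.theta_eq hg
  refine ⟨fun n hn => ⟨?_, fun z hz => ⟨FreeFermion.transpose_matrixP hθ
    (FreeFermion.orderedDomain_subset n τ hz), FreeFermion.generatingFunction_eq hg hn hz⟩⟩,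
    fun n m k hk _ => ⟨FreeFermion.convergesAnalytically_squareFock hg τ hk,
      fun ho z hz => FreeFermion.nPoint_squareFock_of_odd hg hk ho hz,
      fun he => ⟨fun z hz => ⟨FreeFermion.transpose_matrixM hθ hk
        (FreeFermion.orderedDomain_subset n τ hz), FreeFermion.nPoint_squareFock hg hk he hz⟩,
        fun z hz => (FreeFermion.analyticOnNhd_pfaffian
          (FreeFermion.analyticOnNhd_matrixM hθ hk τ) z hz).mul analyticAt_const⟩⟩⟩
  -- Since `ψ = ψ[-1] 𝟏`, the convergence claim for the generating function is a case of the one for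
  -- square bracket vectors.
  rw [← FreeFermion.squareFock_one]
  exact FreeFermion.convergesAnalytically_squareFock hg τ (k := fun _ : Fin n => fun _ : Fin 1 => 1)
    fun _ _ => le_rfl
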